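/- Let $R=\mathbb{C}[x_1,\dots,x_n]$, graded by $\deg x_i=1$. Let $D\subset X=\mathbb{C}^n$ be a reduced central hyperplane arrangement, that is, a union of finitely many pairwise distinct hyperplanes through the origin, and let $f=\prod_k \ell_k\in R$ be its reduced defining equation, where the $\ell_k$ are linear forms defining these hyperplanes. Assume that $D$ is essential, that is, the intersection of all its hyperplanes is $\{0\}$. For $j\in\mathbb{Z}$ let $$M^j=\Gamma\bigl(X,\Omega_X^j(\log D)\bigr)$$ be the $R$-module of global algebraic logarithmic $j$-forms, that is, of rational differential $j$-forms $\eta$ on $\mathbb{C}^n$ such that $f\eta$ and $f\,d\eta$ have polynomial coefficients. It is graded by $\deg x_i=\deg dx_i=1$: a form $\sum_{|I|=j}\eta_I\,dx_I$ has degree $k$ if each $\eta_I$ is a homogeneous rational function of degree $k-j$ (or zero). Then for every $j\in\mathbb{Z}$ the module $M^j$ is a finitely generated graded $R$-module and $$\operatorname{reg} M^j\le 0 .$$ Here the Castelnuovo–Mumford regularity of a finitely generated graded $R$-module $M$ is $$\operatorname{reg} M=\max_{i,k}\,(c_{i,k}-i),$$ where $\cdots\to F_i\to\cdots\to F_0\to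 M\to 0$ with $F_i=\bigoplus_k R(-c_{i,k})$ is a minimal graded free resolution (and $\operatorname{reg} 0=-\infty$). -/

import Mathlib

noncomputable section

namespace LogForms

open MvPolynomial

/-! ### Graded modules over `R = ℂ[x₁, …, xₙ]` and Castelnuovo-Mumford regularity -/

/-- The coordinate ring `R = ℂ[x₁, …, xₙ]` of `ℂⁿ`, graded by `deg xᵢ = 1`. -/
abbrev PolyRing (n : ℕ) : Type := MvPolynomial (Fin n) ℂ

/-- The degree `e` part of `R` for an integer `e` (it is zero for `e < 0`). -/
def polyHomogeneous (n : ℕ) (e : ℤ) : Submodule ℂ (PolyRing n) where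
  carrier := {p | ∀ m ∈ p.support, (m.degree : ℤ) = e}
  zero_mem' := by simp
  add_mem' := by
    intro p q hp hq m hm
    rcases Finset.mem_union.1 (MvPolynomial.support_add hm) with h | h
    · exact hp m h
    · exact hq m h
  smul_mem' := by
    intro c p hp m hm
    exact hp m (MvPolynomial.support_smul hm)

/-- The family `𝓜` of `ℂ`-subspaces makes the `R`-module `M` a `ℤ`-graded `R`-module:
`M = ⨁ₖ 𝓜 k` and `Rₑ 𝓜 k ⊆ 𝓜 (e + k)`. -/
structure IsGradedModule {n : ℕ} {M : Type*} [AddCommGroup M] [Module (PolyRing n) M] [Module ℂ M]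
    (𝓜 : ℤ → Submodule ℂ M) : Prop where
  isInternal : DirectSum.IsInternal 𝓜
  smul_mem : ∀ (e k : ℤ) (p : PolyRing n) (m : M),
    p ∈ polyHomogeneous n e → m ∈ 𝓜 k → p • m ∈ 𝓜 (e + k)

/-- The degree `e` part of the graded free module `⨁ₖ R(-cₖ)`, whose `k`-th basis vector has
degree `cₖ`. -/
def freeGrading (n : ℕ) {r : ℕ} (c : Fin r → ℤ) (e : ℤ) : Submodule ℂ (Fin r → PolyRing n) where
  carrier := {v | ∀ k, v k ∈ polyHomogeneous n (e - c k)}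
  zero_mem' := fun k => (polyHomogeneous n (e - c k)).zero_mem
  add_mem' := fun hv hw k => (polyHomogeneous n (e - c k)).add_mem (hv k) (hw k)
  smul_mem' := fun a _ hv k => (polyHomogeneous n (e - c k)).smul_mem a (hv k)

/-- A minimal graded free resolution `⋯ → F₁ → F₀ → M → 0` of a graded `R`-module, with
`F_j = ⨁ₖ R(-c_{j,k})` of finite rank: the maps preserve degrees, the sequence is exact, and the
image of each `F_{j+1} → F_j` is contained in `𝔪 F_j`, where `𝔪 = (x₁, …, xₙ)`. -/
structure MinimalGradedFreeResolution {n : ℕ} {M : Type*} [AddCommGroup M] [Module (PolyRing n) M]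
    [Module ℂ M] (𝓜 : ℤ → Submodule ℂ M) where
  rank : ℕ → ℕ
  c : (j : ℕ) → Fin (rank j) → ℤ
  ε : (Fin (rank 0) → PolyRing n) →ₗ[PolyRing n] M
  d : (j : ℕ) → (Fin (rank (j + 1)) → PolyRing n) →ₗ[PolyRing n] (Fin (rank j) → PolyRing n)
  ε_degree : ∀ (e : ℤ), ∀ v ∈ freeGrading n (c 0) e, ε v ∈ 𝓜 e
  d_degree : ∀ (j : ℕ) (e : ℤ), ∀ v ∈ freeGrading n (c (j + 1)) e, d j v ∈ freeGrading n (c j) e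
  ε_surjective : Function.Surjective ε
  exact_zero : Function.Exact (d 0) ε
  exact_succ : ∀ j, Function.Exact (d (j + 1)) (d j)
  minimal : ∀ j v l, d j v l ∈ Ideal.span (Set.range (X : Fin n → PolyRing n))

/-- The Castelnuovo-Mumford regularity `reg M = max_{j,k} (c_{j,k} - j)` of a finitely generated
graded `R`-module, with values in `ℤ ∪ {-∞, ∞}` and `reg 0 = -∞`. The maximum does not depend on
the minimal graded free resolution, as this is unique up to isomorphism; so the infimum over all
of them is their common value. (It is `∞` when there is no such resolution, so that a bound
`reg M ≤ r` with `r` finite contains the existence of one.) -/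
def regularity {n : ℕ} {M : Type*} [AddCommGroup M] [Module (PolyRing n) M] [Module ℂ M]
    (𝓜 : ℤ → Submodule ℂ M) : WithBot (WithTop ℤ) :=
  ⨅ F : MinimalGradedFreeResolution (n := n) 𝓜,
    ⨆ (j : ℕ) (k : Fin (F.rank j)), (((F.c j k - (j : ℤ) : ℤ) : WithTop ℤ) : WithBot (WithTop ℤ))

/-! ### Rational functions -/

/-- The field `ℂ(x₁, …, xₙ)`. -/
abbrev RatFun (n : ℕ) : Type := FractionRing (PolyRing n)

/-- A numerator of a rational function. -/
def num {n : ℕ} (g : RatFun n) : PolyRing n := (IsLocalization.sec (nonZeroDivisors (PolyRing n)) g).1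

/-- The corresponding denominator. -/
def den {n : ℕ} (g : RatFun n) : PolyRing n := (IsLocalization.sec (nonZeroDivisors (PolyRing n)) g).2

theorem den_ne_zero {n : ℕ} (g : RatFun n) : den g ≠ 0 :=
  nonZeroDivisors.ne_zero (IsLocalization.sec (nonZeroDivisors (PolyRing n)) g).2.2

theorem coe_ne_zero {n : ℕ} {q : PolyRing n} (hq : q ≠ 0) : algebraMap (PolyRing n) (RatFun n) q ≠ 0 :=
  fun h => hq (IsFractionRing.injective (PolyRing n) (RatFun n) (by simpa using h))

theorem num_div_den {n : ℕ} (g : RatFun n) :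
    algebraMap (PolyRing n) (RatFun n) (num g) / algebraMap (PolyRing n) (RatFun n) (den g) = g := by
  rw [div_eq_iff (coe_ne_zero (den_ne_zero g))]
  exact (IsLocalization.sec_spec (nonZeroDivisors (PolyRing n)) g).symm

/-- The quotient rule for `∂/∂xᵢ` applied to the fraction `p / q`. -/
def quotientRule {n : ℕ} (i : Fin n) (p q : PolyRing n) : RatFun n :=
  algebraMap (PolyRing n) (RatFun n) (pderiv i p * q - p * pderiv i q) /
    algebraMap (PolyRing n) (RatFun n) q ^ 2

theorem quotientRule_congr {n : ℕ} (i : Fin n) {p q p' q' : PolyRing n} (hq : q ≠ 0) (hq' : q' ≠ 0)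
    (h : p * q' = p' * q) : quotientRule i p q = quotientRule i p' q' := by
  have h1 : pderiv i p * q' + p * pderiv i q' = pderiv i p' * q + p' * pderiv i q := by
    have := congrArg (pderiv i) h
    rw [pderiv_mul, pderiv_mul] at this
    exact this
  have h2 : (pderiv i p * q - p * pderiv i q) * q' ^ 2 =
      (pderiv i p' * q' - p' * pderiv i q') * q ^ 2 := by
    linear_combination (q * q') * h1 - (pderiv i q' * q + pderiv i q * q') * h
  have h3 := congrArg (algebraMap (PolyRing n) (RatFun n)) h2
  rw [map_mul, map_mul, map_pow, map_pow] at h3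
  unfold quotientRule
  rw [div_eq_div_iff (pow_ne_zero 2 (coe_ne_zero hq)) (pow_ne_zero 2 (coe_ne_zero hq'))]
  exact h3

/-- The partial derivative `∂/∂xᵢ` on `ℂ(x₁, …, xₙ)`, given by the quotient rule. -/
def ratPartialFun {n : ℕ} (i : Fin n) (g : RatFun n) : RatFun n := quotientRule i (num g) (den g)

theorem ratPartialFun_div {n : ℕ} (i : Fin n) (p q : PolyRing n) (hq : q ≠ 0) :
    ratPartialFun i (algebraMap (PolyRing n) (RatFun n) p / algebraMap (PolyRing n) (RatFun n) q) =
      quotientRule i p q := by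
  set g := algebraMap (PolyRing n) (RatFun n) p / algebraMap (PolyRing n) (RatFun n) q with hg
  refine quotientRule_congr i (den_ne_zero g) hq ?_
  have h := num_div_den g
  rw [hg, ← hg, hg, div_eq_div_iff (coe_ne_zero (den_ne_zero g)) (coe_ne_zero hq),
    ← map_mul, ← map_mul] at h
  exact IsFractionRing.injective (PolyRing n) (RatFun n) h

theorem exists_div {n : ℕ} (g : RatFun n) : ∃ p q : PolyRing n, q ≠ 0 ∧
    g = algebraMap (PolyRing n) (RatFun n) p / algebraMap (PolyRing n) (RatFun n) q :=
  ⟨num g, den g, den_ne_zero g, (num_div_den g).symm⟩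

theorem ratPartialFun_add {n : ℕ} (i : Fin n) (g h : RatFun n) :
    ratPartialFun i (g + h) = ratPartialFun i g + ratPartialFun i h := by
  obtain ⟨p, q, hq, rfl⟩ := exists_div g
  obtain ⟨r, s, hs, rfl⟩ := exists_div h
  rw [div_add_div _ _ (coe_ne_zero hq) (coe_ne_zero hs), ← map_mul, ← map_mul, ← map_mul,
    ← map_add, ratPartialFun_div _ _ _ (mul_ne_zero hq hs), ratPartialFun_div _ _ _ hq,
    ratPartialFun_div _ _ _ hs]
  have := coe_ne_zero hq
  have := coe_ne_zero hs
  simp only [quotientRule, pderiv_mul, map_add, map_sub, map_mul]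
  field_simp
  ring

theorem ratPartialFun_mul {n : ℕ} (i : Fin n) (g h : RatFun n) :
    ratPartialFun i (g * h) = g * ratPartialFun i h + h * ratPartialFun i g := by
  obtain ⟨p, q, hq, rfl⟩ := exists_div g
  obtain ⟨r, s, hs, rfl⟩ := exists_div h
  rw [div_mul_div_comm, ← map_mul, ← map_mul, ratPartialFun_div _ _ _ (mul_ne_zero hq hs),
    ratPartialFun_div _ _ _ hq, ratPartialFun_div _ _ _ hs]
  have := coe_ne_zero hq
  have := coe_ne_zero hs
  simp only [quotientRule, pderiv_mul, map_add, map_sub, map_mul]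
  field_simp
  ring

theorem ratPartialFun_coe {n : ℕ} (i : Fin n) (p : PolyRing n) :
    ratPartialFun i (algebraMap (PolyRing n) (RatFun n) p) =
      algebraMap (PolyRing n) (RatFun n) (pderiv i p) := by
  have h := ratPartialFun_div i p 1 one_ne_zero
  simpa [quotientRule] using h

/-- `∂/∂xᵢ` as a `ℂ`-linear derivation of `ℂ(x₁, …, xₙ)`. -/
def ratPartial {n : ℕ} (i : Fin n) : Derivation ℂ (RatFun n) (RatFun n) :=
  Derivation.mk'
    { toFun := ratPartialFun i
      map_add' := ratPartialFun_add i
      map_smul' := by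
        intro a g
        have h : a • g = algebraMap (PolyRing n) (RatFun n) (C a) * g := by
          rw [Algebra.smul_def, IsScalarTower.algebraMap_apply ℂ (PolyRing n) (RatFun n),
            MvPolynomial.algebraMap_eq]
        rw [h, ratPartialFun_mul, ratPartialFun_coe, pderiv_C, map_zero, mul_zero, add_zero,
          RingHom.id_apply, Algebra.smul_def, IsScalarTower.algebraMap_apply ℂ (PolyRing n) (RatFun n),
          MvPolynomial.algebraMap_eq] }
    (fun g h => ratPartialFun_mul i g h)

theorem ratPartial_coe {n : ℕ} (i : Fin n) (p : PolyRing n) :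
    ratPartial i (algebraMap (PolyRing n) (RatFun n) p) = algebraMap (PolyRing n) (RatFun n) (pderiv i p) :=
  ratPartialFun_coe i p

/-- The homogeneous rational functions of degree `e`: zero, and the quotients `p / q` of
homogeneous polynomials with `deg p - deg q = e`. -/
def ratHomogeneous (n : ℕ) (e : ℤ) : Submodule ℂ (RatFun n) where
  carrier := {g | g = 0 ∨ ∃ (a b : ℕ) (p q : PolyRing n), p.IsHomogeneous a ∧ q.IsHomogeneous b ∧
    q ≠ 0 ∧ (a : ℤ) - b = e ∧
    g = algebraMap (PolyRing n) (RatFun n) p / algebraMap (PolyRing n) (RatFun n) q}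
  zero_mem' := Or.inl rfl
  add_mem' := by
    rintro g h (rfl | ⟨a, b, p, q, hp, hq, hq0, rfl, rfl⟩) hh
    · simpa using hh
    · rcases hh with rfl | ⟨a', b', p', q', hp', hq', hq0', he, rfl⟩
      · exact Or.inr ⟨a, b, p, q, hp, hq, hq0, rfl, by simp⟩
      · refine Or.inr ⟨a + b', b + b', p * q' + q * p', q * q', ?_, hq.mul hq',
          mul_ne_zero hq0 hq0', by push_cast; ring, ?_⟩
        · have h1 : b + a' = a + b' := by omega
          have h2 := hq.mul hp'
          rw [h1] at h2
          exact (hp.mul hq').add h2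
        · rw [div_add_div _ _ (coe_ne_zero hq0) (coe_ne_zero hq0')]
          simp
  smul_mem' := by
    rintro c g (rfl | ⟨a, b, p, q, hp, hq, hq0, rfl, rfl⟩)
    · left; simp
    · refine Or.inr ⟨a, b, C c * p, q, hp.C_mul c, hq, hq0, rfl, ?_⟩
      rw [Algebra.smul_def, IsScalarTower.algebraMap_apply ℂ (PolyRing n) (RatFun n),
        MvPolynomial.algebraMap_eq, map_mul, mul_div_assoc]

/-! ### Rational and logarithmic differential forms on `ℂⁿ` -/

/-- A rational differential form `∑_I η_I dx_I` on `ℂⁿ` (not necessarily of pure degree), given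
by its coefficients. Here `dx_I = dx_{i₁} ∧ ⋯ ∧ dx_{i_j}` for `I = {i₁ < ⋯ < i_j}`. -/
abbrev RatForm (n : ℕ) : Type := Finset (Fin n) → RatFun n

/-- The form has polynomial coefficients. -/
def IsPolynomialForm {n : ℕ} (η : RatForm n) : Prop :=
  ∀ I, η I ∈ (algebraMap (PolyRing n) (RatFun n)).range

/-- The exterior derivative `d(∑_I η_I dx_I) = ∑_I ∑_i (∂η_I/∂xᵢ) dxᵢ ∧ dx_I`; here
`dxᵢ ∧ dx_{J ∖ i} = (-1)^s dx_J` for `i ∈ J`, with `s` the number of elements of `J` below `i`. -/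
def exteriorD {n : ℕ} (η : RatForm n) : RatForm n := fun J =>
  ∑ i ∈ J, (-1 : RatFun n) ^ (J.filter (· < i)).card * ratPartial i (η (J.erase i))

/-- The `R`-module of global algebraic logarithmic `j`-forms of the divisor `f = 0` in `ℂⁿ`: the
rational `j`-forms `η` such that `f η` and `f dη` have polynomial coefficients. -/
def logForms {n : ℕ} (f : PolyRing n) (j : ℤ) : Submodule (PolyRing n) (RatForm n) where
  carrier := {η | (∀ I, (I.card : ℤ) ≠ j → η I = 0) ∧ IsPolynomialForm (f • η) ∧
    IsPolynomialForm (f • exteriorD η)}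
  zero_mem' := by
    refine ⟨fun _ _ => rfl, fun I => ?_, fun I => ?_⟩
    · simp
    · simp [exteriorD]
  add_mem' := by
    rintro η θ ⟨h1, h2, h3⟩ ⟨h1', h2', h3'⟩
    have hd : exteriorD (η + θ) = exteriorD η + exteriorD θ := by
      funext J
      simp [exteriorD, mul_add, Finset.sum_add_distrib]
    refine ⟨fun I hI => by simp [h1 I hI, h1' I hI], fun I => ?_, fun I => ?_⟩
    · rw [smul_add]
      exact add_mem (h2 I) (h2' I)
    · rw [hd, smul_add]
      exact add_mem (h3 I) (h3' I)
  smul_mem' := by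
    rintro r η ⟨h1, h2, h3⟩
    refine ⟨fun I hI => by simp [h1 I hI], fun I => ?_, fun J => ?_⟩
    · rw [smul_comm]
      have := mul_mem (RingHom.mem_range_self (algebraMap (PolyRing n) (RatFun n)) r) (h2 I)
      rwa [← Algebra.smul_def] at this
    · have hd : (f • exteriorD (r • η)) J =
          algebraMap (PolyRing n) (RatFun n) r * (f • exteriorD η) J +
          ∑ i ∈ J, (-1 : RatFun n) ^ (J.filter (· < i)).card *
            (algebraMap (PolyRing n) (RatFun n) (pderiv i r) * (f • η) (J.erase i)) := by
        have hs : ∀ (p : PolyRing n) (θ : RatForm n) (I : Finset (Fin n)),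
            (p • θ) I = algebraMap (PolyRing n) (RatFun n) p * θ I :=
          fun p θ I => Algebra.smul_def p (θ I)
        simp only [hs, exteriorD, Derivation.leibniz, ratPartial_coe, smul_eq_mul, Finset.mul_sum,
          ← Finset.sum_add_distrib]
        refine Finset.sum_congr rfl fun i _ => ?_
        ring
      rw [hd]
      refine add_mem (mul_mem (RingHom.mem_range_self _ r) (h3 J)) (sum_mem fun i _ => ?_)
      exact mul_mem (pow_mem (neg_mem (one_mem _)) _)
        (mul_mem (RingHom.mem_range_self _ _) (h2 _))

/-- The degree `k` part of the module of logarithmic `j`-forms, for the grading with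
`deg xᵢ = deg dxᵢ = 1`: each coefficient `η_I` is homogeneous of degree `k - |I|`. -/
def logGrading {n : ℕ} (f : PolyRing n) (j k : ℤ) : Submodule ℂ (logForms f j) where
  carrier := {η | ∀ I, (η : RatForm n) I ∈ ratHomogeneous n (k - I.card)}
  zero_mem' := fun I => (ratHomogeneous n (k - I.card)).zero_mem
  add_mem' := fun hη hθ I => (ratHomogeneous n (k - I.card)).add_mem (hη I) (hθ I)
  smul_mem' := fun a _ hη I => (ratHomogeneous n (k - I.card)).smul_mem a (hη I)

/-! ### Hyperplane arrangements -/

/-- A reduced central hyperplane arrangement in `ℂⁿ`: finitely many pairwise distinct hyperplanes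
through the origin, each given as the kernel of a nonzero linear form. -/
structure CentralArrangement (n : ℕ) where
  size : ℕ
  form : Fin size → Module.Dual ℂ (Fin n → ℂ)
  form_ne_zero : ∀ k, form k ≠ 0
  distinct : Function.Injective fun k => LinearMap.ker (form k)

/-- The arrangement is essential: its hyperplanes meet only in the origin. -/
def CentralArrangement.IsEssential {n : ℕ} (D : CentralArrangement n) : Prop :=
  ⨅ k, LinearMap.ker (D.form k) = ⊥

/-- The reduced defining equation, the product of the linear forms. -/
def CentralArrangement.equation {n : ℕ} (D : CentralArrangement n) : PolyRing n :=
  ∏ k, ∑ i, C (D.form k (Pi.single i 1)) * X i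

end LogForms

end

/-!
Let `f` be the product of the linear forms `ℓ_k`, `d` in number. Multiplication by `f` identifies
the logarithmic `j`-forms with the polynomial `j`-forms `ω` such that `ℓ_k` divides `dℓ_k ∧ ω` for
all `k` (`CentralArrangement.divForm_mem_logForms_equation`); this uses `f dη = dω - df ∧ η` for
`ω = f η` and that the `ℓ_k` are pairwise coprime. All form degrees can be treated at once, in a
graded submodule `N(D)` of a free module (`logMod`), and the claim becomes `reg N(D) ≤ d`.

For `d` hyperplanes of rank `r` in `ℂᵐ`, essential or not, the bound is `reg N(D) ≤ d + m - r`
(`resolutionLE_logMod`), proved by induction on `d`. The regularity is used in two forms: as a bound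
on the degrees of a free resolution (`ResolutionLE`), and as vanishing of the graded pieces of the
cohomology of the Čech complexes on the variables (`RegularityLE`); they are equivalent by the long
exact sequences of Čech cohomology, the computation of the Čech cohomology of `R`, and the fact that
a module of regularity at most `ρ` is generated in degrees at most `ρ`. Resolutions are compatible
with adding variables to the polynomial ring, so one may assume that the hyperplanes have rank `n`,
while the exterior algebra keeps `m` generators; in suitable coordinates, `x₁, …, xₙ` are then among
the `ℓ_k`.

* If one of these hyperplanes `xᵢ = 0` is independent of all the other hyperplanes, contraction with
  a vector field killed by the other forms splits off its contribution
  (`RegularityLE.logMod_insert`).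
* Otherwise, let `x_T` be the product of the `xᵢ` with `i ∈ T`, and `D ∖ T` the arrangement without
  the corresponding hyperplanes. The modules `N_T = x_T N(D ∖ T)` satisfy
  `xᵢ N_T ⊆ N_{T ∪ i} ⊆ N_T`. In the double complex made of their Čech complexes, every row in which
  some `xᵢ` has been inverted is contractible, so that for `p ≥ 1` the Čech cohomology of
  `N_∅ = N(D)` vanishes in degree `p` as soon as that of `N_T` does in degree `p + |T| - 1` for all
  `T ≠ ∅` (`GradedPieces.exactAt_of_family`). Removing `T` loses rank at most `|T| - 1`, so the
  induction hypothesis bounds the regularity of `N_T` by `d + m - r + |T| - 1`, which is what is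
  needed.

The same double complex for `N_T = x_T N` gives the statement on generators
(`RegularityLE.exists_sum_X_smul`), and from it minimal resolutions with the required degrees
(`regularity_le_of_regularityLE`).
-/

noncomputable section

namespace LogForms

open MvPolynomial

/-! ### Exterior multiplication and contraction on functions of finite subsets -/

section Exterior

variable {n : ℕ} {A B : Type*} [AddCommGroup A] [AddCommGroup B]

/-- The sign `(-1)^s`, with `s` the number of elements of `S` below `i`, by which
`dxᵢ ∧ dx_{S ∖ i}` differs from `dx_S` when `i ∈ S`. -/
def koszulSign (i : Fin n) (S : Finset (Fin n)) : ℤ := (-1) ^ (S.filter (· < i)).card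

theorem koszulSign_mul_self (i : Fin n) (S : Finset (Fin n)) :
    koszulSign i S * koszulSign i S = 1 := by
  rw [koszulSign, ← mul_pow]
  simp

theorem koszulSign_insert (i k : Fin n) (S : Finset (Fin n)) (hk : k ∉ S) :
    koszulSign i (insert k S) = if k < i then -koszulSign i S else koszulSign i S := by
  unfold koszulSign
  rw [Finset.filter_insert]
  split_ifs with h
  · rw [Finset.card_insert_of_notMem (by simp [hk]), pow_succ]
    ring
  · rfl

theorem koszulSign_erase (i k : Fin n) (S : Finset (Fin n)) (hk : k ∈ S) :
    koszulSign i (S.erase k) = if k < i then -koszulSign i S else koszulSign i S := by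
  have h := koszulSign_insert i k (S.erase k) (Finset.notMem_erase k S)
  rw [Finset.insert_erase hk] at h
  split_ifs at h ⊢ <;> simp [h]

/-- Exterior multiplication by `dxᵢ` on forms `∑_S c_S dx_S` with coefficients in an abelian
group. The form is encoded by its coefficients `c`. -/
def wedge (i : Fin n) : (Finset (Fin n) → A) →+ (Finset (Fin n) → A) where
  toFun c S := if i ∈ S then koszulSign i S • c (S.erase i) else 0
  map_zero' := by ext; simp
  map_add' c c' := by ext S; by_cases h : i ∈ S <;> simp [h]

/-- Contraction with the `i`-th coordinate vector field on forms `∑_S c_S dx_S`. -/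
def contr (i : Fin n) : (Finset (Fin n) → A) →+ (Finset (Fin n) → A) where
  toFun c S := if i ∈ S then 0 else koszulSign i S • c (insert i S)
  map_zero' := by ext; simp
  map_add' c c' := by ext S; by_cases h : i ∈ S <;> simp [h]

theorem wedge_apply (i : Fin n) (c : Finset (Fin n) → A) (S : Finset (Fin n)) :
    wedge i c S = if i ∈ S then koszulSign i S • c (S.erase i) else 0 := rfl

theorem contr_apply (i : Fin n) (c : Finset (Fin n) → A) (S : Finset (Fin n)) :
    contr i c S = if i ∈ S then 0 else koszulSign i S • c (insert i S) := rfl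

theorem wedge_comp (f : A →+ B) (i : Fin n) (c : Finset (Fin n) → A) :
    wedge i (fun S => f (c S)) = fun S => f (wedge i c S) := by
  ext S
  by_cases h : i ∈ S <;> simp [wedge_apply, h]

theorem contr_comp (f : A →+ B) (i : Fin n) (c : Finset (Fin n) → A) :
    contr i (fun S => f (c S)) = fun S => f (contr i c S) := by
  ext S
  by_cases h : i ∈ S <;> simp [contr_apply, h]

theorem wedge_wedge_self (i : Fin n) (c : Finset (Fin n) → A) : wedge i (wedge i c) = 0 := by
  ext S
  simp [wedge_apply]

theorem contr_contr_self (i : Fin n) (c : Finset (Fin n) → A) : contr i (contr i c) = 0 := by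
  ext S
  simp [contr_apply]

theorem wedge_wedge (i k : Fin n) (c : Finset (Fin n) → A) :
    wedge i (wedge k c) + wedge k (wedge i c) = 0 := by
  rcases eq_or_ne i k with rfl | hik
  · simp [wedge_wedge_self]
  ext S
  by_cases hi : i ∈ S
  · by_cases hk : k ∈ S
    · have h1 := koszulSign_erase k i S hi
      have h2 := koszulSign_erase i k S hk
      simp only [Pi.add_apply, wedge_apply, hi, hk, Finset.mem_erase, hik, hik.symm, h1, h2,
        Finset.erase_right_comm (a := k) (b := i), ne_eq, not_false_eq_true, and_self, if_true,
        smul_smul, ← add_smul]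
      rcases lt_or_gt_of_ne hik with h | h
      · simp [h, h.not_gt, mul_comm]
      · simp [h, h.not_gt, mul_comm]
    · simp [wedge_apply, hi, hk]
  · simp [wedge_apply, hi]

theorem contr_contr (i k : Fin n) (c : Finset (Fin n) → A) :
    contr i (contr k c) + contr k (contr i c) = 0 := by
  rcases eq_or_ne i k with rfl | hik
  · simp [contr_contr_self]
  ext S
  by_cases hi : i ∈ S
  · simp [contr_apply, hi]
  · by_cases hk : k ∈ S
    · simp [contr_apply, hi, hk]
    · have h1 := koszulSign_insert k i S hi
      have h2 := koszulSign_insert i k S hk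
      simp only [Pi.add_apply, contr_apply, hi, hk, Finset.mem_insert, hik, hik.symm, h1, h2,
        Finset.insert_comm k i, or_self, if_false, smul_smul, ← add_smul]
      rcases lt_or_gt_of_ne hik with h | h
      · simp [h, h.not_gt, mul_comm]
      · simp [h, h.not_gt, mul_comm]

theorem wedge_contr (i k : Fin n) (c : Finset (Fin n) → A) :
    wedge i (contr k c) + contr k (wedge i c) = if i = k then c else 0 := by
  split_ifs with hik
  · subst hik
    ext S
    by_cases hi : i ∈ S
    · have h1 := koszulSign_erase i i S hi
      simp [wedge_apply, contr_apply, hi, h1, smul_smul, koszulSign_mul_self]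
    · have h1 := koszulSign_insert i i S hi
      simp [wedge_apply, contr_apply, hi, h1, smul_smul, koszulSign_mul_self]
  · ext S
    by_cases hi : i ∈ S
    · by_cases hk : k ∈ S
      · simp [wedge_apply, contr_apply, hi, hk, Ne.symm hik]
      · have h1 := koszulSign_erase k i S hi
        have h2 := koszulSign_insert i k S hk
        simp only [Pi.add_apply, wedge_apply, contr_apply, hi, hk, Finset.mem_insert,
          Finset.mem_erase, hik, h1, h2, Finset.erase_insert_of_ne (Ne.symm hik),
          smul_smul, ← add_smul, or_true, if_true, and_false, if_false]
        rcases lt_or_gt_of_ne hik with h | h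
        · simp [h, h.not_gt, mul_comm]
        · simp [h, h.not_gt, mul_comm]
    · simp [wedge_apply, contr_apply, hi, hik]

/-- Exterior multiplication by `∑ᵢ dxᵢ`, which is the simplicial coboundary (Čech differential). -/
def cobd : (Finset (Fin n) → A) →+ (Finset (Fin n) → A) := ∑ i, wedge i

/-- Contraction with the sum of the coordinate vector fields: the simplicial boundary. -/
def bd : (Finset (Fin n) → A) →+ (Finset (Fin n) → A) := ∑ i, contr i

theorem cobd_apply (c : Finset (Fin n) → A) : cobd c = ∑ i, wedge i c := by
  simp [cobd, AddMonoidHom.finsetSum_apply]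

theorem bd_apply (c : Finset (Fin n) → A) : bd c = ∑ i, contr i c := by
  simp [bd, AddMonoidHom.finsetSum_apply]

theorem cobd_comp (f : A →+ B) (c : Finset (Fin n) → A) :
    cobd (fun S => f (c S)) = fun S => f (cobd c S) := by
  ext S
  simp [cobd_apply, wedge_comp]

theorem cobd_eval {ι : Type*} (c : Finset (Fin n) → ι → A) (t : ι) :
    cobd (fun S => c S t) = fun S => cobd c S t :=
  cobd_comp (Pi.evalAddMonoidHom (fun _ : ι => A) t) c

theorem sum_sum_eq_zero_of_antisymm {ι : Type*} [Fintype ι] [DecidableEq ι] (f : ι → ι → A)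
    (h : ∀ i k, f i k + f k i = 0) (h0 : ∀ i, f i i = 0) : ∑ i, ∑ k, f i k = 0 := by
  rw [← Fintype.sum_prod_type']
  refine Finset.sum_involution (fun a _ => a.swap) (fun a _ => h _ _) ?_ (by simp) (by simp)
  rintro ⟨i, k⟩ _ hik heq
  obtain rfl : k = i := congrArg Prod.fst heq
  exact hik (h0 _)

theorem cobd_cobd (c : Finset (Fin n) → A) : cobd (cobd c) = 0 := by
  simp only [cobd_apply, map_sum]
  exact sum_sum_eq_zero_of_antisymm _ (fun i k => wedge_wedge k i c) fun i => wedge_wedge_self i c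

theorem bd_bd (c : Finset (Fin n) → A) : bd (bd c) = 0 := by
  simp only [bd_apply, map_sum]
  exact sum_sum_eq_zero_of_antisymm _ (fun i k => contr_contr k i c) fun i => contr_contr_self i c

theorem bd_wedge (k : Fin n) (c : Finset (Fin n) → A) : bd (wedge k c) = c - wedge k (bd c) := by
  rw [eq_sub_iff_add_eq, bd_apply, bd_apply, map_sum, ← Finset.sum_add_distrib]
  rw [Finset.sum_eq_single k]
  · rw [add_comm, wedge_contr, if_pos rfl]
  · intro i _ hi
    rw [add_comm, wedge_contr, if_neg hi.symm]
  · simp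

theorem cobd_contr (k : Fin n) (c : Finset (Fin n) → A) : cobd (contr k c) = c - contr k (cobd c) := by
  rw [eq_sub_iff_add_eq, cobd_apply, cobd_apply, map_sum, ← Finset.sum_add_distrib]
  rw [Finset.sum_eq_single k]
  · rw [wedge_contr, if_pos rfl]
  · intro i _ hi
    rw [wedge_contr, if_neg hi]
  · simp

theorem cobd_eq_zero_of_card_ne (c : Finset (Fin n) → A) (p : ℕ) (hc : ∀ S, S.card ≠ p → c S = 0)
    (S : Finset (Fin n)) (hS : S.card ≠ p + 1) : cobd c S = 0 := by
  simp only [cobd_apply, Finset.sum_apply, wedge_apply]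
  refine Finset.sum_eq_zero fun i _ => ?_
  split_ifs with h
  · rw [hc _ _, smul_zero]
    have := Finset.card_erase_add_one h
    omega
  · rfl

theorem bd_eq_zero_of_card_ne (c : Finset (Fin n) → A) (p : ℕ)
    (hc : ∀ S, S.card ≠ p + 1 → c S = 0)
    (S : Finset (Fin n)) (hS : S.card ≠ p) : bd c S = 0 := by
  simp only [bd_apply, Finset.sum_apply, contr_apply]
  refine Finset.sum_eq_zero fun i _ => ?_
  split_ifs with h
  · rfl
  · rw [hc _ _, smul_zero]
    rw [Finset.card_insert_of_notMem h]
    omega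

/-- The components of a cobounding cochain in the wrong degrees can be dropped. -/
theorem cobd_indicator (b c : Finset (Fin n) → A) (p : ℕ) (hb : cobd b = c)
    (hc : ∀ S, S.card ≠ p + 1 → c S = 0) :
    cobd (fun S => if S.card = p then b S else 0) = c := by
  subst hb
  ext S
  by_cases hS : S.card = p + 1
  · simp only [cobd_apply, Finset.sum_apply, wedge_apply]
    refine Finset.sum_congr rfl fun i _ => ?_
    split_ifs with h1 h2
    · rfl
    · have := Finset.card_erase_add_one h1
      omega
    · rfl
  · rw [hc S hS]
    exact cobd_eq_zero_of_card_ne _ p (fun S hS => by simp [hS]) S hS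

end Exterior

/-! ### Čech complexes of graded modules -/

section Cech

variable {n : ℕ} {V W : Type*} [AddCommGroup V] [Module (PolyRing n) V]
  [AddCommGroup W] [Module (PolyRing n) W]

/-- The homogeneous parts of a graded `R`-submodule of `V`, where `V` itself need not be graded:
subgroups `Nₑ` of `V` with `xᵢ Nₑ ⊆ Nₑ₊₁`. In the applications the variables act bijectively
on `V`, so that `V` contains all localizations of the submodule at products of variables. -/
structure GradedPieces (n : ℕ) (V : Type*) [AddCommGroup V] [Module (PolyRing n) V] where
  piece : ℤ → AddSubgroup V
  X_smul_mem : ∀ i e v, v ∈ piece e → (X i : PolyRing n) • v ∈ piece (e + 1)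

/-- The product of the variables `xᵢ`, `i ∈ S`. -/
def prodX (S : Finset (Fin n)) : PolyRing n := ∏ i ∈ S, X i

namespace GradedPieces

theorem prodX_smul_mem (N : GradedPieces n V) (S : Finset (Fin n)) (e : ℤ) (v : V)
    (hv : v ∈ N.piece e) : prodX S • v ∈ N.piece (e + S.card) := by
  induction S using Finset.induction_on with
  | empty => simpa [prodX] using hv
  | insert i S hi ih =>
    have h := N.X_smul_mem i _ _ ih
    rw [prodX, Finset.prod_insert hi, mul_smul, Finset.card_insert_of_notMem hi]
    push_cast
    rwa [← add_assoc]

theorem prodX_pow_smul_mem (N : GradedPieces n V) (S : Finset (Fin n)) (a : ℕ) (e : ℤ) (v : V)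
    (hv : v ∈ N.piece e) : prodX S ^ a • v ∈ N.piece (e + a * S.card) := by
  induction a with
  | zero => simpa using hv
  | succ a ih =>
    have h := N.prodX_smul_mem S _ _ ih
    rw [pow_succ', mul_smul]
    convert h using 2
    push_cast
    ring

/-- The part of degree `e` of the localization of `N` at the product of the variables `xᵢ`,
`i ∈ S`. -/
def loc (N : GradedPieces n V) (S : Finset (Fin n)) (e : ℤ) : AddSubgroup V where
  carrier := {v | ∃ a : ℕ, prodX S ^ a • v ∈ N.piece (e + a * S.card)}
  zero_mem' := ⟨0, by simp⟩
  add_mem' := by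
    rintro v w ⟨a, ha⟩ ⟨b, hb⟩
    refine ⟨a + b, ?_⟩
    have h1 := N.prodX_pow_smul_mem S b _ _ ha
    have h2 := N.prodX_pow_smul_mem S a _ _ hb
    rw [smul_add]
    refine add_mem ?_ ?_
    · rw [add_comm a b, pow_add, mul_smul]
      convert h1 using 2
      push_cast
      ring
    · rw [pow_add, mul_smul]
      convert h2 using 2
      push_cast
      ring
  neg_mem' := by
    rintro v ⟨a, ha⟩
    exact ⟨a, by simpa using ha⟩

theorem mem_loc {N : GradedPieces n V} {S : Finset (Fin n)} {e : ℤ} {v : V} :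
    v ∈ N.loc S e ↔ ∃ a : ℕ, prodX S ^ a • v ∈ N.piece (e + a * S.card) := Iff.rfl

theorem mem_loc_empty {N : GradedPieces n V} {e : ℤ} {v : V} :
    v ∈ N.loc ∅ e ↔ v ∈ N.piece e := by
  simp [mem_loc, prodX]

theorem loc_le_loc_insert (N : GradedPieces n V) (S : Finset (Fin n)) (i : Fin n) (e : ℤ) :
    N.loc S e ≤ N.loc (insert i S) e := by
  by_cases hi : i ∈ S
  · rw [Finset.insert_eq_of_mem hi]
  rintro v ⟨a, ha⟩
  refine ⟨a, ?_⟩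
  have h := N.prodX_pow_smul_mem {i} a _ _ ha
  rw [prodX, Finset.prod_insert hi, mul_pow, mul_smul, Finset.card_insert_of_notMem hi]
  rw [prodX, Finset.prod_singleton, Finset.card_singleton] at h
  rw [← prodX]
  convert h using 2
  push_cast
  ring

theorem cobd_mem_loc (N : GradedPieces n V) (e : ℤ) (c : Finset (Fin n) → V)
    (hc : ∀ S, c S ∈ N.loc S e) (S : Finset (Fin n)) : cobd c S ∈ N.loc S e := by
  simp only [cobd_apply, Finset.sum_apply, wedge_apply]
  refine sum_mem fun i _ => ?_
  split_ifs with h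
  · refine zsmul_mem ?_ _
    have := N.loc_le_loc_insert (S.erase i) i e (hc (S.erase i))
    rwa [Finset.insert_erase h] at this
  · exact zero_mem _

/-- Vanishing of the degree `e` part of the local cohomology `H^p_𝔪(N)`, stated as exactness of
the Čech complex on the variables. -/
def ExactAt (N : GradedPieces n V) (p : ℕ) (e : ℤ) : Prop :=
  ∀ c : Finset (Fin n) → V, (∀ S, c S ∈ N.loc S e) → (∀ S, S.card ≠ p → c S = 0) → cobd c = 0 →
    ∃ b : Finset (Fin n) → V, (∀ S, b S ∈ N.loc S e) ∧ cobd b = c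

theorem ExactAt.exists_of_succ {N : GradedPieces n V} {p : ℕ} {e : ℤ} (h : N.ExactAt (p + 1) e)
    (c : Finset (Fin n) → V) (hc : ∀ S, c S ∈ N.loc S e) (hp : ∀ S, S.card ≠ p + 1 → c S = 0)
    (hd : cobd c = 0) :
    ∃ b : Finset (Fin n) → V, (∀ S, b S ∈ N.loc S e) ∧ (∀ S, S.card ≠ p → b S = 0) ∧
      cobd b = c := by
  obtain ⟨b, hb, hbc⟩ := h c hc hp hd
  refine ⟨fun S => if S.card = p then b S else 0, fun S => ?_, fun S hS => by simp [hS],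
    cobd_indicator b c p hbc hp⟩
  dsimp only
  split_ifs
  · exact hb S
  · exact zero_mem _

theorem ExactAt.eq_zero {N : GradedPieces n V} {e : ℤ} (h : N.ExactAt 0 e)
    (c : Finset (Fin n) → V) (hc : ∀ S, c S ∈ N.loc S e) (hp : ∀ S, S.card ≠ 0 → c S = 0)
    (hd : cobd c = 0) : c = 0 := by
  obtain ⟨b, -, rfl⟩ := h c hc hp hd
  ext S
  by_cases hS : S.card = 0
  · rw [Finset.card_eq_zero] at hS
    simp [hS, cobd_apply, wedge_apply]
  · exact hp S hS

theorem exactAt_of_lt (N : GradedPieces n V) {p : ℕ} (hp : n < p) (e : ℤ) : N.ExactAt p e := by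
  intro c _ hc _
  refine ⟨0, fun S => zero_mem _, ?_⟩
  ext S
  have := Finset.card_le_univ S
  rw [Fintype.card_fin] at this
  rw [map_zero, hc S (by omega), Pi.zero_apply]

/-- The induction step through the double complex `C^{p,q} = ⨁ N_T[x_S⁻¹]`, `|S| = p`, `|T| = q`,
of a family of submodules with `xᵢ N_T ⊆ N_{T ∪ i} ⊆ N_T`. For `S ≠ ∅` the complex in the
`T`-direction is contractible, as `N_T[x_S⁻¹]` depends only on `S ∪ T`. So if the Čech complexes
of the `N_T`, `T ≠ ∅`, are exact along a diagonal, a cocycle of both differentials next to that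
diagonal is `∂d` of a cochain. -/
theorem exists_eq_cobd_bd (N : Finset (Fin n) → GradedPieces n V) (e : ℤ) (t : ℕ)
    (hle : ∀ T i e, (N (insert i T)).piece e ≤ (N T).piece e)
    (hmul : ∀ T i e v, v ∈ (N T).piece e →
      (X i : PolyRing n) • v ∈ (N (insert i T)).piece (e + 1))
    (hex : ∀ T, T.Nonempty → (N T).ExactAt (T.card + t) e) (k : ℕ) :
    ∀ q, n ≤ q + t + k → ∀ y : Finset (Fin n) → Finset (Fin n) → V,
      (∀ S T, y S T ∈ (N T).loc S e) → (∀ S, S.card ≠ q + 1 + t → y S = 0) →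
      (∀ S T, T.card ≠ q → y S T = 0) → cobd y = 0 → (∀ S, bd (y S) = 0) →
      ∃ u : Finset (Fin n) → Finset (Fin n) → V, (∀ S T, u S T ∈ (N T).loc S e) ∧
        (∀ S, S.card ≠ q + t → u S = 0) ∧ (∀ S T, T.card ≠ q + 1 → u S T = 0) ∧
        y = cobd fun S => bd (u S) := by
  have hloc : ∀ T i S, (N (insert i T)).loc S e ≤ (N T).loc S e :=
    fun T i S v ⟨a, ha⟩ => ⟨a, hle _ _ _ ha⟩
  have hloc' : ∀ T i S, i ∈ S → (N T).loc S e ≤ (N (insert i T)).loc S e := by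
    rintro T i S hi v ⟨a, ha⟩
    refine ⟨a + 1, ?_⟩
    have h2 := (N (insert i T)).prodX_smul_mem (S.erase i) _ _ (hmul T i _ _ ha)
    have h3 : prodX S = prodX (S.erase i) * (X i : PolyRing n) := by
      rw [prodX, prodX, Finset.prod_erase_mul _ _ hi]
    rw [pow_succ', mul_smul]
    nth_rewrite 1 [h3]
    rw [mul_smul]
    convert h2 using 2
    have := Finset.card_erase_add_one hi
    push_cast [← this]
    ring
  induction k with
  | zero =>
    intro q hq y _ hyS _ _ _
    refine ⟨0, fun S T => zero_mem _, fun S _ => rfl, fun S T _ => rfl, ?_⟩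
    ext S : 1
    have := Finset.card_le_univ S
    rw [Fintype.card_fin] at this
    rw [hyS S (by omega)]
    have : (fun S : Finset (Fin n) => bd ((0 : Finset (Fin n) → Finset (Fin n) → V) S)) = 0 := by
      ext; simp
    rw [this, map_zero]
    rfl
  | succ k ih =>
    intro q hq y hy hyS hyT hdy hby
    -- the contracting homotopy is `wedge i` for any choice of `i ∈ S`
    let w : Finset (Fin n) → Finset (Fin n) → V := fun S =>
      if h : S.Nonempty then wedge h.choose (y S) else 0
    have hw : ∀ S T, w S T ∈ (N T).loc S e := by
      intro S T
      by_cases h : S.Nonempty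
      · simp only [w, h, dif_pos, wedge_apply]
        split_ifs with hT
        · refine zsmul_mem ?_ _
          have := hloc' _ _ _ h.choose_spec (hy S (T.erase h.choose))
          rwa [Finset.insert_erase hT] at this
        · exact zero_mem _
      · simp only [w, h, dif_neg, not_false_eq_true]
        exact zero_mem _
    have hwS : ∀ S, S.card ≠ q + 1 + t → w S = 0 := by
      intro S hS
      simp only [w, hyS S hS, map_zero]
      split_ifs <;> rfl
    have hwT : ∀ S T, T.card ≠ q + 1 → w S T = 0 := by
      intro S T hT
      by_cases h : S.Nonempty
      · simp only [w, h, dif_pos, wedge_apply]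
        split_ifs with hT'
        · have := Finset.card_erase_add_one hT'
          rw [hyT _ _ (by omega), smul_zero]
        · rfl
      · simp [w, h]
    have hbw : ∀ S, bd (w S) = y S := by
      intro S
      by_cases h : S.Nonempty
      · simp only [w, h, dif_pos]
        rw [bd_wedge, hby, map_zero, sub_zero]
      · have h0 : S.card ≠ q + 1 + t := by
          rw [Finset.not_nonempty_iff_eq_empty] at h
          simp [h]
          omega
        rw [hwS S h0, hyS S h0, map_zero]
    obtain ⟨u, hu, huS, huT, hdu⟩ := ih (q + 1) (by omega) (cobd w)
      (by
        intro S T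
        have h1 := (N T).cobd_mem_loc e (fun S => w S T) (fun S => hw S T) S
        rwa [cobd_eval] at h1)
      (fun S hS => cobd_eq_zero_of_card_ne w (q + 1 + t) hwS S (by omega))
      (by
        intro S T hT
        have h1 := congrFun (cobd_eval w T) S
        have h2 : (fun S => w S T) = 0 := by
          ext S
          exact hwT S T hT
        rw [h2, map_zero] at h1
        exact h1.symm)
      (cobd_cobd w)
      (by
        intro S
        have h1 := congrFun (cobd_comp (bd (n := n) (A := V)) w) S
        simp only [hbw] at h1
        rw [← h1, show (fun S => y S) = y from rfl, hdy]
        rfl)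
    let w' : Finset (Fin n) → Finset (Fin n) → V := w - fun S => bd (u S)
    have hw' : ∀ S T, w' S T ∈ (N T).loc S e := by
      intro S T
      refine sub_mem (hw S T) ?_
      simp only [bd_apply, Finset.sum_apply, contr_apply]
      refine sum_mem fun i _ => ?_
      split_ifs with h
      · exact zero_mem _
      · exact zsmul_mem (hloc _ _ _ (hu S _)) _
    have hw'S : ∀ S, S.card ≠ q + 1 + t → w' S = 0 := by
      intro S hS
      simp only [w', Pi.sub_apply, hwS S hS, huS S hS, map_zero, sub_zero]
    have hw'T : ∀ S T, T.card ≠ q + 1 → w' S T = 0 := by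
      intro S T hT
      simp only [w', Pi.sub_apply, hwT S T hT, zero_sub, neg_eq_zero]
      exact bd_eq_zero_of_card_ne _ (q + 1) (fun T hT => huT S T hT) T hT
    have hdw' : cobd w' = 0 := by
      simp only [w', map_sub, ← hdu, sub_self]
    have hbw' : ∀ S, bd (w' S) = y S := by
      intro S
      simp only [w', Pi.sub_apply, map_sub, hbw, bd_bd, sub_zero]
    have hcol : ∀ T : Finset (Fin n), T.card = q + 1 → ∃ b : Finset (Fin n) → V,
        (∀ S, b S ∈ (N T).loc S e) ∧ (∀ S, S.card ≠ q + t → b S = 0) ∧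
          cobd b = fun S => w' S T := by
      intro T hT
      have hE := hex T (Finset.card_pos.1 (by omega))
      rw [show T.card + t = q + t + 1 by omega] at hE
      refine hE.exists_of_succ (fun S => w' S T) (fun S => hw' S T) ?_ ?_
      · intro S hS
        rw [hw'S S (by omega)]
        rfl
      · rw [cobd_eval, hdw']
        rfl
    choose! b hb hbS hdb using hcol
    refine ⟨fun S T => if T.card = q + 1 then b T S else 0, ?_, ?_, ?_, ?_⟩
    · intro S T
      dsimp only
      split_ifs with hT
      · exact hb T hT S
      · exact zero_mem _
    · intro S hS
      ext T
      dsimp only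
      split_ifs with hT
      · exact hbS T hT S hS
      · rfl
    · intro S T hT
      simp [hT]
    · have h1 : cobd (fun S T => if T.card = q + 1 then b T S else 0) = w' := by
        ext S T
        have h2 := congrFun (cobd_eval (fun S T => if T.card = q + 1 then b T S else 0) T) S
        rw [← h2]
        by_cases hT : T.card = q + 1
        · simp only [hT, if_true]
          exact congrFun (hdb T hT) S
        · simp only [hT, if_false]
          rw [hw'T S T hT, show (fun _ : Finset (Fin n) => (0 : V)) = 0 from rfl, map_zero]
          rfl
      rw [cobd_comp (bd (n := n) (A := V)), h1]
      ext S : 1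
      rw [hbw']

/-- If `xᵢ N_T ⊆ N_{T ∪ i} ⊆ N_T` and `H^{p + |T| - 1}_𝔪(N_T)ₑ = 0` for all `T ≠ ∅`, where `p ≥ 1`,
then `H^p_𝔪(N_∅)ₑ = 0`. -/
theorem exactAt_of_family (N : Finset (Fin n) → GradedPieces n V) (e : ℤ) (t : ℕ)
    (hle : ∀ T i e, (N (insert i T)).piece e ≤ (N T).piece e)
    (hmul : ∀ T i e v, v ∈ (N T).piece e →
      (X i : PolyRing n) • v ∈ (N (insert i T)).piece (e + 1))
    (hex : ∀ T, T.Nonempty → (N T).ExactAt (T.card + t) e) : (N ∅).ExactAt (t + 1) e := by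
  intro c hc hcS hdc
  obtain ⟨u, hu, -, -, hyu⟩ := exists_eq_cobd_bd N e t hle hmul hex n 0 (by omega)
    (fun S T => if T = ∅ then c S else 0)
    (by
      intro S T
      split_ifs with hT
      · rw [hT]
        exact hc S
      · exact zero_mem _)
    (by
      intro S hS
      ext T
      simp [hcS S (by omega)])
    (by
      intro S T hT
      rw [if_neg (by rintro rfl; simp at hT)])
    (by
      ext S T
      refine (congrFun (cobd_eval (fun S T => if T = ∅ then c S else 0) T) S).symm.trans ?_
      by_cases hT : T = ∅
      · simp only [hT, if_true, hdc]
        rfl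
      · simp only [hT, if_false]
        rw [show (fun _ : Finset (Fin n) => (0 : V)) = 0 from rfl, map_zero]
        rfl)
    (by
      intro S
      ext T
      simp [bd_apply, contr_apply])
  refine ⟨fun S => bd (u S) ∅, fun S => ?_, ?_⟩
  · simp only [bd_apply, Finset.sum_apply, contr_apply]
    refine sum_mem fun i _ => ?_
    split_ifs with h
    · exact zero_mem _
    · obtain ⟨a, ha⟩ := hu S (insert i ∅)
      exact zsmul_mem (mem_loc.2 ⟨a, hle _ _ _ ha⟩) _
  · rw [cobd_eval (fun S => bd (u S)) ∅, ← hyu]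
    simp

/-- If `xᵢ N_T ⊆ N_{T ∪ i} ⊆ N_T`, `H^{|T|}_𝔪(N_T)ₑ = 0` for all `T ≠ ∅` and `H^0_𝔪(N_∅)ₑ = 0`,
then the degree `e` part of `N_∅` is the sum of those of the `N_{i}`. -/
theorem exists_sum_of_family (N : Finset (Fin n) → GradedPieces n V) (e : ℤ)
    (hle : ∀ T i e, (N (insert i T)).piece e ≤ (N T).piece e)
    (hmul : ∀ T i e v, v ∈ (N T).piece e →
      (X i : PolyRing n) • v ∈ (N (insert i T)).piece (e + 1))
    (hex : ∀ T, (N T).ExactAt T.card e) (z : V) (hz : z ∈ (N ∅).piece e) :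
    ∃ y : Fin n → V, (∀ i, y i ∈ (N {i}).piece e) ∧ z = ∑ i, y i := by
  let c : Finset (Fin n) → V := fun S => if S = ∅ then z else 0
  have hc : ∀ S, c S ∈ (N ∅).loc S e := by
    intro S
    simp only [c]
    split_ifs with hS
    · rw [hS, mem_loc_empty]
      exact hz
    · exact zero_mem _
  have hcS : ∀ S, S.card ≠ 0 → c S = 0 := by
    intro S hS
    simp only [c]
    rw [if_neg (by rintro rfl; simp at hS)]
  obtain ⟨u, hu, huS, -, hyu⟩ := exists_eq_cobd_bd N e 0 hle hmul (fun T _ => hex T) n 0 (by omega)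
    (fun S T => if T = ∅ then cobd c S else 0)
    (by
      intro S T
      split_ifs with hT
      · rw [hT]
        exact (N ∅).cobd_mem_loc e c hc S
      · exact zero_mem _)
    (by
      intro S hS
      ext T
      simp [cobd_eq_zero_of_card_ne c 0 hcS S (by omega)])
    (by
      intro S T hT
      rw [if_neg (by rintro rfl; simp at hT)])
    (by
      ext S T
      refine (congrFun (cobd_eval (fun S T => if T = ∅ then cobd c S else 0) T) S).symm.trans ?_
      by_cases hT : T = ∅
      · simp only [hT, if_true]
        rw [show (fun S => cobd c S) = cobd c from rfl, cobd_cobd]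
        rfl
      · simp only [hT, if_false]
        rw [show (fun _ : Finset (Fin n) => (0 : V)) = 0 from rfl, map_zero]
        rfl)
    (by
      intro S
      ext T
      simp [bd_apply, contr_apply])
  have hbd : ∀ S, bd (u S) ∅ ∈ (N ∅).loc S e := by
    intro S
    simp only [bd_apply, Finset.sum_apply, contr_apply]
    refine sum_mem fun i _ => ?_
    split_ifs with h
    · exact zero_mem _
    · obtain ⟨a, ha⟩ := hu S (insert i ∅)
      exact zsmul_mem (mem_loc.2 ⟨a, hle _ _ _ ha⟩) _
  have h0 := (hex ∅).eq_zero (c - fun S => bd (u S) ∅) (fun S => sub_mem (hc S) (hbd S))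
    (by
      intro S hS
      rw [Pi.sub_apply, hcS S hS, huS S (by omega), map_zero]
      simp)
    (by
      rw [map_sub, cobd_eval (fun S => bd (u S)) ∅, ← hyu]
      simp)
  have h1 : z = bd (u ∅) ∅ := by
    have := congrFun h0 ∅
    simpa [c, sub_eq_zero] using this
  refine ⟨fun i => koszulSign i ∅ • u ∅ {i}, fun i => zsmul_mem ?_ _, ?_⟩
  · have := hu ∅ {i}
    rwa [mem_loc_empty] at this
  · rw [h1]
    simp [bd_apply, contr_apply]

end GradedPieces

end Cech

/-! ### Long exact sequences of Čech cohomology -/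

section LongExact

variable {n : ℕ} {V W : Type*} [AddCommGroup V] [Module (PolyRing n) V]
  [AddCommGroup W] [Module (PolyRing n) W]

namespace GradedPieces

/-- The image of a graded module under a linear map. -/
def map (N : GradedPieces n V) (φ : V →ₗ[PolyRing n] W) : GradedPieces n W where
  piece e := (N.piece e).map φ.toAddMonoidHom
  X_smul_mem := by
    rintro i e _ ⟨v, hv, rfl⟩
    exact ⟨(X i : PolyRing n) • v, N.X_smul_mem i e v hv, φ.map_smul _ _⟩

/-- The kernel of a linear map on a graded module. -/
def kerOf (N : GradedPieces n V) (φ : V →ₗ[PolyRing n] W) : GradedPieces n V where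
  piece e := N.piece e ⊓ φ.toAddMonoidHom.ker
  X_smul_mem := by
    rintro i e v ⟨hv, hv'⟩
    refine ⟨N.X_smul_mem i e v hv, ?_⟩
    have : φ v = 0 := hv'
    show φ ((X i : PolyRing n) • v) = 0
    rw [map_smul, this, smul_zero]

/-- The graded module `N(-t)`. -/
def shift (N : GradedPieces n V) (t : ℤ) : GradedPieces n V where
  piece e := N.piece (e - t)
  X_smul_mem i e v hv := by
    have := N.X_smul_mem i _ v hv
    rwa [show e - t + 1 = e + 1 - t by ring] at this

theorem loc_shift (N : GradedPieces n V) (t : ℤ) (S : Finset (Fin n)) (e : ℤ) :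
    (N.shift t).loc S e = N.loc S (e - t) := by
  ext v
  simp only [mem_loc, shift]
  refine exists_congr fun a => ?_
  rw [show e + a * (S.card : ℤ) - t = e - t + a * S.card by ring]

theorem exactAt_shift {N : GradedPieces n V} {t : ℤ} {p : ℕ} {e : ℤ} (h : N.ExactAt p (e - t)) :
    (N.shift t).ExactAt p e := by
  unfold ExactAt at h ⊢
  simpa only [loc_shift] using h

/-- The variables act bijectively. -/
def XBijective (n : ℕ) (V : Type*) [AddCommGroup V] [Module (PolyRing n) V] : Prop :=
  ∀ i : Fin n, Function.Bijective fun v : V => (X i : PolyRing n) • v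

theorem XBijective.prodX_pow (h : XBijective n V) (S : Finset (Fin n)) (a : ℕ) :
    Function.Bijective fun v : V => prodX S ^ a • v := by
  have h1 : Function.Bijective fun v : V => prodX S • v := by
    induction S using Finset.induction_on with
    | empty =>
      simp only [prodX, Finset.prod_empty, one_smul]
      exact Function.bijective_id
    | insert i S hi ih =>
      have := (h i).comp ih
      simpa [prodX, Finset.prod_insert hi, mul_smul, Function.comp_def] using this
  induction a with
  | zero =>
    simp only [pow_zero, one_smul]
    exact Function.bijective_id
  | succ a ih =>
    have := h1.comp ih
    simpa [pow_succ', mul_smul, Function.comp_def] using this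

theorem mem_loc_kerOf (hW : XBijective n W) {N : GradedPieces n V} {φ : V →ₗ[PolyRing n] W}
    {S : Finset (Fin n)} {e : ℤ} {v : V} :
    v ∈ (N.kerOf φ).loc S e ↔ v ∈ N.loc S e ∧ φ v = 0 := by
  constructor
  · rintro ⟨a, ha, ha'⟩
    refine ⟨⟨a, ha⟩, (hW.prodX_pow S a).1 ?_⟩
    have : φ (prodX S ^ a • v) = 0 := ha'
    simpa using this
  · rintro ⟨⟨a, ha⟩, h⟩
    refine ⟨a, ha, ?_⟩
    show φ (prodX S ^ a • v) = 0
    rw [map_smul, h, smul_zero]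

theorem mem_loc_map (hV : XBijective n V) (hW : XBijective n W) {N : GradedPieces n V}
    {φ : V →ₗ[PolyRing n] W} {S : Finset (Fin n)} {e : ℤ} {w : W} :
    w ∈ (N.map φ).loc S e ↔ ∃ v ∈ N.loc S e, φ v = w := by
  constructor
  · rintro ⟨a, v, hv, hvw⟩
    obtain ⟨v', rfl⟩ := (hV.prodX_pow S a).2 v
    refine ⟨v', ⟨a, hv⟩, (hW.prodX_pow S a).1 ?_⟩
    have : φ (prodX S ^ a • v') = prodX S ^ a • w := hvw
    simpa using this
  · rintro ⟨v, ⟨a, ha⟩, rfl⟩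
    exact ⟨a, _, ha, φ.map_smul _ _⟩

/-- The part `H^p(N) → H^p(φ N) → H^{p+1}(ker φ)` of the long exact sequence. -/
theorem ExactAt.map (hV : XBijective n V) (hW : XBijective n W) {N : GradedPieces n V}
    {φ : V →ₗ[PolyRing n] W} {p : ℕ} {e : ℤ} (h : N.ExactAt p e)
    (hk : (N.kerOf φ).ExactAt (p + 1) e) : (N.map φ).ExactAt p e := by
  classical
  intro c hc hcp hdc
  choose v hv hvc using fun S => (mem_loc_map hV hW).1 (hc S)
  let v' : Finset (Fin n) → V := fun S => if S.card = p then v S else 0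
  have hv' : ∀ S, v' S ∈ N.loc S e := by
    intro S
    simp only [v']
    split_ifs
    · exact hv S
    · exact zero_mem _
  have hφv' : (fun S => φ (v' S)) = c := by
    ext S
    simp only [v']
    split_ifs with hS
    · exact hvc S
    · rw [map_zero, hcp S hS]
  have hcomp : ∀ b : Finset (Fin n) → V, cobd (fun S => φ (b S)) = fun S => φ (cobd b S) :=
    fun b => cobd_comp φ.toAddMonoidHom b
  obtain ⟨b, hb, hbp, hdb⟩ := hk.exists_of_succ (cobd v')
    (fun S => (mem_loc_kerOf hW).2 ⟨N.cobd_mem_loc e v' hv' S, by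
      rw [← congrFun (hcomp v') S, hφv', hdc]
      rfl⟩)
    (cobd_eq_zero_of_card_ne v' p fun S hS => by simp [v', hS]) (cobd_cobd v')
  obtain ⟨b', hb', hdb'⟩ := h (v' - b)
    (fun S => sub_mem (hv' S) ((mem_loc_kerOf hW).1 (hb S)).1)
    (fun S hS => by simp [v', hS, hbp S hS]) (by rw [map_sub, hdb, sub_self])
  refine ⟨fun S => φ (b' S), fun S => (mem_loc_map hV hW).2 ⟨_, hb' S, rfl⟩, ?_⟩
  rw [hcomp, hdb', ← hφv']
  ext S
  rw [Pi.sub_apply, map_sub, ((mem_loc_kerOf hW).1 (hb S)).2, sub_zero]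

/-- The part `H^p(φ N) → H^{p+1}(ker φ) → H^{p+1}(N)` of the long exact sequence. -/
theorem ExactAt.kerOf_succ (hV : XBijective n V) (hW : XBijective n W) {N : GradedPieces n V}
    {φ : V →ₗ[PolyRing n] W} {p : ℕ} {e : ℤ} (h : (N.map φ).ExactAt p e)
    (hN : N.ExactAt (p + 1) e) : (N.kerOf φ).ExactAt (p + 1) e := by
  intro c hc hcp hdc
  have hcomp : ∀ b : Finset (Fin n) → V, cobd (fun S => φ (b S)) = fun S => φ (cobd b S) :=
    fun b => cobd_comp φ.toAddMonoidHom b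
  obtain ⟨b, hb, hbp, hdb⟩ := hN.exists_of_succ c (fun S => ((mem_loc_kerOf hW).1 (hc S)).1) hcp hdc
  obtain ⟨b', hb', hdb'⟩ := h (fun S => φ (b S)) (fun S => (mem_loc_map hV hW).2 ⟨_, hb S, rfl⟩)
    (fun S hS => by simp [hbp S hS]) (by
      rw [hcomp, hdb]
      ext S
      exact ((mem_loc_kerOf hW).1 (hc S)).2)
  choose v hv hvb using fun S => (mem_loc_map hV hW).1 (hb' S)
  refine ⟨b - cobd v, fun S => (mem_loc_kerOf hW).2 ⟨sub_mem (hb S) (N.cobd_mem_loc e v hv S), ?_⟩, ?_⟩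
  · rw [Pi.sub_apply, map_sub, ← congrFun (hcomp v) S]
    simp only [hvb]
    rw [show (fun S => b' S) = b' from rfl, hdb', sub_self]
  · rw [map_sub, cobd_cobd, sub_zero, hdb]

theorem ExactAt.kerOf_zero (hW : XBijective n W) {N : GradedPieces n V}
    {φ : V →ₗ[PolyRing n] W} {e : ℤ} (h : N.ExactAt 0 e) : (N.kerOf φ).ExactAt 0 e := by
  intro c hc hcp hdc
  have := h.eq_zero c (fun S => ((mem_loc_kerOf hW).1 (hc S)).1) hcp hdc
  exact ⟨0, fun S => zero_mem _, by rw [this, map_zero]⟩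

theorem ExactAt.map_of_injective (hV : XBijective n V) (hW : XBijective n W) {N : GradedPieces n V}
    {φ : V →ₗ[PolyRing n] W} (hφ : Function.Injective φ) {p : ℕ} {e : ℤ} (h : N.ExactAt p e) :
    (N.map φ).ExactAt p e := by
  refine h.map hV hW fun c hc _ _ => ⟨0, fun S => zero_mem _, ?_⟩
  ext S
  have := hφ (((mem_loc_kerOf hW).1 (hc S)).2.trans (map_zero φ).symm)
  rw [map_zero, this]
  rfl

end GradedPieces

end LongExact

/-! ### Laurent polynomials and the local cohomology of free modules -/

section Laurent

variable {n : ℕ}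

/-- The Laurent polynomial ring `ℂ[x₁^{±1}, …, xₙ^{±1}]`. -/
abbrev Laurent (n : ℕ) : Type := AddMonoidAlgebra ℂ (Fin n → ℤ)

/-- The inclusion of the exponents of polynomials into those of Laurent polynomials. -/
def expZ (n : ℕ) : (Fin n →₀ ℕ) →+ (Fin n → ℤ) where
  toFun m i := m i
  map_zero' := by ext; simp
  map_add' m m' := by ext; simp

theorem expZ_injective : Function.Injective (expZ n) := by
  intro m m' h
  ext i
  have := congrFun h i
  simpa [expZ] using this

/-- The inclusion of the polynomial ring into the Laurent polynomial ring. -/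
def toLaurent (n : ℕ) : PolyRing n →ₐ[ℂ] Laurent n :=
  AddMonoidAlgebra.mapDomainAlgHom ℂ ℂ (expZ n)

instance : Algebra (PolyRing n) (Laurent n) := (toLaurent n).toRingHom.toAlgebra

theorem smul_laurent (p : PolyRing n) (u : Laurent n) : p • u = toLaurent n p * u := rfl

theorem toLaurent_monomial (m : Fin n →₀ ℕ) (a : ℂ) :
    toLaurent n (monomial m a) = AddMonoidAlgebra.single (expZ n m) a := by
  rw [← single_eq_monomial]
  exact AddMonoidAlgebra.mapDomain_single

theorem coeff_toLaurent_expZ (p : PolyRing n) (m : Fin n →₀ ℕ) :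
    (toLaurent n p).coeff (expZ n m) = p.coeff m :=
  Finsupp.mapDomain_apply expZ_injective _ _

theorem coeff_toLaurent_of_notMem (p : PolyRing n) (a : Fin n → ℤ) (ha : a ∉ Set.range (expZ n)) :
    (toLaurent n p).coeff a = 0 :=
  Finsupp.mapDomain_of_notMem_range _ _ ha

theorem toLaurent_injective : Function.Injective (toLaurent n) := by
  intro p q h
  ext m
  rw [← coeff_toLaurent_expZ, h, coeff_toLaurent_expZ]

/-- The exponent of the product of the variables in `S`. -/
def indicatorZ (S : Finset (Fin n)) : Fin n → ℤ := fun i => if i ∈ S then 1 else 0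

theorem toLaurent_X (i : Fin n) :
    toLaurent n (X i) = AddMonoidAlgebra.single (indicatorZ {i}) 1 := by
  rw [X, toLaurent_monomial]
  congr 1
  ext k
  simp [expZ, indicatorZ, Finsupp.single_apply, eq_comm]

theorem toLaurent_prodX_pow (S : Finset (Fin n)) (a : ℕ) :
    toLaurent n (prodX S ^ a) = AddMonoidAlgebra.single (a • indicatorZ S) 1 := by
  have h1 : toLaurent n (prodX S) = AddMonoidAlgebra.single (indicatorZ S) 1 := by
    rw [prodX, map_prod]
    simp only [toLaurent_X]
    rw [AddMonoidAlgebra.prod_single, Finset.prod_const_one]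
    congr 1
    ext k
    simp [indicatorZ]
  rw [map_pow, h1, AddMonoidAlgebra.single_pow, one_pow]

theorem coeff_prodX_pow_smul (S : Finset (Fin n)) (a : ℕ) (u : Laurent n) (m : Fin n → ℤ) :
    (prodX S ^ a • u).coeff m = u.coeff (m - a • indicatorZ S) := by
  rw [smul_laurent, toLaurent_prodX_pow, AddMonoidAlgebra.coeff_single_mul_apply, one_mul,
    neg_add_eq_sub]

theorem XBijective_laurent : GradedPieces.XBijective n (Laurent n) := by
  intro i
  have h : ∀ u : Laurent n, (X i : PolyRing n) • u =
      AddMonoidAlgebra.single (indicatorZ {i}) 1 * u := fun u => by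
    rw [smul_laurent, toLaurent_X]
  have h1 : (AddMonoidAlgebra.single (indicatorZ {i}) 1 : Laurent n) *
      AddMonoidAlgebra.single (-indicatorZ {i}) 1 = 1 := by
    rw [AddMonoidAlgebra.single_mul_single, add_neg_cancel, one_mul]
    rfl
  simp only [h]
  refine Function.bijective_iff_has_inverse.2
    ⟨fun u => AddMonoidAlgebra.single (-indicatorZ {i}) 1 * u, fun u => ?_, fun u => ?_⟩
  · dsimp only
    rw [← mul_assoc, mul_comm (AddMonoidAlgebra.single _ _) (AddMonoidAlgebra.single _ _), h1,
      one_mul]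
  · dsimp only
    rw [← mul_assoc, h1, one_mul]

theorem XBijective_pi {ι V : Type*} [AddCommGroup V] [Module (PolyRing n) V]
    (h : GradedPieces.XBijective n V) : GradedPieces.XBijective n (ι → V) := by
  intro i
  exact Function.Bijective.piMap fun _ : ι => h i

/-- The Laurent polynomials of degree `e` without negative powers of the variables outside `S`. -/
def laurentPart (S : Finset (Fin n)) (e : ℤ) : AddSubgroup (Laurent n) where
  carrier := {u | ∀ m, u.coeff m ≠ 0 → (∀ i, i ∉ S → 0 ≤ m i) ∧ ∑ i, m i = e}
  zero_mem' := by simp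
  add_mem' := by
    intro u v hu hv m hm
    by_cases h : u.coeff m = 0
    · refine hv m fun h' => hm ?_
      rw [AddMonoidAlgebra.coeff_add, Finsupp.add_apply, h, h', add_zero]
    · exact hu m h
  neg_mem' := by
    intro u hu m hm
    refine hu m fun h => hm ?_
    rw [AddMonoidAlgebra.coeff_neg, Finsupp.neg_apply, h, neg_zero]

theorem toLaurent_mem_laurentPart {p : PolyRing n} {e : ℤ} :
    toLaurent n p ∈ laurentPart ∅ e ↔ p ∈ polyHomogeneous n e := by
  have hdeg : ∀ m : Fin n →₀ ℕ, ∑ i, expZ n m i = (m.degree : ℤ) := by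
    intro m
    rw [Finsupp.degree_eq_sum]
    push_cast
    rfl
  constructor
  · intro h m hm
    rw [mem_support_iff, ← coeff_toLaurent_expZ] at hm
    rw [← (h _ hm).2, hdeg]
  · intro h a ha
    by_cases hr : a ∈ Set.range (expZ n)
    · obtain ⟨m, rfl⟩ := hr
      rw [coeff_toLaurent_expZ, ← mem_support_iff] at ha
      exact ⟨fun i _ => by simp [expZ], by rw [hdeg, h m ha]⟩
    · exact absurd (coeff_toLaurent_of_notMem p a hr) ha

theorem exists_toLaurent_eq {u : Laurent n} {e : ℤ} (hu : u ∈ laurentPart ∅ e) :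
    ∃ p ∈ polyHomogeneous n e, toLaurent n p = u := by
  suffices h : ∃ p, toLaurent n p = u by
    obtain ⟨p, rfl⟩ := h
    exact ⟨p, toLaurent_mem_laurentPart.1 hu, rfl⟩
  have h1 : u ∈ (toLaurent n).range := by
    rw [← AddMonoidAlgebra.sum_coeff_single u]
    refine sum_mem fun a ha => ?_
    have h2 := (hu a (Finsupp.mem_support_iff.1 ha)).1
    refine ⟨monomial (Finsupp.equivFunOnFinite.symm fun i => (a i).toNat) (u.coeff a), ?_⟩
    show toLaurent n _ = _
    rw [toLaurent_monomial]
    congr 1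
    ext i
    simp [expZ, h2 i]
  exact h1

theorem sum_nsmul_indicatorZ (a : ℕ) (S : Finset (Fin n)) :
    ∑ i, (a • indicatorZ S) i = a * S.card := by
  simp [indicatorZ, mul_comm]

theorem prodX_pow_smul_mem_laurentPart {S : Finset (Fin n)} {a : ℕ} {u : Laurent n} {e : ℤ}
    (h : prodX S ^ a • u ∈ laurentPart ∅ (e + a * S.card)) : u ∈ laurentPart S e := by
  intro m hm
  have h1 := h (m + a • indicatorZ S) (by rwa [coeff_prodX_pow_smul, add_sub_cancel_right])
  refine ⟨fun i hi => ?_, ?_⟩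
  · simpa [indicatorZ, hi] using h1.1 i
  · have h2 := h1.2
    simp only [Pi.add_apply, Finset.sum_add_distrib, sum_nsmul_indicatorZ] at h2
    linarith

theorem exists_prodX_pow_smul_mem {S : Finset (Fin n)} {u : Laurent n} {e : ℤ}
    (h : u ∈ laurentPart S e) :
    ∃ a₀ : ℕ, ∀ a ≥ a₀, prodX S ^ a • u ∈ laurentPart ∅ (e + a * S.card) := by
  refine ⟨u.coeff.support.sup fun m => Finset.univ.sup fun i => (-m i).toNat, fun a ha m hm => ?_⟩
  rw [coeff_prodX_pow_smul] at hm
  have h1 := h _ hm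
  have h2 : ∀ i, (-(m - a • indicatorZ S) i).toNat ≤ a := fun i =>
    ((Finset.le_sup (f := fun i => (-(m - a • indicatorZ S) i).toNat) (Finset.mem_univ i)).trans
      (Finset.le_sup (f := fun m : Fin n → ℤ => Finset.univ.sup fun i => (-m i).toNat)
        (Finsupp.mem_support_iff.2 hm))).trans ha
  refine ⟨fun i _ => ?_, ?_⟩
  · by_cases hi : i ∈ S
    · have := h2 i
      simp [indicatorZ, hi] at this
      omega
    · simpa [indicatorZ, hi] using h1.1 i hi
  · have h3 := h1.2
    simp only [Pi.sub_apply, Finset.sum_sub_distrib, sum_nsmul_indicatorZ] at h3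
    linarith

open Classical in
/-- The part of a Laurent polynomial with exponents satisfying a predicate. -/
def laurentFilter (P : (Fin n → ℤ) → Prop) : Laurent n →+ Laurent n where
  toFun u := .ofCoeff (u.coeff.filter P)
  map_zero' := by
    rw [AddMonoidAlgebra.coeff_zero, Finsupp.filter_zero, AddMonoidAlgebra.ofCoeff_zero]
  map_add' u v := by
    rw [AddMonoidAlgebra.coeff_add, Finsupp.filter_add]
    rfl

theorem coeff_laurentFilter (P : (Fin n → ℤ) → Prop) [DecidablePred P] (u : Laurent n)
    (m : Fin n → ℤ) : (laurentFilter P u).coeff m = if P m then u.coeff m else 0 := by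
  refine (@Finsupp.filter_apply _ _ _ P (fun _ => Classical.propDecidable _) u.coeff m).trans ?_
  congr

/-- A choice of a variable with nonnegative exponent. -/
def nonnegIndex (m : Fin n → ℤ) : Option (Fin n) := by
  classical
  exact if h : ∃ i, 0 ≤ m i then some h.choose else none

theorem nonneg_of_nonnegIndex {m : Fin n → ℤ} {i : Fin n} (h : nonnegIndex m = some i) :
    0 ≤ m i := by
  unfold nonnegIndex at h
  split_ifs at h with h'
  rw [← Option.some.inj h]
  exact h'.choose_spec

/-- `H^p_𝔪(R)ₑ = 0` unless `p = n` and `e ≤ -n`. On the monomials with a fixed variable `xᵢ` of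
nonnegative exponent, adding `i` to the index set is a contracting homotopy. -/
theorem exists_cobd_laurent {ι : Type*} (s : ι → ℤ) (p : ℕ) (e : ℤ)
    (hpe : ∀ k, p = n → -(n : ℤ) < e - s k) (c : Finset (Fin n) → ι → Laurent n)
    (hc : ∀ S k, c S k ∈ laurentPart S (e - s k)) (hcp : ∀ S, S.card ≠ p → c S = 0)
    (hdc : cobd c = 0) :
    ∃ b : Finset (Fin n) → ι → Laurent n, (∀ S k, b S k ∈ laurentPart S (e - s k)) ∧
      cobd b = c := by
  classical
  let π : Fin n → (ι → Laurent n) →+ (ι → Laurent n) := fun i =>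
    (AddMonoidHom.compLeft (laurentFilter fun m => nonnegIndex m = some i) ι)
  have hπ : ∀ i v k m, (π i v k).coeff m = if nonnegIndex m = some i then (v k).coeff m else 0 :=
    fun i v k m => coeff_laurentFilter (fun m => nonnegIndex m = some i) (v k) m
  refine ⟨∑ i, contr i fun S => π i (c S), fun S k => ?_, ?_⟩
  · rw [Finset.sum_apply, Finset.sum_apply]
    refine sum_mem fun i _ => ?_
    rw [contr_apply]
    split_ifs with hi
    · exact zero_mem _
    · rw [Pi.smul_apply]
      refine zsmul_mem ?_ _
      intro m hm
      rw [hπ] at hm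
      split_ifs at hm with hmi
      · have h1 := hc _ _ m hm
        refine ⟨fun l hl => ?_, h1.2⟩
        by_cases hli : l = i
        · rw [hli]
          exact nonneg_of_nonnegIndex hmi
        · exact h1.1 l (by simp [hli, hl])
      · exact absurd rfl hm
  · rw [map_sum]
    simp only [cobd_contr, cobd_comp, hdc]
    ext S k m
    have h0 : ∀ i, contr i (fun S : Finset (Fin n) => π i ((0 : Finset (Fin n) → ι → Laurent n) S))
        = 0 := by
      intro i
      rw [show (fun S : Finset (Fin n) => π i ((0 : Finset (Fin n) → ι → Laurent n) S)) = 0 by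
        ext S : 1
        exact map_zero _, map_zero]
    simp only [h0, sub_zero, Finset.sum_apply, AddMonoidAlgebra.coeff_sum, Finsupp.finsetSum_apply,
      hπ]
    rcases hidx : nonnegIndex m with _ | i
    · simp only [reduceCtorEq, if_false, Finset.sum_const_zero]
      by_contra hne
      have h1 := hc S k m (Ne.symm hne)
      have hneg : ∀ i, m i < 0 := by
        intro i
        by_contra hi
        have : ∃ i, 0 ≤ m i := ⟨i, not_lt.1 hi⟩
        simp [nonnegIndex, this] at hidx
      have hS : S = Finset.univ := by
        ext i
        simp only [Finset.mem_univ, iff_true]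
        by_contra hi
        exact absurd (h1.1 i hi) (not_le.2 (hneg i))
      have hp : p = n := by
        by_contra hp
        rw [hcp S (by rw [hS, Finset.card_univ, Fintype.card_fin]; omega)] at hne
        exact hne rfl
      have h2 : ∑ i : Fin n, m i ≤ ∑ _i : Fin n, (-1 : ℤ) :=
        Finset.sum_le_sum fun i _ => by have := hneg i; omega
      have h3 := hpe k hp
      rw [h1.2] at h2
      simp at h2
      omega
    · simp only [Option.some.injEq]
      rw [Finset.sum_eq_single i (fun l _ hl => if_neg (Ne.symm hl)) (by simp), if_pos rfl]

end Laurent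

/-! ### Graded submodules of free modules -/

section Graded

variable {n : ℕ} {ι κ : Type}

theorem mem_polyHomogeneous {p : PolyRing n} {e : ℤ} :
    p ∈ polyHomogeneous n e ↔ ∀ m, p.coeff m ≠ 0 → (m.degree : ℤ) = e :=
  forall_congr' fun _ => by rw [mem_support_iff]

theorem mul_mem_polyHomogeneous {p q : PolyRing n} {d e : ℤ} (hp : p ∈ polyHomogeneous n d)
    (hq : q ∈ polyHomogeneous n e) : p * q ∈ polyHomogeneous n (d + e) := by
  classical
  intro m hm
  obtain ⟨a, ha, b, hb, rfl⟩ := Finset.mem_add.1 (support_mul p q hm)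
  rw [map_add, Nat.cast_add, hp a ha, hq b hb]

theorem X_mem_polyHomogeneous (i : Fin n) : (X i : PolyRing n) ∈ polyHomogeneous n 1 := by
  intro m hm
  rw [support_X, Finset.mem_singleton] at hm
  rw [hm, Finsupp.degree_single]
  rfl

theorem C_mem_polyHomogeneous (a : ℂ) : (C a : PolyRing n) ∈ polyHomogeneous n 0 := by
  intro m hm
  have : m = 0 := by
    by_contra h
    rw [mem_support_iff, coeff_C, if_neg (Ne.symm h)] at hm
    exact hm rfl
  simp [this]

theorem mem_polyHomogeneous_natCast {p : PolyRing n} {d : ℕ} :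
    p ∈ polyHomogeneous n d ↔ p.IsHomogeneous d := by
  rw [mem_polyHomogeneous]
  constructor
  · intro h m hm
    rw [← Nat.cast_inj (R := ℤ), ← h m hm, Finsupp.degree_eq_weight_one]
    rfl
  · intro h m hm
    have := h hm
    rw [← this, Finsupp.degree_eq_weight_one]
    rfl

theorem eq_zero_of_mem_polyHomogeneous_neg {p : PolyRing n} {e : ℤ} (he : e < 0)
    (hp : p ∈ polyHomogeneous n e) : p = 0 := by
  ext m
  by_contra h
  have := mem_polyHomogeneous.1 hp m h
  omega

/-- The homogeneous component of integral degree `e` of a polynomial. -/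
def polyComponent (n : ℕ) (e : ℤ) : PolyRing n →ₗ[ℂ] PolyRing n :=
  if 0 ≤ e then homogeneousComponent e.toNat else 0

theorem coeff_polyComponent (e : ℤ) (p : PolyRing n) (m : Fin n →₀ ℕ) :
    (polyComponent n e p).coeff m = if (m.degree : ℤ) = e then p.coeff m else 0 := by
  unfold polyComponent
  split_ifs with h1 h2 h2
  · rw [coeff_homogeneousComponent, if_pos (by omega)]
  · rw [coeff_homogeneousComponent, if_neg (by omega)]
  · omega
  · simp

theorem polyComponent_mem (e : ℤ) (p : PolyRing n) : polyComponent n e p ∈ polyHomogeneous n e := by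
  rw [mem_polyHomogeneous]
  intro m hm
  rw [coeff_polyComponent] at hm
  by_contra h
  simp [h] at hm

theorem polyComponent_of_mem {e : ℤ} {p : PolyRing n} (hp : p ∈ polyHomogeneous n e) (e' : ℤ) :
    polyComponent n e' p = if e' = e then p else 0 := by
  ext m
  rw [coeff_polyComponent]
  by_cases hm : p.coeff m = 0
  · simp only [hm, ite_self]
    split_ifs <;> simp [hm]
  · have := mem_polyHomogeneous.1 hp m hm
    rw [this]
    by_cases h : e' = e
    · simp [h]
    · simp [h, Ne.symm h]

theorem polyComponent_mul_of_mem {d : ℤ} {p : PolyRing n} (hp : p ∈ polyHomogeneous n d) (e : ℤ)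
    (q : PolyRing n) : polyComponent n e (q * p) = polyComponent n (e - d) q * p := by
  induction q using MvPolynomial.induction_on' with
  | monomial m a =>
    have hm : (monomial m a : PolyRing n) ∈ polyHomogeneous n m.degree :=
      mem_polyHomogeneous_natCast.2 (isHomogeneous_monomial a rfl)
    rw [polyComponent_of_mem hm, polyComponent_of_mem (mul_mem_polyHomogeneous hm hp)]
    by_cases h : e = m.degree + d
    · rw [if_pos h, if_pos (by omega)]
    · rw [if_neg h, if_neg (by omega), zero_mul]
  | add p q hp hq => rw [add_mul, map_add, hp, hq, map_add, add_mul]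

/-- The elements of degree `e` of the free module `R^ι` whose `k`-th basis vector has
degree `s k`. -/
def vecHomogeneous (n : ℕ) (s : ι → ℤ) (e : ℤ) : Submodule ℂ (ι → PolyRing n) where
  carrier := {v | ∀ k, v k ∈ polyHomogeneous n (e - s k)}
  zero_mem' := fun k => (polyHomogeneous n (e - s k)).zero_mem
  add_mem' := fun hv hw k => (polyHomogeneous n (e - s k)).add_mem (hv k) (hw k)
  smul_mem' := fun a _ hv k => (polyHomogeneous n (e - s k)).smul_mem a (hv k)

/-- The component of degree `e` of an element of the graded free module `R^ι`. -/
def vecComponent (n : ℕ) (s : ι → ℤ) (e : ℤ) : (ι → PolyRing n) →ₗ[ℂ] (ι → PolyRing n) :=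
  LinearMap.pi fun k => polyComponent n (e - s k) ∘ₗ LinearMap.proj k

theorem vecComponent_apply (s : ι → ℤ) (e : ℤ) (v : ι → PolyRing n) (k : ι) :
    vecComponent n s e v k = polyComponent n (e - s k) (v k) := rfl

theorem vecComponent_mem (s : ι → ℤ) (e : ℤ) (v : ι → PolyRing n) :
    vecComponent n s e v ∈ vecHomogeneous n s e := fun _ => polyComponent_mem _ _

theorem vecComponent_of_mem {s : ι → ℤ} {e : ℤ} {v : ι → PolyRing n}
    (hv : v ∈ vecHomogeneous n s e) (e' : ℤ) :
    vecComponent n s e' v = if e' = e then v else 0 := by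
  ext1 k
  rw [vecComponent_apply, polyComponent_of_mem (hv k)]
  by_cases h : e' = e
  · simp [h]
  · rw [if_neg h, if_neg (by omega)]
    rfl

theorem X_smul_mem_vecHomogeneous {s : ι → ℤ} {e : ℤ} {v : ι → PolyRing n} (i : Fin n)
    (hv : v ∈ vecHomogeneous n s e) :
    (X i : PolyRing n) • v ∈ vecHomogeneous n s (e + 1) := by
  intro k
  have := mul_mem_polyHomogeneous (X_mem_polyHomogeneous i) (hv k)
  rwa [show 1 + (e - s k) = e + 1 - s k by ring] at this

/-- An element of a graded free module of finite rank is the sum of its components. -/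
theorem exists_sum_vecComponent [Finite ι] (s : ι → ℤ) (v : ι → PolyRing n) :
    ∃ E : Finset ℤ, (∀ e ∉ E, vecComponent n s e v = 0) ∧ v = ∑ e ∈ E, vecComponent n s e v := by
  classical
  have := Fintype.ofFinite ι
  let E : Finset ℤ := Finset.univ.biUnion fun k => (v k).support.image fun m => (m.degree : ℤ) + s k
  have hE : ∀ k m, (v k).coeff m ≠ 0 → (m.degree : ℤ) + s k ∈ E := by
    intro k m hm
    exact Finset.mem_biUnion.2 ⟨k, Finset.mem_univ k,
      Finset.mem_image.2 ⟨m, mem_support_iff.2 hm, rfl⟩⟩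
  refine ⟨E, fun e he => ?_, ?_⟩
  · ext k m
    rw [vecComponent_apply, coeff_polyComponent]
    split_ifs with h
    · by_contra hne
      have := hE k m hne
      rw [h, sub_add_cancel] at this
      exact he this
    · simp
  · ext k m
    rw [Finset.sum_apply, coeff_sum]
    simp only [vecComponent_apply, coeff_polyComponent]
    by_cases hm : (v k).coeff m = 0
    · simp [hm]
    · rw [Finset.sum_eq_single ((m.degree : ℤ) + s k)]
      · simp
      · intro e _ he
        rw [if_neg (by omega)]
      · exact fun h => absurd (hE k m hm) h

/-- A submodule of a graded free module is graded if it contains the components of its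
elements. -/
def IsGradedSubmodule (s : ι → ℤ) (N : Submodule (PolyRing n) (ι → PolyRing n)) : Prop :=
  ∀ v ∈ N, ∀ e, vecComponent n s e v ∈ N

/-- The homogeneous parts of a submodule of a graded free module. -/
def gradedPart (s : ι → ℤ) (N : Submodule (PolyRing n) (ι → PolyRing n)) :
    GradedPieces n (ι → PolyRing n) where
  piece e := N.toAddSubgroup ⊓ (vecHomogeneous n s e).toAddSubgroup
  X_smul_mem i _ _ hv := ⟨N.smul_mem _ hv.1, X_smul_mem_vecHomogeneous i hv.2⟩

/-- The inclusion `R^ι → (R[x₁⁻¹, …, xₙ⁻¹])^ι`. -/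
def laurentMap (n : ℕ) (ι : Type) : (ι → PolyRing n) →ₗ[PolyRing n] (ι → Laurent n) :=
  (Algebra.linearMap (PolyRing n) (Laurent n)).compLeft ι

theorem laurentMap_apply (v : ι → PolyRing n) (k : ι) :
    laurentMap n ι v k = toLaurent n (v k) := rfl

theorem laurentMap_injective : Function.Injective (laurentMap n ι) := by
  intro v w h
  ext1 k
  exact toLaurent_injective (congrFun h k)

/-- The homogeneous parts of a submodule of `R^ι`, inside `(R[x₁⁻¹, …, xₙ⁻¹])^ι`. -/
def laurentPieces (s : ι → ℤ) (N : Submodule (PolyRing n) (ι → PolyRing n)) :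
    GradedPieces n (ι → Laurent n) := (gradedPart s N).map (laurentMap n ι)

theorem mem_laurentPieces {s : ι → ℤ} {N : Submodule (PolyRing n) (ι → PolyRing n)} {e : ℤ}
    {u : ι → Laurent n} : u ∈ (laurentPieces s N).piece e ↔
      ∃ v ∈ N, v ∈ vecHomogeneous n s e ∧ laurentMap n ι v = u := by
  constructor
  · rintro ⟨v, ⟨h1, h2⟩, h3⟩
    exact ⟨v, h1, h2, h3⟩
  · rintro ⟨v, h1, h2, h3⟩
    exact ⟨v, ⟨h1, h2⟩, h3⟩

/-- The bound `reg N ≤ ρ` for a graded submodule `N` of a free module, expressed by local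
cohomology: `H^p_𝔪(N)ₑ = 0` for `e > ρ - p`. -/
def RegularityLE (s : ι → ℤ) (N : Submodule (PolyRing n) (ι → PolyRing n)) (ρ : ℤ) : Prop :=
  ∀ (p : ℕ) (e : ℤ), ρ - p < e → (laurentPieces s N).ExactAt p e

theorem RegularityLE.mono {s : ι → ℤ} {N : Submodule (PolyRing n) (ι → PolyRing n)} {ρ ρ' : ℤ}
    (h : RegularityLE s N ρ) (hρ : ρ ≤ ρ') : RegularityLE s N ρ' :=
  fun p e he => h p e (by omega)

theorem mem_loc_laurentPieces_top [Finite ι] {s : ι → ℤ} {S : Finset (Fin n)} {e : ℤ}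
    {u : ι → Laurent n} : u ∈ (laurentPieces s ⊤).loc S e ↔ ∀ k, u k ∈ laurentPart S (e - s k) := by
  have := Fintype.ofFinite ι
  constructor
  · rintro ⟨a, ha⟩ k
    obtain ⟨v, -, hv, hvu⟩ := mem_laurentPieces.1 ha
    refine prodX_pow_smul_mem_laurentPart (a := a) ?_
    have h1 := congrFun hvu k
    rw [Pi.smul_apply] at h1
    rw [← h1, laurentMap_apply, toLaurent_mem_laurentPart]
    have h2 := hv k
    rwa [show e + a * (S.card : ℤ) - s k = e - s k + a * S.card by ring] at h2
  · intro h
    choose a₀ ha₀ using fun k => exists_prodX_pow_smul_mem (h k)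
    have h1 := fun k => ha₀ k (Finset.univ.sup a₀) (Finset.le_sup (Finset.mem_univ k))
    choose v hv hvu using fun k => exists_toLaurent_eq (h1 k)
    refine ⟨Finset.univ.sup a₀, mem_laurentPieces.2 ⟨v, trivial, fun k => ?_, ?_⟩⟩
    · have := hv k
      rwa [show e - s k + (Finset.univ.sup a₀ : ℕ) * (S.card : ℤ) =
        e + (Finset.univ.sup a₀ : ℕ) * (S.card : ℤ) - s k by ring] at this
    · ext1 k
      rw [laurentMap_apply, hvu, Pi.smul_apply]

/-- A free module with generators of degree at most `ρ` has regularity at most `ρ`. -/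
theorem regularityLE_top [Finite ι] {s : ι → ℤ} {ρ : ℤ} (hs : ∀ k, s k ≤ ρ) :
    RegularityLE (n := n) s ⊤ ρ := by
  intro p e he c hc hcp hdc
  simp only [mem_loc_laurentPieces_top] at hc ⊢
  refine exists_cobd_laurent s p e (fun k hp => ?_) c hc hcp hdc
  have := hs k
  omega

/-! ### Generators, relations and resolutions -/

/-- The module of relations between the elements `w k`. -/
def relations [Fintype κ] (w : κ → ι → PolyRing n) : Submodule (PolyRing n) (κ → PolyRing n) :=
  LinearMap.ker (Fintype.linearCombination (PolyRing n) w)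

theorem mem_relations [Fintype κ] {w : κ → ι → PolyRing n} {a : κ → PolyRing n} :
    a ∈ relations w ↔ ∑ k, a k • w k = 0 := by
  rw [relations, LinearMap.mem_ker, Fintype.linearCombination_apply]

theorem sum_vecComponent_smul [Fintype κ] {s : ι → ℤ} {c : κ → ℤ} {w : κ → ι → PolyRing n}
    (hw : ∀ k, w k ∈ vecHomogeneous n s (c k)) (e : ℤ) (a : κ → PolyRing n) :
    ∑ k, vecComponent n c e a k • w k = vecComponent n s e (∑ k, a k • w k) := by
  ext1 i
  rw [vecComponent_apply, Finset.sum_apply, Finset.sum_apply, map_sum]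
  refine Finset.sum_congr rfl fun k _ => ?_
  rw [Pi.smul_apply, Pi.smul_apply, smul_eq_mul, smul_eq_mul, polyComponent_mul_of_mem (hw k i),
    vecComponent_apply]
  congr 3
  ring

theorem isGradedSubmodule_relations [Fintype κ] {s : ι → ℤ} {c : κ → ℤ} {w : κ → ι → PolyRing n}
    (hw : ∀ k, w k ∈ vecHomogeneous n s (c k)) : IsGradedSubmodule c (relations w) := by
  intro a ha e
  rw [mem_relations] at ha ⊢
  rw [sum_vecComponent_smul hw, ha, map_zero]

/-- The extension of `a ↦ ∑ₖ aₖ wₖ` to Laurent polynomials. -/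
def laurentCombination [Fintype κ] (w : κ → ι → PolyRing n) :
    (κ → Laurent n) →ₗ[PolyRing n] (ι → Laurent n) :=
  LinearMap.pi fun i => ∑ k, w k i • LinearMap.proj k

theorem laurentCombination_apply [Fintype κ] (w : κ → ι → PolyRing n) (u : κ → Laurent n) (i : ι) :
    laurentCombination w u i = ∑ k, w k i • u k := by
  simp [laurentCombination]

theorem laurentCombination_laurentMap [Fintype κ] (w : κ → ι → PolyRing n) (a : κ → PolyRing n) :
    laurentCombination w (laurentMap n κ a) = laurentMap n ι (∑ k, a k • w k) := by
  ext1 i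
  rw [laurentCombination_apply, laurentMap_apply, Finset.sum_apply, map_sum]
  refine Finset.sum_congr rfl fun k _ => ?_
  rw [smul_laurent, laurentMap_apply, ← map_mul, Pi.smul_apply, smul_eq_mul, mul_comm]

theorem GradedPieces.ext' {V : Type*} [AddCommGroup V] [Module (PolyRing n) V]
    {N N' : GradedPieces n V} (h : ∀ e v, v ∈ N.piece e ↔ v ∈ N'.piece e) : N = N' := by
  cases N
  cases N'
  congr
  ext e v
  exact h e v

theorem laurentPieces_relations [Fintype κ] (c : κ → ℤ) (w : κ → ι → PolyRing n) :
    (laurentPieces c ⊤).kerOf (laurentCombination w) = laurentPieces c (relations w) := by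
  refine GradedPieces.ext' fun e u => ?_
  rw [mem_laurentPieces]
  constructor
  · rintro ⟨h1, h2⟩
    obtain ⟨a, -, ha, rfl⟩ := mem_laurentPieces.1 h1
    refine ⟨a, ?_, ha, rfl⟩
    have h3 : laurentCombination w (laurentMap n κ a) = 0 := h2
    rw [laurentCombination_laurentMap] at h3
    rw [mem_relations]
    exact laurentMap_injective (h3.trans (map_zero _).symm)
  · rintro ⟨a, ha, hae, rfl⟩
    refine ⟨mem_laurentPieces.2 ⟨a, trivial, hae, rfl⟩, ?_⟩
    show laurentCombination w (laurentMap n κ a) = 0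
    rw [laurentCombination_laurentMap, mem_relations.1 ha, map_zero]

theorem laurentPieces_span [Fintype κ] {s : ι → ℤ} {c : κ → ℤ} {w : κ → ι → PolyRing n}
    (hw : ∀ k, w k ∈ vecHomogeneous n s (c k)) :
    (laurentPieces c ⊤).map (laurentCombination w) =
      laurentPieces s (Submodule.span (PolyRing n) (Set.range w)) := by
  refine GradedPieces.ext' fun e u => ?_
  rw [mem_laurentPieces]
  have hcomp : ∀ a, vecComponent n s e (∑ k, vecComponent n c e a k • w k) =
      ∑ k, vecComponent n c e a k • w k := by
    intro a
    rw [sum_vecComponent_smul hw, vecComponent_of_mem (vecComponent_mem _ _ _), if_pos rfl]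
  constructor
  · rintro ⟨v, hv, rfl⟩
    obtain ⟨a, -, ha, rfl⟩ := mem_laurentPieces.1 hv
    refine ⟨∑ k, a k • w k, (Submodule.mem_span_range_iff_exists_fun _).2 ⟨a, rfl⟩, ?_,
      (laurentCombination_laurentMap w a).symm⟩
    have h1 := hcomp a
    rw [vecComponent_of_mem ha, if_pos rfl] at h1
    rw [← h1]
    exact vecComponent_mem _ _ _
  · rintro ⟨v, hv, hve, rfl⟩
    obtain ⟨a, rfl⟩ := (Submodule.mem_span_range_iff_exists_fun _).1 hv
    refine ⟨laurentMap n κ (vecComponent n c e a),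
      mem_laurentPieces.2 ⟨_, trivial, vecComponent_mem _ _ _, rfl⟩, ?_⟩
    show laurentCombination w (laurentMap n κ (vecComponent n c e a)) = _
    rw [laurentCombination_laurentMap, sum_vecComponent_smul hw, vecComponent_of_mem hve, if_pos rfl]

theorem XBijective_laurent_pi : GradedPieces.XBijective n (ι → Laurent n) :=
  XBijective_pi XBijective_laurent

/-- The relations between generators of degree at most `ρ` of a module of regularity at most `ρ`
have regularity at most `ρ + 1`. -/
theorem RegularityLE.relations [Fintype κ] {s : ι → ℤ} {c : κ → ℤ} {w : κ → ι → PolyRing n} {ρ : ℤ}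
    (hw : ∀ k, w k ∈ vecHomogeneous n s (c k)) (hc : ∀ k, c k ≤ ρ)
    (h : RegularityLE s (Submodule.span (PolyRing n) (Set.range w)) ρ) :
    RegularityLE c (relations w) (ρ + 1) := by
  have hF : RegularityLE (n := n) c ⊤ ρ := regularityLE_top hc
  intro p e he
  rw [← laurentPieces_relations]
  rcases p with _ | p
  · exact (hF 0 e (by push_cast at he ⊢; omega)).kerOf_zero XBijective_laurent_pi
  · refine GradedPieces.ExactAt.kerOf_succ XBijective_laurent_pi XBijective_laurent_pi ?_
      (hF (p + 1) e (by push_cast at he ⊢; omega))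
    rw [laurentPieces_span hw]
    exact h p e (by push_cast at he ⊢; omega)

/-- The first `l` steps of a graded free resolution of `N` (not necessarily minimal) can be chosen
with the generators of `F_j` in degrees at most `ρ + j`. -/
def ResolutionLE (n : ℕ) : ℕ → ∀ {ι : Type} (_ : ι → ℤ)
    (_ : Submodule (PolyRing n) (ι → PolyRing n)) (_ : ℤ), Prop
  | 0, _, _, _, _ => True
  | l + 1, ι, s, N, ρ => ∃ (r : ℕ) (c : Fin r → ℤ) (w : Fin r → ι → PolyRing n),
      (∀ k, w k ∈ vecHomogeneous n s (c k)) ∧ (∀ k, c k ≤ ρ) ∧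
        Submodule.span (PolyRing n) (Set.range w) = N ∧ ResolutionLE n l c (relations w) (ρ + 1)

theorem ResolutionLE.exactAt (l : ℕ) : ∀ {ι : Type} {s : ι → ℤ}
    {N : Submodule (PolyRing n) (ι → PolyRing n)} {ρ : ℤ}, ResolutionLE n l s N ρ →
      ∀ (p : ℕ) (e : ℤ), ρ - p < e → n < p + l → (laurentPieces s N).ExactAt p e := by
  induction l with
  | zero =>
    intro ι s N ρ _ p e _ hp
    exact GradedPieces.exactAt_of_lt _ hp e
  | succ l ih =>
    rintro ι s N ρ ⟨r, c, w, hw, hc, rfl, hres⟩ p e he hp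
    rw [← laurentPieces_span hw]
    refine GradedPieces.ExactAt.map XBijective_laurent_pi XBijective_laurent_pi
      (regularityLE_top hc p e he) ?_
    rw [laurentPieces_relations]
    exact ih hres (p + 1) e (by push_cast; omega) (by omega)

theorem ResolutionLE.regularityLE {s : ι → ℤ} {N : Submodule (PolyRing n) (ι → PolyRing n)} {ρ : ℤ}
    (h : ResolutionLE n (n + 1) s N ρ) : RegularityLE s N ρ :=
  fun p e he => h.exactAt (n + 1) p e he (by omega)

/-- The graded modules `x_T N_T`, with `x_T` the product of the variables `xᵢ`, `i ∈ T`. -/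
def mulProdX {V : Type*} [AddCommGroup V] [Module (PolyRing n) V]
    (N : Finset (Fin n) → GradedPieces n V) (T : Finset (Fin n)) : GradedPieces n V :=
  ((N T).shift T.card).map (LinearMap.lsmul (PolyRing n) V (prodX T))

theorem mem_mulProdX {V : Type*} [AddCommGroup V] [Module (PolyRing n) V]
    {N : Finset (Fin n) → GradedPieces n V} {T : Finset (Fin n)} {e : ℤ} {v : V} :
    v ∈ (mulProdX N T).piece e ↔ ∃ w ∈ (N T).piece (e - T.card), prodX T • w = v := Iff.rfl

section Family

variable {V : Type*} [AddCommGroup V] [Module (PolyRing n) V]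
  {N : Finset (Fin n) → GradedPieces n V}

theorem mulProdX_insert_le (hX : ∀ T i e v, v ∈ (N (insert i T)).piece e →
      (X i : PolyRing n) • v ∈ (N T).piece (e + 1)) (T : Finset (Fin n)) (i : Fin n) (e : ℤ) :
    (mulProdX N (insert i T)).piece e ≤ (mulProdX N T).piece e := by
  by_cases hi : i ∈ T
  · rw [Finset.insert_eq_of_mem hi]
  · intro v hv
    obtain ⟨w, hw, rfl⟩ := mem_mulProdX.1 hv
    refine mem_mulProdX.2 ⟨(X i : PolyRing n) • w, ?_, ?_⟩
    · have := hX T i _ w hw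
      rw [Finset.card_insert_of_notMem hi] at this
      convert this using 2
      push_cast
      ring
    · rw [prodX, prodX, Finset.prod_insert hi, smul_smul, mul_comm]

theorem X_smul_mem_mulProdX (hN : ∀ T i e, (N T).piece e ≤ (N (insert i T)).piece e)
    (T : Finset (Fin n)) (i : Fin n) (e : ℤ) (v : V) (hv : v ∈ (mulProdX N T).piece e) :
    (X i : PolyRing n) • v ∈ (mulProdX N (insert i T)).piece (e + 1) := by
  by_cases hi : i ∈ T
  · rw [Finset.insert_eq_of_mem hi]
    exact (mulProdX N T).X_smul_mem i e v hv
  · obtain ⟨w, hw, rfl⟩ := mem_mulProdX.1 hv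
    refine mem_mulProdX.2 ⟨w, ?_, ?_⟩
    · rw [Finset.card_insert_of_notMem hi]
      have := hN T i _ hw
      convert this using 2
      push_cast
      ring
    · rw [prodX, prodX, Finset.prod_insert hi, smul_smul]

theorem exactAt_mulProdX (hV : GradedPieces.XBijective n V) {T : Finset (Fin n)} {p : ℕ} {e : ℤ}
    (h : (N T).ExactAt p (e - T.card)) : (mulProdX N T).ExactAt p e := by
  refine GradedPieces.ExactAt.map_of_injective hV hV (fun v w hvw => ?_)
    (GradedPieces.exactAt_shift h)
  exact (hV.prodX_pow T 1).1 (by simpa using hvw)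

end Family

/-- A module of regularity at most `ρ` is generated in degrees at most `ρ`. This is the vanishing
of `H_0` of the Koszul complex, which is compared with the Čech complexes of the `x_T N`. -/
theorem RegularityLE.exists_sum_X_smul {s : ι → ℤ} {N : Submodule (PolyRing n) (ι → PolyRing n)}
    {ρ : ℤ} (h : RegularityLE s N ρ) {e : ℤ} (he : ρ < e) {v : ι → PolyRing n} (hv : v ∈ N)
    (hve : v ∈ vecHomogeneous n s e) :
    ∃ y : Fin n → ι → PolyRing n, (∀ i, y i ∈ N ∧ y i ∈ vecHomogeneous n s (e - 1)) ∧
      v = ∑ i, (X i : PolyRing n) • y i := by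
  obtain ⟨y, hy, hvy⟩ := GradedPieces.exists_sum_of_family (mulProdX fun _ => laurentPieces s N) e
    (mulProdX_insert_le fun T i e v hv => GradedPieces.X_smul_mem _ i e v hv)
    (X_smul_mem_mulProdX fun _ _ _ => le_rfl)
    (fun T => exactAt_mulProdX XBijective_laurent_pi (h _ _ (by omega)))
    (laurentMap n ι v)
    (mem_mulProdX.2 ⟨_, mem_laurentPieces.2 ⟨v, hv, by simpa using hve, rfl⟩, by simp [prodX]⟩)
  choose w hw hwy using fun i => mem_mulProdX.1 (hy i)
  choose z hz hze hzw using fun i => mem_laurentPieces.1 (hw i)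
  refine ⟨z, fun i => ⟨hz i, by simpa using hze i⟩, laurentMap_injective ?_⟩
  rw [hvy, map_sum]
  refine Finset.sum_congr rfl fun i _ => ?_
  rw [map_smul, hzw, ← hwy, prodX, Finset.prod_singleton]

theorem exists_homogeneous_generators [Finite ι] {s : ι → ℤ}
    {N : Submodule (PolyRing n) (ι → PolyRing n)} (hN : IsGradedSubmodule s N) :
    ∃ (r : ℕ) (c : Fin r → ℤ) (w : Fin r → ι → PolyRing n),
      (∀ k, w k ∈ vecHomogeneous n s (c k)) ∧ Submodule.span (PolyRing n) (Set.range w) = N := by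
  let H : Set (ι → PolyRing n) := {v | v ∈ N ∧ ∃ e, v ∈ vecHomogeneous n s e}
  have hH : Submodule.span (PolyRing n) H = N := by
    refine le_antisymm (Submodule.span_le.2 fun v hv => hv.1) fun v hv => ?_
    obtain ⟨E, -, hE⟩ := exists_sum_vecComponent s v
    rw [hE]
    exact sum_mem fun e _ => Submodule.subset_span ⟨hN v hv e, e, vecComponent_mem s e v⟩
  have hfg : (Submodule.span (PolyRing n) H).FG := IsNoetherian.noetherian _
  obtain ⟨H', hH', hspan⟩ := (Submodule.fg_span_iff_fg_span_finset_subset H).1 hfg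
  have hdeg : ∀ k : Fin H'.card, ∃ e, (H'.equivFin.symm k : ι → PolyRing n) ∈ vecHomogeneous n s e :=
    fun k => (hH' (H'.equivFin.symm k).2).2
  choose c hc using hdeg
  refine ⟨H'.card, c, fun k => H'.equivFin.symm k, hc, ?_⟩
  rw [← hH, hspan]
  congr 1
  ext v
  constructor
  · rintro ⟨k, rfl⟩
    exact (H'.equivFin.symm k).2
  · intro hv
    exact ⟨H'.equivFin ⟨v, hv⟩, by simp⟩

theorem span_succAbove {r : ℕ} {w : Fin (r + 1) → ι → PolyRing n} (k : Fin (r + 1))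
    (hk : w k ∈ Submodule.span (PolyRing n) (w '' {k}ᶜ)) :
    Submodule.span (PolyRing n) (Set.range fun l => w (k.succAbove l)) =
      Submodule.span (PolyRing n) (Set.range w) := by
  have h1 : Set.range (fun l => w (k.succAbove l)) = w '' {k}ᶜ := by
    rw [← Fin.range_succAbove, ← Set.range_comp]
    rfl
  rw [h1]
  refine le_antisymm (Submodule.span_mono (Set.image_subset_range _ _)) (Submodule.span_le.2 ?_)
  rintro _ ⟨l, rfl⟩
  by_cases hl : l = k
  · rw [hl]
    exact hk
  · exact Submodule.subset_span ⟨l, hl, rfl⟩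

/-- Let `N` be graded of regularity at most `ρ`. A family of homogeneous generators of `N` with the
smallest possible number of members has degrees at most `ρ`, and the relations between its members
have coefficients in `𝔪`. -/
theorem RegularityLE.exists_minimal_generators [Finite ι] {s : ι → ℤ}
    {N : Submodule (PolyRing n) (ι → PolyRing n)} {ρ : ℤ} (h : RegularityLE s N ρ)
    (hN : IsGradedSubmodule s N) :
    ∃ (r : ℕ) (c : Fin r → ℤ) (w : Fin r → ι → PolyRing n),
      (∀ k, w k ∈ vecHomogeneous n s (c k)) ∧ (∀ k, c k ≤ ρ) ∧
        Submodule.span (PolyRing n) (Set.range w) = N ∧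
        ∀ a ∈ LogForms.relations w, ∀ k, a k ∈ Ideal.span (Set.range (X : Fin n → PolyRing n)) := by
  classical
  have hex := exists_homogeneous_generators hN
  obtain ⟨r, ⟨c, w, hw, hspan⟩, hr⟩ : ∃ r, (∃ (c : Fin r → ℤ) (w : Fin r → ι → PolyRing n),
      (∀ k, w k ∈ vecHomogeneous n s (c k)) ∧ Submodule.span (PolyRing n) (Set.range w) = N) ∧
      ∀ r' < r, ¬∃ (c : Fin r' → ℤ) (w : Fin r' → ι → PolyRing n),
        (∀ k, w k ∈ vecHomogeneous n s (c k)) ∧ Submodule.span (PolyRing n) (Set.range w) = N :=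
    ⟨_, Nat.find_spec hex, fun r' => Nat.find_min hex⟩
  have hmin : ∀ k, w k ∉ Submodule.span (PolyRing n) (w '' {k}ᶜ) := by
    intro k hk
    rcases r with _ | r
    · exact k.elim0
    · refine hr r (by omega) ⟨fun l => c (k.succAbove l), fun l => w (k.succAbove l),
        fun l => hw _, ?_⟩
      rw [span_succAbove k hk, hspan]
  have hred : ∀ (k : Fin r) (a : Fin r → PolyRing n), a k = 0 →
      ∑ l, a l • w l ∈ Submodule.span (PolyRing n) (w '' {k}ᶜ) := by
    intro k a hak
    refine sum_mem fun l _ => ?_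
    by_cases hl : l = k
    · rw [hl, hak, zero_smul]
      exact zero_mem _
    · exact Submodule.smul_mem _ _ (Submodule.subset_span ⟨l, hl, rfl⟩)
  refine ⟨r, c, w, hw, fun k => ?_, hspan, fun a ha k => ?_⟩
  · by_contra hk
    obtain ⟨y, hy, hwy⟩ := h.exists_sum_X_smul (not_le.1 hk)
      (by rw [← hspan]; exact Submodule.subset_span ⟨k, rfl⟩) (hw k)
    refine hmin k ?_
    rw [hwy]
    refine sum_mem fun i _ => Submodule.smul_mem _ _ ?_
    have h1 := (hy i).1
    rw [← hspan] at h1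
    obtain ⟨a, ha⟩ := (Submodule.mem_span_range_iff_exists_fun _).1 h1
    have h2 := sum_vecComponent_smul hw (c k - 1) a
    rw [ha, vecComponent_of_mem (hy i).2, if_pos rfl] at h2
    rw [← h2]
    refine hred k _ ?_
    exact eq_zero_of_mem_polyHomogeneous_neg (by omega) (polyComponent_mem (c k - 1 - c k) (a k))
  · -- otherwise a component of the relation expresses `w k` through the other generators
    by_contra hak
    have h0 : (a k).coeff 0 ≠ 0 := by
      intro h0
      refine hak ?_
      rw [← Set.image_univ, mem_ideal_span_X_image]
      intro m hm
      by_contra! hm'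
      have : m = 0 := by
        ext i
        exact hm' i trivial
      rw [this, mem_support_iff] at hm
      exact hm h0
    have h1 := isGradedSubmodule_relations hw a ha (c k)
    rw [mem_relations] at h1
    have h2 : vecComponent n c (c k) a k = C ((a k).coeff 0) := by
      rw [vecComponent_apply, sub_self, polyComponent, if_pos le_rfl, Int.toNat_zero,
        homogeneousComponent_zero]
    rw [← Finset.add_sum_erase _ _ (Finset.mem_univ k), h2] at h1
    refine hmin k ?_
    have h3 : w k = (C (((a k).coeff 0)⁻¹) : PolyRing n) • -∑ l ∈ Finset.univ.erase k,
        vecComponent n c (c k) a l • w l := by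
      rw [← eq_neg_of_add_eq_zero_left h1, smul_smul, ← C_mul, inv_mul_cancel₀ h0, C_1, one_smul]
    rw [h3]
    refine Submodule.smul_mem _ _ (neg_mem (sum_mem fun l hl => ?_))
    exact Submodule.smul_mem _ _ (Submodule.subset_span ⟨l, Finset.ne_of_mem_erase hl, rfl⟩)

theorem RegularityLE.resolutionLE (l : ℕ) : ∀ {ι : Type} [Finite ι] {s : ι → ℤ}
    {N : Submodule (PolyRing n) (ι → PolyRing n)} {ρ : ℤ}, RegularityLE s N ρ →
      IsGradedSubmodule s N → ResolutionLE n l s N ρ := by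
  induction l with
  | zero => exact fun _ _ => trivial
  | succ l ih =>
    intro ι _ s N ρ h hN
    obtain ⟨r, c, w, hw, hc, rfl, -⟩ := h.exists_minimal_generators hN
    exact ⟨r, c, w, hw, hc, rfl, ih (h.relations hw hc) (isGradedSubmodule_relations hw)⟩

end Graded

/-! ### Extension of the polynomial ring by further variables -/

section BaseChange

variable {n r : ℕ} {ι κ : Type}

/-- The linear form `∑ᵢ vᵢ xᵢ`. -/
def linForm (n : ℕ) : (Fin n → ℂ) →ₗ[ℂ] PolyRing n :=
  ∑ i, (LinearMap.toSpanSingleton ℂ (PolyRing n) (X i)) ∘ₗ LinearMap.proj i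

theorem linForm_apply (v : Fin n → ℂ) : linForm n v = ∑ i, C (v i) * X i := by
  simp [linForm, smul_eq_C_mul]

theorem linForm_single (i : Fin n) : linForm n (Pi.single i 1) = X i := by
  rw [linForm_apply, Finset.sum_eq_single i]
  · simp
  · intro k _ hk
    simp [hk]
  · simp

theorem linForm_mem (v : Fin n → ℂ) : linForm n v ∈ polyHomogeneous n 1 := by
  rw [linForm_apply]
  refine sum_mem fun i _ => ?_
  simpa using mul_mem_polyHomogeneous (C_mem_polyHomogeneous (v i)) (X_mem_polyHomogeneous i)

/-- The homomorphism of polynomial rings given by a linear map between the spaces of linear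
forms. -/
def linSubst (B : (Fin r → ℂ) →ₗ[ℂ] (Fin n → ℂ)) : PolyRing r →ₐ[ℂ] PolyRing n :=
  aeval fun i => linForm n (B (Pi.single i 1))

theorem linSubst_linForm (B : (Fin r → ℂ) →ₗ[ℂ] (Fin n → ℂ)) (v : Fin r → ℂ) :
    linSubst B (linForm r v) = linForm n (B v) := by
  have h : (linSubst B).toLinearMap ∘ₗ linForm r = linForm n ∘ₗ B := by
    refine LinearMap.pi_ext' fun i => LinearMap.ext_ring ?_
    simp [linForm_single, linSubst]
  exact LinearMap.congr_fun h v

theorem linSubst_mem (B : (Fin r → ℂ) →ₗ[ℂ] (Fin n → ℂ)) {p : PolyRing r} {e : ℤ}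
    (hp : p ∈ polyHomogeneous r e) : linSubst B p ∈ polyHomogeneous n e := by
  rcases lt_or_ge e 0 with he | he
  · rw [eq_zero_of_mem_polyHomogeneous_neg he hp, map_zero]
    exact zero_mem _
  · lift e to ℕ using he
    rw [mem_polyHomogeneous_natCast] at hp ⊢
    have := hp.aeval (fun i => linForm n (B (Pi.single i 1))) (n := 1) fun i =>
      mem_polyHomogeneous_natCast.1 (by exact_mod_cast linForm_mem _)
    rwa [one_mul] at this

/-- The ring homomorphism `θ` makes its target a polynomial ring over its source. (`G` is a left
inverse of `F` as well, but this is not needed.) -/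
def IsPolynomialExtension (θ : PolyRing r →ₐ[ℂ] PolyRing n) : Prop :=
  ∃ (J : Type) (G : PolyRing n →ₐ[ℂ] MvPolynomial J (PolyRing r))
    (F : MvPolynomial J (PolyRing r) →+* PolyRing n),
    (∀ a, G (θ a) = C a) ∧ (∀ a, F (C a) = θ a) ∧ ∀ p, F (G p) = p

theorem isPolynomialExtension_linSubst {B : (Fin r → ℂ) →ₗ[ℂ] (Fin n → ℂ)}
    (hB : Function.Injective B) : IsPolynomialExtension (linSubst B) := by
  classical
  have hli : LinearIndependent ℂ fun i => B (Pi.single i 1) := by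
    have := (Pi.basisFun ℂ (Fin r)).linearIndependent.map' B (LinearMap.ker_eq_bot.2 hB)
    simpa [Function.comp_def] using this
  -- the additional variables are the vectors by which the image of the basis is extended
  let b := Module.Basis.sumExtend hli
  have hb : ∀ i, b (Sum.inl i) = B (Pi.single i 1) := fun i => by
    simp [b, Module.Basis.sumExtend]
    rfl
  let J : Type := Module.Basis.sumExtendIndex hli
  have : Finite (Fin r ⊕ J) := Module.Finite.finite_basis b
  have : Finite J := Finite.sum_right (Fin r)
  have := Fintype.ofFinite J
  let g : (Fin n → ℂ) →ₗ[ℂ] MvPolynomial J (PolyRing r) :=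
    b.constr ℂ (Sum.elim (fun i => C (X i)) X)
  let G : PolyRing n →ₐ[ℂ] MvPolynomial J (PolyRing r) := aeval fun i => g (Pi.single i 1)
  have hG : ∀ v, G (linForm n v) = g v := by
    have h : G.toLinearMap ∘ₗ linForm n = g := by
      refine LinearMap.pi_ext' fun i => LinearMap.ext_ring ?_
      simp [linForm_single, G]
    exact fun v => LinearMap.congr_fun h v
  let F : MvPolynomial J (PolyRing r) →+* PolyRing n :=
    eval₂Hom (linSubst B).toRingHom fun j => linForm n (b (Sum.inr j))
  have hFC : ∀ a, F (C a) = linSubst B a := fun a => by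
    simp [F]
  have hFg : ∀ v, F (g v) = linForm n v := by
    let Fl : MvPolynomial J (PolyRing r) →ₗ[ℂ] PolyRing n :=
      { toFun := F
        map_add' := F.map_add
        map_smul' := by
          intro a p
          have h1 : a • p = C (C a) * p := by
            rw [Algebra.smul_def, IsScalarTower.algebraMap_apply ℂ (PolyRing r) (MvPolynomial J (PolyRing r))]
            rfl
          rw [h1, map_mul, hFC, RingHom.id_apply, Algebra.smul_def]
          congr 1
          exact (linSubst B).commutes a }
    have h : Fl ∘ₗ g = linForm n := by
      refine b.ext fun i => ?_
      rcases i with i | j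
      · show F (g (b (Sum.inl i))) = _
        rw [b.constr_basis, Sum.elim_inl, hFC, hb, linSubst, aeval_X]
      · show F (g (b (Sum.inr j))) = _
        rw [b.constr_basis, Sum.elim_inr]
        simp [F]
    exact fun v => LinearMap.congr_fun h v
  refine ⟨J, G, F, fun a => ?_, hFC, fun p => ?_⟩
  · have h : G.comp (linSubst B) = IsScalarTower.toAlgHom ℂ (PolyRing r) _ := by
      refine MvPolynomial.algHom_ext fun i => ?_
      rw [AlgHom.comp_apply, linSubst, aeval_X, hG, ← hb, b.constr_basis]
      rfl
    exact DFunLike.congr_fun h a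
  · have h : F.comp G.toRingHom = RingHom.id _ := by
      refine MvPolynomial.ringHom_ext (fun a => ?_) fun i => ?_
      · have h1 : G.toRingHom (C a) = C (C a) := by
          have := G.commutes a
          rw [IsScalarTower.algebraMap_apply ℂ (PolyRing r) (MvPolynomial J (PolyRing r))] at this
          exact this
        rw [RingHom.comp_apply, h1, hFC, RingHom.id_apply]
        exact (linSubst B).commutes a
      · have h1 : G.toRingHom (X i) = g (Pi.single i 1) := by
          rw [← hG, linForm_single]
          rfl
        rw [RingHom.comp_apply, h1, hFg, linForm_single, RingHom.id_apply]
    exact DFunLike.congr_fun h p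

/-- The extension of a submodule of a free module along a ring homomorphism. -/
def baseChange (θ : PolyRing r →ₐ[ℂ] PolyRing n) (N : Submodule (PolyRing r) (ι → PolyRing r)) :
    Submodule (PolyRing n) (ι → PolyRing n) :=
  Submodule.span (PolyRing n) ((fun (v : ι → PolyRing r) (k : ι) => θ (v k)) '' (N : Set (ι → PolyRing r)))

section

variable {θ : PolyRing r →ₐ[ℂ] PolyRing n} {J : Type}
  {G : PolyRing n →ₐ[ℂ] MvPolynomial J (PolyRing r)} {F : MvPolynomial J (PolyRing r) →+* PolyRing n}

theorem eq_sum_coeff_mul (hF : ∀ a, F (C a) = θ a) (hFG : ∀ p, F (G p) = p) (E : Finset (J →₀ ℕ))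
    (p : PolyRing n) (hE : ∀ m, (G p).coeff m ≠ 0 → m ∈ E) :
    p = ∑ m ∈ E, θ ((G p).coeff m) * F (monomial m 1) := by
  classical
  conv_lhs => rw [← hFG p, (G p).as_sum]
  rw [map_sum]
  have h : ∀ m, F (monomial m ((G p).coeff m)) = θ ((G p).coeff m) * F (monomial m 1) := by
    intro m
    rw [← hF, ← map_mul, C_mul_monomial, mul_one]
  simp only [h]
  refine Finset.sum_subset (fun m hm => hE m (mem_support_iff.1 hm)) fun m _ hm => ?_
  rw [notMem_support_iff.1 hm, map_zero, zero_mul]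

/-- Over a polynomial extension, membership in the extended submodule is tested on coefficients. -/
theorem mem_baseChange [Finite ι] (hG : ∀ a, G (θ a) = C a) (hF : ∀ a, F (C a) = θ a)
    (hFG : ∀ p, F (G p) = p) {N : Submodule (PolyRing r) (ι → PolyRing r)} {v : ι → PolyRing n} :
    v ∈ baseChange θ N ↔ ∀ m, (fun k => (G (v k)).coeff m) ∈ N := by
  classical
  have := Fintype.ofFinite ι
  constructor
  · intro hv
    induction hv using Submodule.span_induction with
    | mem v hv =>
      obtain ⟨w, hw, rfl⟩ := hv
      intro m
      simp only [hG, coeff_C]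
      split_ifs
      · exact hw
      · exact zero_mem N
    | zero =>
      intro m
      simp only [Pi.zero_apply, map_zero, coeff_zero]
      exact zero_mem N
    | add v w _ _ hv hw =>
      intro m
      simp only [Pi.add_apply, map_add, coeff_add]
      exact add_mem (hv m) (hw m)
    | smul p v _ hv =>
      intro m
      have : (fun k => (G ((p • v) k)).coeff m) =
          ∑ x ∈ Finset.HasAntidiagonal.antidiagonal m, (G p).coeff x.1 • fun k => (G (v k)).coeff x.2 := by
        ext1 k
        rw [Pi.smul_apply, smul_eq_mul, map_mul, coeff_mul, Finset.sum_apply]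
        rfl
      rw [this]
      exact sum_mem fun x _ => N.smul_mem _ (hv x.2)
  · intro h
    let E : Finset (J →₀ ℕ) := Finset.univ.biUnion fun k => (G (v k)).support
    have hE : v = ∑ m ∈ E, F (monomial m 1) • fun k => θ ((G (v k)).coeff m) := by
      ext1 k
      rw [Finset.sum_apply]
      refine (eq_sum_coeff_mul hF hFG E (v k) fun m hm => ?_).trans ?_
      · exact Finset.mem_biUnion.2 ⟨k, Finset.mem_univ k, mem_support_iff.2 hm⟩
      · exact Finset.sum_congr rfl fun m _ => mul_comm _ _
    rw [hE]
    exact sum_mem fun m _ => Submodule.smul_mem _ _ (Submodule.subset_span ⟨_, h m, rfl⟩)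

theorem dvd_iff_forall_coeff (hG : ∀ a, G (θ a) = C a) (hF : ∀ a, F (C a) = θ a)
    (hFG : ∀ p, F (G p) = p) {q : PolyRing r} {p : PolyRing n} :
    θ q ∣ p ↔ ∀ m, q ∣ (G p).coeff m := by
  constructor
  · rintro ⟨u, rfl⟩ m
    rw [map_mul, hG, coeff_C_mul]
    exact dvd_mul_right _ _
  · intro h
    rw [eq_sum_coeff_mul hF hFG (G p).support p fun m hm => mem_support_iff.2 hm]
    exact Finset.dvd_sum fun m _ => Dvd.dvd.mul_right (map_dvd θ (h m)) _

end

theorem baseChange_span (θ : PolyRing r →ₐ[ℂ] PolyRing n) (w : κ → ι → PolyRing r) :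
    baseChange θ (Submodule.span (PolyRing r) (Set.range w)) =
      Submodule.span (PolyRing n) (Set.range fun k i => θ (w k i)) := by
  refine le_antisymm (Submodule.span_le.2 ?_) (Submodule.span_le.2 ?_)
  · rintro _ ⟨v, hv, rfl⟩
    dsimp only
    induction hv using Submodule.span_induction with
    | mem v hv =>
      obtain ⟨k, rfl⟩ := hv
      exact Submodule.subset_span ⟨k, rfl⟩
    | zero =>
      simp only [Pi.zero_apply, map_zero]
      exact zero_mem _
    | add v v' _ _ hv hv' =>
      simp only [Pi.add_apply, map_add]
      exact add_mem hv hv'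
    | smul p v _ hv =>
      simp only [Pi.smul_apply, smul_eq_mul, map_mul]
      exact Submodule.smul_mem _ (θ p) hv
  · rintro _ ⟨k, rfl⟩
    exact Submodule.subset_span ⟨w k, Submodule.subset_span ⟨k, rfl⟩, rfl⟩

theorem baseChange_relations [Fintype κ] {θ : PolyRing r →ₐ[ℂ] PolyRing n}
    (hθ : IsPolynomialExtension θ) (w : κ → ι → PolyRing r) :
    baseChange θ (relations w) = relations fun k i => θ (w k i) := by
  obtain ⟨J, G, F, hG, hF, hFG⟩ := hθ
  ext v
  rw [mem_baseChange hG hF hFG]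
  simp only [mem_relations, funext_iff, Finset.sum_apply, Pi.smul_apply, smul_eq_mul, Pi.zero_apply]
  have hGi : ∀ p, G p = 0 → p = 0 := fun p hp => by rw [← hFG p, hp, map_zero]
  have hcoeff : ∀ m i, (G (∑ k, v k * θ (w k i))).coeff m = ∑ k, (G (v k)).coeff m * w k i := by
    intro m i
    rw [map_sum, coeff_sum]
    refine Finset.sum_congr rfl fun k _ => ?_
    rw [map_mul, hG, mul_comm, coeff_C_mul, mul_comm]
  constructor
  · intro h i
    refine hGi _ ?_
    ext1 m
    rw [hcoeff, h m i, coeff_zero]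
  · intro h m i
    rw [← hcoeff, h i, map_zero, coeff_zero]

theorem ResolutionLE.baseChange {B : (Fin r → ℂ) →ₗ[ℂ] (Fin n → ℂ)} (hB : Function.Injective B)
    (l : ℕ) : ∀ {ι : Type} {s : ι → ℤ} {N : Submodule (PolyRing r) (ι → PolyRing r)} {ρ : ℤ},
      ResolutionLE r l s N ρ → ResolutionLE n l s (baseChange (linSubst B) N) ρ := by
  induction l with
  | zero => exact fun _ => trivial
  | succ l ih =>
    rintro ι s N ρ ⟨t, c, w, hw, hc, rfl, hres⟩
    refine ⟨t, c, fun k i => linSubst B (w k i), fun k i => linSubst_mem B (hw k i), hc,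
      (baseChange_span _ _).symm, ?_⟩
    rw [← baseChange_relations (isPolynomialExtension_linSubst hB)]
    exact ih hres

end BaseChange

/-! ### Exterior multiplication by constant forms -/

section WedgeForm

variable {m : ℕ} {A A' : Type*} [AddCommGroup A] [Module ℂ A] [AddCommGroup A'] [Module ℂ A']

theorem wedge_smul (i : Fin m) (c : ℂ) (v : Finset (Fin m) → A) : wedge i (c • v) = c • wedge i v :=
  wedge_comp (DistribSMul.toAddMonoidHom A c) i v

theorem contr_smul (i : Fin m) (c : ℂ) (v : Finset (Fin m) → A) : contr i (c • v) = c • contr i v :=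
  contr_comp (DistribSMul.toAddMonoidHom A c) i v

/-- Exterior multiplication by the constant form `∑ᵢ aᵢ dxᵢ`. -/
def wedgeForm (a : Fin m → ℂ) : (Finset (Fin m) → A) →ₗ[ℂ] (Finset (Fin m) → A) where
  toFun v := ∑ i, a i • wedge i v
  map_add' v w := by simp [Finset.sum_add_distrib]
  map_smul' c v := by simp [wedge_smul, Finset.smul_sum, smul_comm c]

/-- Contraction with the constant vector field `∑ᵢ uᵢ ∂/∂xᵢ`. -/
def contrForm (u : Fin m → ℂ) : (Finset (Fin m) → A) →ₗ[ℂ] (Finset (Fin m) → A) where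
  toFun v := ∑ i, u i • contr i v
  map_add' v w := by simp [Finset.sum_add_distrib]
  map_smul' c v := by simp [contr_smul, Finset.smul_sum, smul_comm c]

theorem wedgeForm_apply (a : Fin m → ℂ) (v : Finset (Fin m) → A) :
    wedgeForm a v = ∑ i, a i • wedge i v := rfl

theorem contrForm_apply (u : Fin m → ℂ) (v : Finset (Fin m) → A) :
    contrForm u v = ∑ i, u i • contr i v := rfl

theorem wedgeForm_comp (f : A →ₗ[ℂ] A') (a : Fin m → ℂ) (v : Finset (Fin m) → A) :
    wedgeForm a (fun I => f (v I)) = fun I => f (wedgeForm a v I) := by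
  ext I
  simp only [wedgeForm_apply, Finset.sum_apply, Pi.smul_apply, map_sum, map_smul]
  exact Finset.sum_congr rfl fun i _ => congrArg _ (congrFun (wedge_comp f.toAddMonoidHom i v) I)

theorem contrForm_comp (f : A →ₗ[ℂ] A') (u : Fin m → ℂ) (v : Finset (Fin m) → A) :
    contrForm u (fun I => f (v I)) = fun I => f (contrForm u v I) := by
  ext I
  simp only [contrForm_apply, Finset.sum_apply, Pi.smul_apply, map_sum, map_smul]
  exact Finset.sum_congr rfl fun i _ => congrArg _ (congrFun (contr_comp f.toAddMonoidHom i v) I)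

theorem wedgeForm_wedgeForm (a b : Fin m → ℂ) (v : Finset (Fin m) → A) :
    wedgeForm a (wedgeForm b v) = -wedgeForm b (wedgeForm a v) := by
  rw [← add_eq_zero_iff_eq_neg]
  simp only [wedgeForm_apply, map_sum, map_smul, Finset.smul_sum]
  nth_rewrite 2 [Finset.sum_comm]
  simp only [← Finset.sum_add_distrib]
  refine Finset.sum_eq_zero fun i _ => Finset.sum_eq_zero fun k _ => ?_
  rw [smul_smul, smul_smul, mul_comm (b i), ← smul_add, wedge_wedge, smul_zero]

theorem wedgeForm_wedgeForm_self (a : Fin m → ℂ) (v : Finset (Fin m) → A) :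
    wedgeForm a (wedgeForm a v) = 0 := by
  have h := wedgeForm_wedgeForm a a v
  rw [← add_eq_zero_iff_eq_neg, ← two_smul ℂ] at h
  exact (smul_eq_zero.1 h).resolve_left two_ne_zero

theorem wedgeForm_contrForm (a u : Fin m → ℂ) (v : Finset (Fin m) → A) :
    wedgeForm a (contrForm u v) + contrForm u (wedgeForm a v) = (∑ i, a i * u i) • v := by
  simp only [wedgeForm_apply, contrForm_apply, map_sum, wedge_smul, contr_smul]
  nth_rewrite 2 [Finset.sum_comm]
  simp only [← Finset.sum_add_distrib, smul_smul]
  rw [Finset.sum_smul]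
  refine Finset.sum_congr rfl fun i _ => ?_
  rw [Finset.sum_eq_single i]
  · rw [mul_comm (u i), ← smul_add, wedge_contr, if_pos rfl]
  · intro k _ hk
    rw [mul_comm (u i), ← smul_add, wedge_contr, if_neg hk, smul_zero]
  · simp

variable {n : ℕ}

theorem dvd_wedgeForm {q : PolyRing n} {v : Finset (Fin m) → PolyRing n} (h : ∀ I, q ∣ v I)
    (a : Fin m → ℂ) (I : Finset (Fin m)) : q ∣ wedgeForm a v I := by
  choose w hw using h
  obtain rfl : v = fun I => q * w I := funext hw
  have := congrFun (wedgeForm_comp (LinearMap.mulLeft ℂ q) a w) I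
  simp only [LinearMap.mulLeft_apply] at this
  rw [this]
  exact dvd_mul_right _ _

theorem dvd_contrForm {q : PolyRing n} {v : Finset (Fin m) → PolyRing n} (h : ∀ I, q ∣ v I)
    (u : Fin m → ℂ) (I : Finset (Fin m)) : q ∣ contrForm u v I := by
  choose w hw using h
  obtain rfl : v = fun I => q * w I := funext hw
  have := congrFun (contrForm_comp (LinearMap.mulLeft ℂ q) u w) I
  simp only [LinearMap.mulLeft_apply] at this
  rw [this]
  exact dvd_mul_right _ _

theorem wedgeForm_smul (q : PolyRing n) (a : Fin m → ℂ) (v : Finset (Fin m) → PolyRing n) :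
    wedgeForm a (q • v) = q • wedgeForm a v :=
  wedgeForm_comp (LinearMap.mulLeft ℂ q) a v

/-- The grading of forms for which `dx_I` has degree `|I|`. -/
def formDegree (m : ℕ) (I : Finset (Fin m)) : ℤ := I.card

theorem wedgeForm_mem {v : Finset (Fin m) → PolyRing n} {e : ℤ}
    (hv : v ∈ vecHomogeneous n (formDegree m) e) (a : Fin m → ℂ) :
    wedgeForm a v ∈ vecHomogeneous n (formDegree m) (e + 1) := by
  rw [wedgeForm_apply]
  refine sum_mem fun i _ => Submodule.smul_mem _ _ fun I => ?_
  rw [wedge_apply]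
  split_ifs with hi
  · have h1 := hv (I.erase i)
    have h2 : e - formDegree m (I.erase i) = e + 1 - formDegree m I := by
      rw [formDegree, formDegree, ← Finset.card_erase_add_one hi]
      push_cast
      ring
    rw [h2] at h1
    exact zsmul_mem h1 _
  · exact zero_mem _

theorem contrForm_mem {v : Finset (Fin m) → PolyRing n} {e : ℤ}
    (hv : v ∈ vecHomogeneous n (formDegree m) e) (u : Fin m → ℂ) :
    contrForm u v ∈ vecHomogeneous n (formDegree m) (e - 1) := by
  rw [contrForm_apply]
  refine sum_mem fun i _ => Submodule.smul_mem _ _ fun I => ?_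
  rw [contr_apply]
  split_ifs with hi
  · exact zero_mem _
  · have h1 := hv (insert i I)
    have h2 : e - formDegree m (insert i I) = e - 1 - formDegree m I := by
      rw [formDegree, formDegree, Finset.card_insert_of_notMem hi]
      push_cast
      ring
    rw [h2] at h1
    exact zsmul_mem h1 _

theorem wedgeForm_vecComponent (a : Fin m → ℂ) (v : Finset (Fin m) → PolyRing n) (e : ℤ) :
    wedgeForm a (vecComponent n (formDegree m) e v) =
      vecComponent n (formDegree m) (e + 1) (wedgeForm a v) := by
  obtain ⟨E, -, hE⟩ := exists_sum_vecComponent (formDegree m) v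
  rw [hE]
  simp only [map_sum]
  refine Finset.sum_congr rfl fun e' _ => ?_
  have h1 := vecComponent_mem (formDegree m) e' v
  rw [vecComponent_of_mem h1, vecComponent_of_mem (wedgeForm_mem h1 a)]
  by_cases h : e = e'
  · simp [h]
  · rw [if_neg h, if_neg (by omega), map_zero]

theorem laurentMap_wedgeForm (a : Fin m → ℂ) (v : Finset (Fin m) → PolyRing n) :
    laurentMap n _ (wedgeForm a v) = wedgeForm a (laurentMap n _ v) :=
  (wedgeForm_comp (toLaurent n).toLinearMap a v).symm

theorem laurentMap_contrForm (u : Fin m → ℂ) (v : Finset (Fin m) → PolyRing n) :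
    laurentMap n _ (contrForm u v) = contrForm u (laurentMap n _ v) :=
  (contrForm_comp (toLaurent n).toLinearMap u v).symm

theorem wedgeForm_smul_laurent (q : Laurent n) (a : Fin m → ℂ) (v : Finset (Fin m) → Laurent n) :
    wedgeForm a (q • v) = q • wedgeForm a v :=
  wedgeForm_comp (LinearMap.mulLeft ℂ q) a v

theorem contrForm_smul_laurent (q : Laurent n) (u : Fin m → ℂ) (v : Finset (Fin m) → Laurent n) :
    contrForm u (q • v) = q • contrForm u v :=
  contrForm_comp (LinearMap.mulLeft ℂ q) u v

end WedgeForm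

/-! ### Linear forms -/

section LinForm

variable {n : ℕ}

theorem coeff_linForm (v : Fin n → ℂ) (i : Fin n) :
    (linForm n v).coeff (Finsupp.single i 1) = v i := by
  rw [linForm_apply, coeff_sum, Finset.sum_eq_single i]
  · rw [coeff_C_mul, coeff_X, if_pos rfl, mul_one]
  · intro k _ hk
    rw [coeff_C_mul, coeff_X, if_neg, mul_zero]
    exact fun h => hk ((Finsupp.single_left_inj one_ne_zero).1 h)
  · simp

theorem linForm_injective : Function.Injective (linForm n) := by
  intro v w h
  ext i
  rw [← coeff_linForm v, h, coeff_linForm]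

theorem linForm_ne_zero {v : Fin n → ℂ} (hv : v ≠ 0) : linForm n v ≠ 0 := fun h =>
  hv (linForm_injective (h.trans (map_zero _).symm))

theorem prime_linForm {v : Fin n → ℂ} (hv : v ≠ 0) : Prime (linForm n v) := by
  have hdeg : (linForm n v).totalDegree = 1 :=
    (mem_polyHomogeneous_natCast.1 (by exact_mod_cast linForm_mem v)).totalDegree
      (linForm_ne_zero hv)
  refine (irreducible_of_totalDegree_eq_one hdeg fun a ha => ?_).prime
  obtain ⟨i, hi⟩ := Function.ne_iff.1 hv
  have h1 := ha (Finsupp.single i 1)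
  rw [coeff_linForm] at h1
  exact isUnit_iff_ne_zero.2 fun h => hi (zero_dvd_iff.1 (h ▸ h1))

theorem exists_smul_eq_of_linForm_dvd {v w : Fin n → ℂ} (h : linForm n v ∣ linForm n w) :
    ∃ a : ℂ, w = a • v := by
  obtain ⟨c, hc⟩ := h
  refine ⟨c.coeff 0, linForm_injective ?_⟩
  have h1 := polyComponent_mul_of_mem (linForm_mem v) 1 c
  rw [mul_comm, ← hc, polyComponent_of_mem (linForm_mem w), if_pos rfl, sub_self, polyComponent,
    if_pos le_rfl, Int.toNat_zero, homogeneousComponent_zero] at h1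
  rw [h1, map_smul, smul_eq_C_mul]

end LinForm

/-! ### Logarithmic forms without denominators -/

section LogMod

variable {m n r : ℕ} {κ : Type*}

/-- The logarithmic forms of an arrangement, multiplied by its equation: the forms `ω` with
polynomial coefficients such that `ℓ_k` divides `α_k ∧ ω` for the hyperplanes `k ∈ D`. The linear
form `ℓ_k` in the coefficient ring and the constant form `α_k` are independent data; this allows
to change the number of variables while the exterior algebra is kept. -/
def logMod (α : κ → Fin m → ℂ) (ℓ : κ → Fin n → ℂ) (D : Finset κ) :
    Submodule (PolyRing n) (Finset (Fin m) → PolyRing n) where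
  carrier := {v | ∀ k ∈ D, ∀ I, linForm n (ℓ k) ∣ wedgeForm (α k) v I}
  zero_mem' k _ I := by simp
  add_mem' hv hw k hk I := by
    rw [map_add]
    exact dvd_add (hv k hk I) (hw k hk I)
  smul_mem' q v hv k hk I := by
    rw [wedgeForm_smul]
    exact Dvd.dvd.mul_left (hv k hk I) q

variable {α : κ → Fin m → ℂ} {ℓ : κ → Fin n → ℂ} {D : Finset κ}

theorem mem_logMod {v : Finset (Fin m) → PolyRing n} :
    v ∈ logMod α ℓ D ↔ ∀ k ∈ D, ∀ I, linForm n (ℓ k) ∣ wedgeForm (α k) v I := Iff.rfl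

theorem isGradedSubmodule_logMod (α : κ → Fin m → ℂ) (ℓ : κ → Fin n → ℂ) (D : Finset κ) :
    IsGradedSubmodule (formDegree m) (logMod α ℓ D) := by
  intro v hv e k hk I
  obtain ⟨q, hq⟩ := hv k hk I
  rw [wedgeForm_vecComponent, vecComponent_apply, hq, mul_comm,
    polyComponent_mul_of_mem (linForm_mem _)]
  exact dvd_mul_left _ _

theorem baseChange_logMod {B : (Fin r → ℂ) →ₗ[ℂ] (Fin n → ℂ)} (hB : Function.Injective B)
    {ℓ' : κ → Fin r → ℂ} (h : ∀ k ∈ D, B (ℓ' k) = ℓ k) :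
    baseChange (linSubst B) (logMod α ℓ' D) = logMod α ℓ D := by
  obtain ⟨J, G, F, hG, hF, hFG⟩ := isPolynomialExtension_linSubst hB
  ext v
  rw [mem_baseChange hG hF hFG]
  simp only [mem_logMod]
  have h1 : ∀ (j : J →₀ ℕ) k I, wedgeForm (α k) (fun I => (G (v I)).coeff j) I =
      (G (wedgeForm (α k) v I)).coeff j := by
    intro j k I
    let f : PolyRing n →ₗ[ℂ] PolyRing r :=
      (MvPolynomial.lcoeff (PolyRing r) j).restrictScalars ℂ ∘ₗ G.toLinearMap
    exact congrFun (wedgeForm_comp f (α k) v) I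
  simp only [h1]
  constructor
  · intro hv k hk I
    rw [← h k hk, ← linSubst_linForm, dvd_iff_forall_coeff hG hF hFG]
    exact fun j => hv j k hk I
  · intro hv j k hk I
    have h2 := hv k hk I
    rw [← h k hk, ← linSubst_linForm, dvd_iff_forall_coeff hG hF hFG] at h2
    exact h2 j

theorem GradedPieces.mem_loc_of_map {V W : Type*} [AddCommGroup V] [Module (PolyRing n) V]
    [AddCommGroup W] [Module (PolyRing n) W] {N : GradedPieces n V} {N' : GradedPieces n W}
    (φ : V →+ W) (hφ : ∀ (q : PolyRing n) v, φ (q • v) = q • φ v)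
    (h : ∀ e v, v ∈ N.piece e → φ v ∈ N'.piece e) {S : Finset (Fin n)} {e : ℤ} {v : V}
    (hv : v ∈ N.loc S e) : φ v ∈ N'.loc S e := by
  obtain ⟨a, ha⟩ := hv
  exact ⟨a, by rw [← hφ]; exact h _ _ ha⟩

theorem wedgeForm_contrForm_mem_logMod {v : Finset (Fin m) → PolyRing n} (hv : v ∈ logMod α ℓ D)
    {b u : Fin m → ℂ} (hu : ∀ k ∈ D, ∑ i, α k i * u i = 0) :
    wedgeForm b (contrForm u v) ∈ logMod α ℓ D := by
  intro k hk I
  have h1 := wedgeForm_contrForm (α k) u v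
  rw [hu k hk, zero_smul, add_eq_zero_iff_eq_neg] at h1
  rw [wedgeForm_wedgeForm, h1, map_neg, neg_neg]
  exact dvd_wedgeForm (fun I => dvd_contrForm (hv k hk) u I) b I

/-- Adding to an arrangement the hyperplane of a variable independent of its equations. With `u`
a vector on which the additional form `b` is one and the other forms vanish, the identity
`v = u⌟(b∧v) + b∧(u⌟v)` splits the modules before and after into summands which agree up to the
factor `xᵢ`. -/
theorem RegularityLE.logMod_insert [DecidableEq κ] {k₀ : κ} {i : Fin n}
    (hi : linForm n (ℓ k₀) = X i)
    {u : Fin m → ℂ} (hu : ∀ k ∈ D, ∑ l, α k l * u l = 0) (hu₀ : ∑ l, α k₀ l * u l = 1)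
    (hdvd : ∀ k ∈ D, ∀ t, linForm n (ℓ k) ∣ X i * t → linForm n (ℓ k) ∣ t) {ρ : ℤ}
    (h : RegularityLE (formDegree m) (logMod α ℓ D) ρ) :
    RegularityLE (formDegree m) (logMod α ℓ (insert k₀ D)) ρ := by
  intro p e he c hc hcp hdc
  set N := laurentPieces (formDegree m) (logMod α ℓ D)
  set N' := laurentPieces (formDegree m) (logMod α ℓ (insert k₀ D))
  obtain ⟨y, hy⟩ := (XBijective_laurent i).2 (1 : Laurent n)
  have hy : toLaurent n (X i) * y = 1 := hy
  have hsmulR : ∀ (q : PolyRing n) (v : Finset (Fin m) → Laurent n), q • v = toLaurent n q • v :=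
    fun q v => rfl
  -- `v ↦ (xᵢ⁻¹ b∧v, b∧(u⌟v))` embeds the new module into the sum of two copies of the old one,
  -- with left inverse `(v₁, v₂) ↦ xᵢ u⌟v₁ + b∧(u⌟v₂)`
  let f₁ : (Finset (Fin m) → Laurent n) →+ (Finset (Fin m) → Laurent n) :=
    (wedgeForm (α k₀)).toAddMonoidHom.comp (DistribSMul.toAddMonoidHom _ y)
  let f₂ : (Finset (Fin m) → Laurent n) →+ (Finset (Fin m) → Laurent n) :=
    (wedgeForm (α k₀)).toAddMonoidHom.comp (contrForm u).toAddMonoidHom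
  let g₁ : (Finset (Fin m) → Laurent n) →+ (Finset (Fin m) → Laurent n) :=
    (DistribSMul.toAddMonoidHom _ (toLaurent n (X i))).comp (contrForm u).toAddMonoidHom
  have hf₁ : ∀ v, f₁ v = wedgeForm (α k₀) (y • v) := fun _ => rfl
  have hf₂ : ∀ v, f₂ v = wedgeForm (α k₀) (contrForm u v) := fun _ => rfl
  have hg₁ : ∀ v, g₁ v = toLaurent n (X i) • contrForm u v := fun _ => rfl
  have hsplit : ∀ v : Finset (Fin m) → Laurent n,
      contrForm u (wedgeForm (α k₀) v) = v - wedgeForm (α k₀) (contrForm u v) := by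
    intro v
    have := wedgeForm_contrForm (α k₀) u v
    rw [hu₀, one_smul] at this
    exact eq_sub_of_add_eq' this
  have hsum : ∀ v, g₁ (f₁ v) + f₂ (f₂ v) = v := by
    intro v
    rw [hg₁, hf₁, hf₂, hf₂, ← contrForm_smul_laurent, ← wedgeForm_smul_laurent, smul_smul, hy,
      one_smul, hsplit, hsplit, map_sub, wedgeForm_wedgeForm_self, sub_zero, sub_add_cancel]
  have hf₁R : ∀ (q : PolyRing n) v, f₁ (q • v) = q • f₁ v := by
    intro q v
    rw [hsmulR, hsmulR, hf₁, hf₁, smul_comm, wedgeForm_smul_laurent]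
  have hf₂R : ∀ (q : PolyRing n) v, f₂ (q • v) = q • f₂ v := by
    intro q v
    rw [hsmulR, hsmulR, hf₂, hf₂, contrForm_smul_laurent, wedgeForm_smul_laurent]
  have hg₁R : ∀ (q : PolyRing n) v, g₁ (q • v) = q • g₁ v := by
    intro q v
    rw [hsmulR, hsmulR, hg₁, hg₁, contrForm_smul_laurent, smul_comm]
  have hf₁mem : ∀ e v, v ∈ N'.piece e → f₁ v ∈ N.piece e := by
    intro e v hv
    obtain ⟨w, hw, hwe, rfl⟩ := mem_laurentPieces.1 hv
    choose t ht using fun I => hw k₀ (Finset.mem_insert_self k₀ D) I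
    simp only [hi] at ht
    have ht' : wedgeForm (α k₀) w = (X i : PolyRing n) • t := funext ht
    refine mem_laurentPieces.2 ⟨t, fun k hk I => hdvd k hk _ ?_, fun I => ?_, ?_⟩
    · have h1 : X i * wedgeForm (α k) t I = wedgeForm (α k) (wedgeForm (α k₀) w) I := by
        rw [ht', wedgeForm_smul]
        rfl
      rw [h1, wedgeForm_wedgeForm, Pi.neg_apply, dvd_neg]
      exact dvd_wedgeForm (hw k (Finset.mem_insert_of_mem hk)) _ I
    · -- cancel the factor `xᵢ`, of degree one
      have h1 := wedgeForm_mem hwe (α k₀) I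
      rw [ht, mul_comm] at h1
      have h2 := polyComponent_mul_of_mem (X_mem_polyHomogeneous i)
        (e + 1 - formDegree m I) (t I)
      rw [polyComponent_of_mem h1, if_pos rfl] at h2
      rw [mul_right_cancel₀ (X_ne_zero i) h2,
        show e + 1 - formDegree m I - 1 = e - formDegree m I by ring]
      exact polyComponent_mem _ _
    · rw [hf₁, wedgeForm_smul_laurent, ← laurentMap_wedgeForm, ht', map_smul, hsmulR, smul_smul,
        mul_comm, hy, one_smul]
  have hf₂mem : ∀ e v, v ∈ N'.piece e → f₂ v ∈ N.piece e := by
    intro e v hv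
    obtain ⟨w, hw, hwe, rfl⟩ := mem_laurentPieces.1 hv
    refine mem_laurentPieces.2 ⟨wedgeForm (α k₀) (contrForm u w), ?_, ?_, ?_⟩
    · exact wedgeForm_contrForm_mem_logMod (fun k hk => hw k (Finset.mem_insert_of_mem hk)) hu
    · simpa using wedgeForm_mem (contrForm_mem hwe u) (α k₀)
    · rw [hf₂, laurentMap_wedgeForm, laurentMap_contrForm]
  have hf₂mem' : ∀ e v, v ∈ N.piece e → f₂ v ∈ N'.piece e := by
    intro e v hv
    obtain ⟨w, hw, hwe, rfl⟩ := mem_laurentPieces.1 hv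
    refine mem_laurentPieces.2 ⟨wedgeForm (α k₀) (contrForm u w), fun k hk => ?_, ?_, ?_⟩
    · rcases Finset.mem_insert.1 hk with rfl | hk
      · intro I
        rw [wedgeForm_wedgeForm_self]
        exact dvd_zero _
      · exact wedgeForm_contrForm_mem_logMod hw hu k hk
    · simpa using wedgeForm_mem (contrForm_mem hwe u) (α k₀)
    · rw [hf₂, laurentMap_wedgeForm, laurentMap_contrForm]
  have hg₁mem : ∀ e v, v ∈ N.piece e → g₁ v ∈ N'.piece e := by
    intro e v hv
    obtain ⟨w, hw, hwe, rfl⟩ := mem_laurentPieces.1 hv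
    refine mem_laurentPieces.2 ⟨(X i : PolyRing n) • contrForm u w, fun k hk I => ?_, ?_, ?_⟩
    · rw [wedgeForm_smul]
      rcases Finset.mem_insert.1 hk with rfl | hk
      · rw [hi]
        exact dvd_mul_right _ _
      · have h1 := wedgeForm_contrForm (α k) u w
        rw [hu k hk, zero_smul, add_eq_zero_iff_eq_neg] at h1
        rw [h1]
        exact Dvd.dvd.mul_left ((dvd_neg (α := PolyRing n)).2 (dvd_contrForm (hw k hk) u I)) _
    · simpa using X_smul_mem_vecHomogeneous i (contrForm_mem hwe u)
    · rw [hg₁, map_smul, laurentMap_contrForm]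
      rfl
  obtain ⟨b₁, hb₁, hdb₁⟩ := h p e he (fun S => f₁ (c S))
    (fun S => GradedPieces.mem_loc_of_map f₁ hf₁R hf₁mem (hc S))
    (fun S hS => by rw [hcp S hS, map_zero])
    (by rw [cobd_comp, hdc]; ext S : 1; exact map_zero f₁)
  obtain ⟨b₂, hb₂, hdb₂⟩ := h p e he (fun S => f₂ (c S))
    (fun S => GradedPieces.mem_loc_of_map f₂ hf₂R hf₂mem (hc S))
    (fun S hS => by rw [hcp S hS, map_zero])
    (by rw [cobd_comp, hdc]; ext S : 1; exact map_zero f₂)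
  refine ⟨(fun S => g₁ (b₁ S)) + fun S => f₂ (b₂ S), fun S => add_mem
    (GradedPieces.mem_loc_of_map g₁ hg₁R hg₁mem (hb₁ S))
    (GradedPieces.mem_loc_of_map f₂ hf₂R hf₂mem' (hb₂ S)), ?_⟩
  rw [map_add, cobd_comp, cobd_comp, hdb₁, hdb₂]
  ext S : 1
  exact hsum (c S)

theorem GradedPieces.exactAt_zero_of_pos {V : Type*} [AddCommGroup V] [Module (PolyRing n) V]
    (N : GradedPieces n V) (hn : 0 < n) (e : ℤ) : N.ExactAt 0 e := by
  intro c _ hcp hdc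
  refine ⟨0, fun S => zero_mem _, ?_⟩
  have h0 : c ∅ = 0 := by
    have h1 := congrFun hdc {⟨0, hn⟩}
    rw [cobd_apply, Finset.sum_apply, Finset.sum_eq_single ⟨0, hn⟩] at h1
    · simpa [wedge_apply, koszulSign, Finset.filter_singleton] using h1
    · intro i _ hi
      rw [wedge_apply, if_neg (by simpa using hi)]
    · simp
  ext S
  by_cases hS : S = ∅
  · rw [hS, h0, map_zero, Pi.zero_apply]
  · rw [hcp S (by simpa using hS), map_zero, Pi.zero_apply]

/-- If the hyperplanes `k 0, …, k (n-1)` of the arrangement are the coordinate hyperplanes, and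
removing any nonempty set of them yields regularity at most `ρ - 1`, then the arrangement has
regularity at most `ρ`. -/
theorem regularityLE_logMod_of_sdiff [DecidableEq κ] (hn : 0 < n) {k : Fin n → κ}
    (hk : ∀ i, linForm n (ℓ (k i)) = X i) {ρ : ℤ}
    (h : ∀ T : Finset (Fin n), T.Nonempty →
      RegularityLE (formDegree m) (logMod α ℓ (D \ T.image k)) (ρ - 1)) :
    RegularityLE (formDegree m) (logMod α ℓ D) ρ := by
  intro p e he
  rcases p with _ | t
  · exact GradedPieces.exactAt_zero_of_pos _ hn e
  let N : Finset (Fin n) → GradedPieces n (Finset (Fin m) → Laurent n) := fun T =>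
    laurentPieces (formDegree m) (logMod α ℓ (D \ T.image k))
  have h0 : mulProdX N ∅ = laurentPieces (formDegree m) (logMod α ℓ D) := by
    refine GradedPieces.ext' fun e v => ?_
    rw [mem_mulProdX]
    simp [N, prodX]
  rw [← h0]
  refine GradedPieces.exactAt_of_family (mulProdX N) e t (mulProdX_insert_le ?_)
    (X_smul_mem_mulProdX ?_) fun T hT => ?_
  · intro T i e v hv
    obtain ⟨w, hw, hwe, rfl⟩ := mem_laurentPieces.1 hv
    refine mem_laurentPieces.2 ⟨(X i : PolyRing n) • w, fun l hl I => ?_,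
      X_smul_mem_vecHomogeneous i hwe, map_smul _ _ _⟩
    rw [wedgeForm_smul]
    by_cases hli : l = k i
    · rw [hli, hk]
      exact dvd_mul_right _ _
    · refine Dvd.dvd.mul_left (hw l ?_ I) _
      rw [Finset.mem_sdiff] at hl ⊢
      refine ⟨hl.1, fun hl' => hl.2 ?_⟩
      rw [Finset.image_insert, Finset.mem_insert] at hl'
      exact hl'.resolve_left hli
  · intro T i e v hv
    obtain ⟨w, hw, hwe, rfl⟩ := mem_laurentPieces.1 hv
    refine mem_laurentPieces.2 ⟨w, fun l hl I => hw l ?_ I, hwe, rfl⟩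
    exact Finset.sdiff_subset_sdiff le_rfl (Finset.image_subset_image (Finset.subset_insert i T)) hl
  · refine exactAt_mulProdX XBijective_laurent_pi (h T hT _ _ ?_)
    push_cast at he ⊢
    omega

/-- The rank of a finite set of linear forms. -/
def formRank (α : κ → Fin m → ℂ) (D : Finset κ) : ℕ :=
  Module.finrank ℂ (Submodule.span ℂ (α '' D))

theorem formRank_le_sdiff_add [DecidableEq κ] (α : κ → Fin m → ℂ) (D T : Finset κ) :
    formRank α D ≤ formRank α (D \ T) + T.card := by
  have h1 : Submodule.span ℂ (α '' D) ≤
      Submodule.span ℂ (α '' ((D \ T : Finset κ) : Set κ)) ⊔ Submodule.span ℂ (α '' T) := by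
    rw [← Submodule.span_union, ← Set.image_union]
    refine Submodule.span_mono (Set.image_mono fun k hk => ?_)
    by_cases h : k ∈ T
    · exact Or.inr h
    · exact Or.inl (Finset.mem_sdiff.2 ⟨hk, h⟩)
  refine (Submodule.finrank_mono h1).trans ((Submodule.finrank_add_le_finrank_add_finrank _ _).trans
    (Nat.add_le_add_left ?_ _))
  classical
  have h2 := finrank_span_finset_le_card (R := ℂ) (T.image α)
  rw [Finset.coe_image] at h2
  exact h2.trans Finset.card_image_le

/-- A basis of the span of the forms of an arrangement, chosen among these forms. -/
theorem exists_basis_forms (α : κ → Fin m → ℂ) (D : Finset κ) :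
    ∃ k : Fin (formRank α D) → κ, (∀ i, k i ∈ D) ∧ LinearIndependent ℂ (fun i => α (k i)) ∧
      Submodule.span ℂ (Set.range fun i => α (k i)) = Submodule.span ℂ (α '' D) := by
  obtain ⟨f, hfD, hfspan, hfli⟩ := Submodule.exists_fun_fin_finrank_span_eq ℂ (α '' (D : Set κ))
  choose k hk hkf using hfD
  obtain rfl : (fun i => α (k i)) = f := funext hkf
  exact ⟨k, hk, hfli, hfspan⟩

/-- The forms `ω = f η`, `η` logarithmic, have regularity at most `d + m - r` for `d` hyperplanes
of rank `r`, when all form degrees are taken together. The number `n` of variables does not enter,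
so one can pass to a space in which the hyperplanes are essential. If no hyperplane is independent
of the others, any `t > 0` of them can be removed with a loss of rank of at most `t - 1`. -/
theorem resolutionLE_logMod [DecidableEq κ] (α : κ → Fin m → ℂ) (D : Finset κ) :
    (∀ k ∈ D, α k ≠ 0) → ∀ (n : ℕ) (ℓ : κ → Fin n → ℂ) (B : (Fin n → ℂ) →ₗ[ℂ] (Fin m → ℂ)),
      Function.Injective B → (∀ k ∈ D, B (ℓ k) = α k) → ∀ l,
        ResolutionLE n l (formDegree m) (logMod α ℓ D) (D.card + m - formRank α D) := by
  induction D using Finset.strongInduction with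
  | H D ih =>
  intro hα n ℓ B hB hℓ l
  rcases D.eq_empty_or_nonempty with rfl | ⟨kD, hkD⟩
  · have htop : logMod α ℓ ∅ = ⊤ := by
      ext v
      simp [mem_logMod]
    refine RegularityLE.resolutionLE l ?_ (isGradedSubmodule_logMod _ _ _)
    rw [htop]
    refine regularityLE_top fun I => ?_
    have := Finset.card_le_univ I
    rw [Fintype.card_fin] at this
    have h0 : formRank α ∅ = 0 := by simp [formRank]
    rw [h0, formDegree]
    push_cast
    omega
  -- pass to coordinates in which a basis among the linear forms consists of the variables
  obtain ⟨k, hkD', hli, hspan⟩ := exists_basis_forms α D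
  have hrpos : 0 < formRank α D := by
    rw [Nat.pos_iff_ne_zero, formRank, Ne, Submodule.finrank_eq_zero, Submodule.span_eq_bot]
    exact fun h => hα kD hkD (h _ ⟨kD, hkD, rfl⟩)
  generalize hr : formRank α D = r at k hkD' hli hspan hrpos ⊢
  let B₁ : (Fin r → ℂ) →ₗ[ℂ] (Fin n → ℂ) := (Pi.basisFun ℂ (Fin r)).constr ℂ fun i => ℓ (k i)
  have hB₁ : ∀ i, B₁ (Pi.single i 1) = ℓ (k i) := fun i => by
    rw [← Pi.basisFun_apply]
    exact Module.Basis.constr_basis _ _ _ _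
  let B₂ : (Fin r → ℂ) →ₗ[ℂ] (Fin m → ℂ) := B ∘ₗ B₁
  have hB₂ : ∀ i, B₂ (Pi.single i 1) = α (k i) := fun i => by
    rw [LinearMap.comp_apply, hB₁, hℓ _ (hkD' i)]
  have hB₂inj : Function.Injective B₂ := by
    have h1 : B₂ = (Pi.basisFun ℂ (Fin r)).constr ℂ fun i => α (k i) :=
      (Pi.basisFun ℂ (Fin r)).ext fun i => by
        rw [Module.Basis.constr_basis, Pi.basisFun_apply, hB₂]
    rw [h1]
    exact Module.Basis.injective_constr_of_linearIndependent _ hli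
  have hB₁inj : Function.Injective B₁ := fun v w h => hB₂inj (congrArg B h)
  have hex : ∀ l ∈ D, ∃ v, B₂ v = α l := by
    intro l hl
    have h1 : α l ∈ Submodule.span ℂ (Set.range fun i => α (k i)) := by
      rw [hspan]
      exact Submodule.subset_span ⟨l, hl, rfl⟩
    have h2 : Submodule.span ℂ (Set.range fun i => α (k i)) ≤ LinearMap.range B₂ := by
      rw [Submodule.span_le]
      rintro _ ⟨i, rfl⟩
      exact ⟨_, hB₂ i⟩
    exact h2 h1
  choose! ℓ' hℓ' using hex
  have hℓ'k : ∀ i, ℓ' (k i) = Pi.single i 1 := fun i =>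
    hB₂inj ((hℓ' _ (hkD' i)).trans (hB₂ i).symm)
  have hX : ∀ i, linForm r (ℓ' (k i)) = X i := fun i => by rw [hℓ'k, linForm_single]
  have hbase : baseChange (linSubst B₁) (logMod α ℓ' D) = logMod α ℓ D :=
    baseChange_logMod hB₁inj fun l hl => hB ((hℓ' l hl).trans (hℓ l hl).symm)
  rw [← hbase]
  refine ResolutionLE.baseChange hB₁inj l (RegularityLE.resolutionLE l ?_
    (isGradedSubmodule_logMod _ _ _))
  have hreg : ∀ D' ⊂ D, RegularityLE (formDegree m) (logMod α ℓ' D')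
      (D'.card + m - formRank α D') := fun D' hD' =>
    (ih D' hD' (fun l hl => hα l (hD'.1 hl)) r ℓ' B₂ hB₂inj (fun l hl => hℓ' l (hD'.1 hl))
      (r + 1)).regularityLE
  by_cases hcol : ∃ k₀ ∈ D, α k₀ ∉ Submodule.span ℂ (α '' ((D.erase k₀ : Finset κ) : Set κ))
  · -- a hyperplane independent of the others, which must belong to the basis
    obtain ⟨k₀, hk₀, hk₀'⟩ := hcol
    obtain ⟨i, rfl⟩ : ∃ i, k i = k₀ := by
      by_contra! hne
      refine hk₀' ?_
      have h1 : α k₀ ∈ Submodule.span ℂ (Set.range fun i => α (k i)) := by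
        rw [hspan]
        exact Submodule.subset_span ⟨k₀, hk₀, rfl⟩
      refine Submodule.span_mono ?_ h1
      rintro _ ⟨i, rfl⟩
      exact ⟨k i, Finset.mem_erase.2 ⟨hne i, hkD' i⟩, rfl⟩
    obtain ⟨φ, hφ, hφ'⟩ := Submodule.exists_le_ker_of_notMem hk₀'
    have hφsum : ∀ v : Fin m → ℂ, ∑ l, v l * ((φ (α (k i)))⁻¹ * φ (Pi.single l 1)) =
        (φ (α (k i)))⁻¹ * φ v := by
      intro v
      have h1 : v = ∑ l, v l • (Pi.single l 1 : Fin m → ℂ) := pi_eq_sum_univ' v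
      conv_rhs => rw [h1, map_sum, Finset.mul_sum]
      refine Finset.sum_congr rfl fun l _ => ?_
      rw [map_smul, smul_eq_mul]
      ring
    have h1 := RegularityLE.logMod_insert (α := α) (D := D.erase (k i)) (hX i)
      (u := fun l => (φ (α (k i)))⁻¹ * φ (Pi.single l 1))
      (fun l hl => by
        have : φ (α l) = 0 := hφ' (Submodule.subset_span ⟨l, hl, rfl⟩)
        rw [hφsum, this, mul_zero])
      (by rw [hφsum, inv_mul_cancel₀ hφ])
      (fun l hl t ht => by
        have hlD := Finset.mem_of_mem_erase hl
        have h0 : ℓ' l ≠ 0 := fun h => hα l hlD (by rw [← hℓ' l hlD, h, map_zero])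
        refine ((prime_linForm h0).dvd_or_dvd ht).resolve_left fun hdvd => hk₀' ?_
        rw [← hX i] at hdvd
        obtain ⟨a, ha⟩ := exists_smul_eq_of_linForm_dvd hdvd
        have h2 := congrArg B₂ ha
        rw [map_smul, hℓ' _ hk₀, hℓ' l hlD] at h2
        rw [h2]
        exact Submodule.smul_mem _ _ (Submodule.subset_span ⟨l, hl, rfl⟩))
      (hreg (D.erase (k i)) (Finset.erase_ssubset hk₀))
    rw [Finset.insert_erase hk₀] at h1
    refine h1.mono ?_
    have h2 := formRank_le_sdiff_add α D {k i}
    rw [Finset.sdiff_singleton_eq_erase, Finset.card_singleton] at h2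
    have h3 := Finset.card_erase_add_one hk₀
    omega
  · -- the first hyperplane that is removed does not change the rank
    push Not at hcol
    refine regularityLE_logMod_of_sdiff hrpos hX fun T hT => ?_
    obtain ⟨i, hi⟩ := hT
    have himg : T.image k ⊆ D := fun l hl => by
      obtain ⟨i, -, rfl⟩ := Finset.mem_image.1 hl
      exact hkD' i
    have hki : k i ∈ T.image k := Finset.mem_image_of_mem k hi
    refine (hreg (D \ T.image k) ⟨Finset.sdiff_subset, fun h => ?_⟩).mono ?_
    · exact (Finset.mem_sdiff.1 (h (hkD' i))).2 hki
    · have h1 : formRank α D = formRank α (D.erase (k i)) := by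
        suffices h : Submodule.span ℂ (α '' (D : Set κ)) =
            Submodule.span ℂ (α '' ((D.erase (k i) : Finset κ) : Set κ)) by
          rw [formRank, formRank, h]
        refine le_antisymm (Submodule.span_le.2 ?_)
          (Submodule.span_mono (Set.image_mono (Finset.erase_subset _ _)))
        rintro _ ⟨l, hl, rfl⟩
        by_cases hli : l = k i
        · rw [hli]
          exact hcol _ (hkD' i)
        · exact Submodule.subset_span ⟨l, Finset.mem_erase.2 ⟨hli, hl⟩, rfl⟩
      have h2 := formRank_le_sdiff_add α (D.erase (k i)) ((T.image k).erase (k i))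
      have h3 : D.erase (k i) \ (T.image k).erase (k i) = D \ T.image k := by
        ext l
        simp only [Finset.mem_sdiff, Finset.mem_erase]
        constructor
        · rintro ⟨⟨h4, h5⟩, h6⟩
          exact ⟨h5, fun h7 => h6 ⟨h4, h7⟩⟩
        · rintro ⟨h4, h5⟩
          exact ⟨⟨fun h6 => h5 (h6 ▸ hki), h4⟩, fun h6 => h5 h6.2⟩
      rw [h3] at h2
      have h4 := Finset.card_erase_add_one hki
      have h5 := Finset.card_sdiff_add_card_eq_card himg
      omega

end LogMod

/-! ### Restriction to one form degree -/

section Restrict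

variable {n : ℕ} {ι : Type}

/-- The elements of `R^ι` with support in `P`. -/
def supportedOn (n : ℕ) (P : ι → Prop) : Submodule (PolyRing n) (ι → PolyRing n) where
  carrier := {v | ∀ k, ¬ P k → v k = 0}
  zero_mem' _ _ := rfl
  add_mem' hv hw k hk := by simp [hv k hk, hw k hk]
  smul_mem' q v hv k hk := by simp [hv k hk]

open Classical in
/-- The projection of `A^ι` to the elements with support in `P`. -/
def restrictTo (P : ι → Prop) {A : Type*} [AddCommGroup A] : (ι → A) →+ (ι → A) where
  toFun v k := if P k then v k else 0
  map_zero' := by ext; simp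
  map_add' v w := by ext k; by_cases h : P k <;> simp [h]

open Classical in
theorem restrictTo_apply (P : ι → Prop) {A : Type*} [AddCommGroup A] (v : ι → A) (k : ι) :
    restrictTo P v k = if P k then v k else 0 := rfl

theorem restrictTo_smul (P : ι → Prop) {A : Type*} [AddCommGroup A] [Module (PolyRing n) A]
    (q : PolyRing n) (v : ι → A) : restrictTo P (q • v) = q • restrictTo P v := by
  ext k
  by_cases h : P k <;> simp [restrictTo_apply, h]

theorem restrictTo_mem_vecHomogeneous (P : ι → Prop) {s : ι → ℤ} {e : ℤ} {v : ι → PolyRing n}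
    (hv : v ∈ vecHomogeneous n s e) : restrictTo P v ∈ vecHomogeneous n s e := by
  intro k
  rw [restrictTo_apply]
  split_ifs
  · exact hv k
  · exact zero_mem _

theorem restrictTo_mem_supportedOn (P : ι → Prop) (v : ι → PolyRing n) :
    restrictTo P v ∈ supportedOn n P := by
  intro k hk
  rw [restrictTo_apply, if_neg hk]

theorem laurentMap_restrictTo (P : ι → Prop) (v : ι → PolyRing n) :
    laurentMap n ι (restrictTo P v) = restrictTo P (laurentMap n ι v) := by
  ext1 k
  by_cases h : P k <;> simp [laurentMap_apply, restrictTo_apply, h]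

/-- The bound on the regularity passes to a direct summand. -/
theorem RegularityLE.inf_supportedOn {s : ι → ℤ} {N : Submodule (PolyRing n) (ι → PolyRing n)}
    {ρ : ℤ} (h : RegularityLE s N ρ) {P : ι → Prop} (hP : ∀ v ∈ N, restrictTo P v ∈ N) :
    RegularityLE s (N ⊓ supportedOn n P) ρ := by
  intro p e he c hc hcp hdc
  have hsub : ∀ S (v : ι → Laurent n), v ∈ (laurentPieces s (N ⊓ supportedOn n P)).loc S e →
      v ∈ (laurentPieces s N).loc S e := by
    rintro S v ⟨a, ha⟩
    obtain ⟨w, hw, hwe, hwv⟩ := mem_laurentPieces.1 ha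
    exact ⟨a, mem_laurentPieces.2 ⟨w, hw.1, hwe, hwv⟩⟩
  obtain ⟨b, hb, hbc⟩ := h p e he c (fun S => hsub S _ (hc S)) hcp hdc
  refine ⟨fun S => restrictTo P (b S), fun S => ?_, ?_⟩
  · obtain ⟨a, ha⟩ := hb S
    obtain ⟨w, hw, hwe, hwb⟩ := mem_laurentPieces.1 ha
    refine ⟨a, mem_laurentPieces.2 ⟨restrictTo P w, ⟨hP w hw, restrictTo_mem_supportedOn P w⟩,
      restrictTo_mem_vecHomogeneous P hwe, ?_⟩⟩
    rw [laurentMap_restrictTo, hwb, restrictTo_smul]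
  · rw [cobd_comp, hbc]
    ext1 S
    obtain ⟨a, ha⟩ := hc S
    obtain ⟨w, hw, -, hwe⟩ := mem_laurentPieces.1 ha
    refine (XBijective_laurent_pi.prodX_pow S a).1 ?_
    dsimp only
    rw [← restrictTo_smul, ← hwe, ← laurentMap_restrictTo]
    congr 1
    ext1 k
    rw [restrictTo_apply]
    split_ifs with hk
    · rfl
    · exact (hw.2 k hk).symm

theorem IsGradedSubmodule.inf_supportedOn {s : ι → ℤ}
    {N : Submodule (PolyRing n) (ι → PolyRing n)} (h : IsGradedSubmodule s N) (P : ι → Prop) :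
    IsGradedSubmodule s (N ⊓ supportedOn n P) := by
  intro v hv e
  refine ⟨h v hv.1 e, fun k hk => ?_⟩
  rw [vecComponent_apply, hv.2 k hk, map_zero]

end Restrict

/-! ### Minimal graded free resolutions -/

section MinimalResolution

variable {n : ℕ}

/-- A graded submodule of a free module, contained in the maximal ideal times the free module,
with bounds on the generator degrees of the free module and on the regularity. -/
structure SyzygyModule (n : ℕ) where
  rank : ℕ
  degree : Fin rank → ℤ
  module : Submodule (PolyRing n) (Fin rank → PolyRing n)
  bound : ℤ
  degree_lt : ∀ k, degree k < bound
  regularityLE : RegularityLE degree module bound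
  isGraded : IsGradedSubmodule degree module
  mem_ideal : ∀ a ∈ module, ∀ k, a k ∈ Ideal.span (Set.range (X : Fin n → PolyRing n))

/-- The relations between minimal homogeneous generators. -/
theorem SyzygyModule.exists_relations {ι : Type} [Finite ι] {s : ι → ℤ}
    {N : Submodule (PolyRing n) (ι → PolyRing n)} {ρ : ℤ} (h : RegularityLE s N ρ)
    (hN : IsGradedSubmodule s N) : ∃ (S : SyzygyModule n) (w : Fin S.rank → ι → PolyRing n),
      S.bound = ρ + 1 ∧ (∀ k, w k ∈ vecHomogeneous n s (S.degree k)) ∧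
      Submodule.span (PolyRing n) (Set.range w) = N ∧ S.module = relations w := by
  obtain ⟨r, c, w, hw, hc, rfl, hmin⟩ := h.exists_minimal_generators hN
  exact ⟨⟨r, c, relations w, ρ + 1, fun k => Int.lt_add_one_iff.2 (hc k),
    RegularityLE.relations hw hc h, isGradedSubmodule_relations hw, hmin⟩, w, rfl, hw, rfl, rfl⟩

namespace SyzygyModule

/-- The next syzygy module. -/
def next (S : SyzygyModule n) : SyzygyModule n :=
  (exists_relations S.regularityLE S.isGraded).choose

/-- Minimal generators of a syzygy module. -/
def gen (S : SyzygyModule n) : Fin S.next.rank → Fin S.rank → PolyRing n :=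
  (exists_relations S.regularityLE S.isGraded).choose_spec.choose

theorem gen_spec (S : SyzygyModule n) : S.next.bound = S.bound + 1 ∧
    (∀ k, S.gen k ∈ vecHomogeneous n S.degree (S.next.degree k)) ∧
    Submodule.span (PolyRing n) (Set.range S.gen) = S.module ∧ S.next.module = relations S.gen :=
  (exists_relations S.regularityLE S.isGraded).choose_spec.choose_spec

/-- The iterated syzygy modules. -/
def iter (S : SyzygyModule n) : ℕ → SyzygyModule n
  | 0 => S
  | j + 1 => (S.iter j).next

theorem bound_iter (S : SyzygyModule n) (j : ℕ) : (S.iter j).bound = S.bound + j := by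
  induction j with
  | zero => simp [iter]
  | succ j ih =>
    rw [iter, (S.iter j).gen_spec.1, ih]
    push_cast
    ring

end SyzygyModule

theorem sum_smul_mem_vecHomogeneous {ι κ : Type} [Fintype κ] {s : ι → ℤ} {c : κ → ℤ}
    {w : κ → ι → PolyRing n} (hw : ∀ k, w k ∈ vecHomogeneous n s (c k)) {e : ℤ} {a : κ → PolyRing n}
    (ha : a ∈ vecHomogeneous n c e) : ∑ k, a k • w k ∈ vecHomogeneous n s e := by
  have h := sum_vecComponent_smul hw e a
  rw [vecComponent_of_mem ha, if_pos rfl] at h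
  rw [h]
  exact vecComponent_mem s e _

theorem freeGrading_add_const {r : ℕ} (c : Fin r → ℤ) (σ e : ℤ) {v : Fin r → PolyRing n} :
    v ∈ freeGrading n (fun k => c k - σ) e ↔ v ∈ vecHomogeneous n c (e + σ) :=
  forall_congr' fun k => by rw [show e - (c k - σ) = e + σ - c k by ring]

variable {M : Type*} [AddCommGroup M] [Module (PolyRing n) M] [Module ℂ M]
  {𝓜 : ℤ → Submodule ℂ M} {ι : Type} [Finite ι] {s : ι → ℤ}
  {N : Submodule (PolyRing n) (ι → PolyRing n)} {σ : ℤ}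

/-- A module isomorphic to a graded submodule of a free module, up to a shift of degrees, has
a minimal graded free resolution that attests the bound on the regularity. -/
theorem regularity_le_of_regularityLE {ρ : ℤ} (h : RegularityLE s N ρ) (hN : IsGradedSubmodule s N)
    (Ψ : N ≃ₗ[PolyRing n] M)
    (hΨ : ∀ e (v : N), (v : ι → PolyRing n) ∈ vecHomogeneous n s (e + σ) → Ψ v ∈ 𝓜 e) :
    regularity (n := n) 𝓜 ≤ (((ρ - σ : ℤ) : WithTop ℤ) : WithBot (WithTop ℤ)) := by
  obtain ⟨S, w, hS, hw, hwN, hrel⟩ := SyzygyModule.exists_relations h hN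
  -- `S.iter 0` is `S`
  let w₀ : Fin (S.iter 0).rank → ι → PolyRing n := w
  have hmem : ∀ a, Fintype.linearCombination (PolyRing n) w₀ a ∈ N := by
    intro a
    rw [← hwN, Fintype.linearCombination_apply]
    exact (Submodule.mem_span_range_iff_exists_fun _).2 ⟨a, rfl⟩
  let ε₀ := LinearMap.codRestrict N (Fintype.linearCombination (PolyRing n) w₀) hmem
  have hε₀ : ∀ a, (ε₀ a : ι → PolyRing n) = ∑ k, a k • w₀ k :=
    fun a => Fintype.linearCombination_apply _ _ _
  let d (j : ℕ) : (Fin (S.iter (j + 1)).rank → PolyRing n) →ₗ[PolyRing n]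
      (Fin (S.iter j).rank → PolyRing n) :=
    Fintype.linearCombination (PolyRing n) (S.iter j).gen
  have hd : ∀ j v, d j v = ∑ k, v k • (S.iter j).gen k :=
    fun j v => Fintype.linearCombination_apply _ _ _
  have hrange : ∀ j v, v ∈ Set.range (d j) ↔ v ∈ (S.iter j).module := by
    intro j v
    rw [← (S.iter j).gen_spec.2.2.1, Submodule.mem_span_range_iff_exists_fun]
    simp only [Set.mem_range, hd]
    rfl
  let F : MinimalGradedFreeResolution (n := n) 𝓜 :=
    { rank := fun j => (S.iter j).rank
      c := fun j k => (S.iter j).degree k - σ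
      ε := Ψ.toLinearMap ∘ₗ ε₀
      d := d
      ε_degree := by
        intro e v hv
        refine hΨ e _ ?_
        rw [hε₀]
        exact sum_smul_mem_vecHomogeneous (w := w₀) hw ((freeGrading_add_const _ σ e).1 hv)
      d_degree := by
        intro j e v hv
        rw [freeGrading_add_const] at hv ⊢
        rw [hd]
        exact sum_smul_mem_vecHomogeneous (S.iter j).gen_spec.2.1 hv
      ε_surjective := by
        intro m
        have h1 : (Ψ.symm m : ι → PolyRing n) ∈ Submodule.span (PolyRing n) (Set.range w₀) :=
          hwN.ge (Ψ.symm m).2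
        obtain ⟨a, ha⟩ := (Submodule.mem_span_range_iff_exists_fun _).1 h1
        refine ⟨a, ?_⟩
        rw [LinearMap.comp_apply, LinearEquiv.coe_coe, ← LinearEquiv.eq_symm_apply]
        exact Subtype.ext ((hε₀ a).trans ha)
      exact_zero := by
        intro v
        rw [hrange, LinearMap.comp_apply, LinearEquiv.coe_coe, LinearEquiv.map_eq_zero_iff,
          Subtype.ext_iff, hε₀]
        exact mem_relations.symm.trans (SetLike.ext_iff.1 hrel v).symm
      exact_succ := by
        intro j v
        rw [hrange, hd]
        change _ ↔ v ∈ (S.iter j).next.module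
        rw [(S.iter j).gen_spec.2.2.2]
        exact mem_relations.symm
      minimal := by
        intro j v l
        exact (S.iter j).mem_ideal _ ((hrange j _).1 ⟨v, rfl⟩) l }
  refine (iInf_le _ F).trans (iSup_le fun j => iSup_le fun k => ?_)
  rw [WithBot.coe_le_coe, WithTop.coe_le_coe]
  have h1 := (S.iter j).degree_lt k
  rw [S.bound_iter, hS] at h1
  change (S.iter j).degree k - σ - j ≤ ρ - σ
  omega

/-- The grading of a module isomorphic to a graded submodule of a free module. -/
theorem isGradedModule_of_isGradedSubmodule (hN : IsGradedSubmodule s N) (Ψ : N ≃ₗ[PolyRing n] M)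
    (hΨ : ∀ e (v : N), Ψ v ∈ 𝓜 e ↔ (v : ι → PolyRing n) ∈ vecHomogeneous n s (e + σ)) :
    IsGradedModule (n := n) 𝓜 := by
  have hΨ' : ∀ e m, m ∈ 𝓜 e ↔ (Ψ.symm m : ι → PolyRing n) ∈ vecHomogeneous n s (e + σ) := by
    intro e m
    rw [← hΨ, LinearEquiv.apply_symm_apply]
  constructor
  · have key : ∀ (e : ℤ) (x : DirectSum ℤ fun e => 𝓜 e),
        vecComponent n s (e + σ) (Ψ.symm (DirectSum.coeAddMonoidHom 𝓜 x)) =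
          (Ψ.symm (x e : M) : ι → PolyRing n) := by
      intro e x
      induction x using DirectSum.induction_on with
      | zero => simp
      | of i x =>
        rw [DirectSum.coeAddMonoidHom_of, vecComponent_of_mem ((hΨ' i x).1 x.2)]
        by_cases h : e = i
        · subst h
          simp
        · rw [if_neg (by omega), DirectSum.of_eq_of_ne _ _ _ h]
          simp
      | add x y hx hy =>
        rw [map_add, map_add, Submodule.coe_add, map_add, hx, hy, DirectSum.add_apply,
          Submodule.coe_add, map_add, Submodule.coe_add]
    constructor
    · rw [injective_iff_map_eq_zero]
      intro x hx
      ext e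
      have h1 := key e x
      rw [hx, map_zero, Submodule.coe_zero, map_zero] at h1
      have h2 : Ψ.symm (x e : M) = 0 := Subtype.ext h1.symm
      simpa using h2
    · intro m
      obtain ⟨E, -, hE⟩ := exists_sum_vecComponent s (Ψ.symm m : ι → PolyRing n)
      let v (e : ℤ) : N := ⟨_, hN _ (Ψ.symm m).2 e⟩
      have hv : ∀ e, Ψ (v e) ∈ 𝓜 (e - σ) := by
        intro e
        rw [hΨ, sub_add_cancel]
        exact vecComponent_mem s e _
      refine ⟨∑ e ∈ E, DirectSum.of (fun e => 𝓜 e) (e - σ) ⟨_, hv e⟩, ?_⟩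
      rw [map_sum]
      simp only [DirectSum.coeAddMonoidHom_of]
      rw [← map_sum, ← LinearEquiv.eq_symm_apply]
      refine Subtype.ext ?_
      rw [Submodule.coe_sum]
      exact hE.symm
  · intro e k p m hp hm
    rw [hΨ'] at hm ⊢
    intro i
    rw [map_smul, show e + k + σ - s i = e + (k + σ - s i) by ring]
    exact mul_mem_polyHomogeneous hp (hm i)

end MinimalResolution

/-! ### Logarithmic forms and divisibility -/

section LogForms

variable {n : ℕ}

/-- The product rule for a product of linear forms. -/
theorem pderiv_prod_linForm {κ : Type*} [DecidableEq κ] (α : κ → Fin n → ℂ) (D : Finset κ)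
    (i : Fin n) : pderiv i (∏ k ∈ D, linForm n (α k)) =
      ∑ k ∈ D, (∏ l ∈ D.erase k, linForm n (α l)) * C (α k i) := by
  have h1 : ∀ k, pderiv i (linForm n (α k)) = C (α k i) := by
    intro k
    rw [linForm_apply, map_sum, Finset.sum_eq_single i]
    · rw [pderiv_C_mul, pderiv_X_self, mul_one]
    · intro j _ hj
      rw [pderiv_C_mul, pderiv_X_of_ne hj, mul_zero]
    · simp
  induction D using Finset.induction_on with
  | empty => simp
  | insert k D hk ih =>
    rw [Finset.prod_insert hk, pderiv_mul, ih, h1, Finset.sum_insert hk, Finset.erase_insert hk,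
      mul_comm (C _), Finset.mul_sum]
    congr 1
    refine Finset.sum_congr rfl fun l hl => ?_
    have hlk : k ≠ l := fun h => hk (h ▸ hl)
    rw [Finset.erase_insert_of_ne hlk, Finset.prod_insert (fun h => hk (Finset.mem_of_mem_erase h)),
      mul_assoc]

/-- For pairwise non-associated primes `p_k`, the product of all of them divides
`∑ₖ (∏_{l ≠ k} p_l) g_k` only if `p_k` divides `g_k`. -/
theorem prod_dvd_sum_iff {κ R : Type*} [DecidableEq κ] [CommRing R] {D : Finset κ} {p g : κ → R}
    (hp : ∀ k ∈ D, Prime (p k)) (hne : ∀ k ∈ D, ∀ l ∈ D, p k ∣ p l → k = l) :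
    ∏ k ∈ D, p k ∣ ∑ k ∈ D, (∏ l ∈ D.erase k, p l) * g k ↔ ∀ k ∈ D, p k ∣ g k := by
  constructor
  · intro h k hk
    have h1 := (Finset.dvd_prod_of_mem p hk).trans h
    rw [← Finset.add_sum_erase D _ hk] at h1
    have h2 : p k ∣ ∑ x ∈ D.erase k, (∏ l ∈ D.erase x, p l) * g x := by
      refine Finset.dvd_sum fun x hx => Dvd.dvd.mul_right (Finset.dvd_prod_of_mem p ?_) _
      exact Finset.mem_erase.2 ⟨(Finset.ne_of_mem_erase hx).symm, hk⟩
    have h3 := (dvd_add_left h2).1 h1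
    refine ((hp k hk).dvd_or_dvd h3).resolve_left fun h4 => ?_
    obtain ⟨l, hl, hkl⟩ := (hp k hk).exists_mem_finset_dvd h4
    exact Finset.ne_of_mem_erase hl (hne k hk l (Finset.mem_of_mem_erase hl) hkl).symm
  · intro h
    refine Finset.dvd_sum fun k hk => ?_
    rw [← Finset.prod_erase_mul D p hk]
    exact mul_dvd_mul_left _ (h k hk)

/-- The rational form `ω / f`. -/
def divForm (f : PolyRing n) : (Finset (Fin n) → PolyRing n) →ₗ[PolyRing n] RatForm n where
  toFun ω I := algebraMap (PolyRing n) (RatFun n) (ω I) / algebraMap (PolyRing n) (RatFun n) f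
  map_add' ω ω' := by
    ext I
    rw [Pi.add_apply, map_add, add_div, Pi.add_apply]
  map_smul' q ω := by
    ext I
    rw [Pi.smul_apply, smul_eq_mul, map_mul, mul_div_assoc, RingHom.id_apply, Pi.smul_apply,
      Algebra.smul_def]

theorem divForm_apply (f : PolyRing n) (ω : Finset (Fin n) → PolyRing n) (I : Finset (Fin n)) :
    divForm f ω I =
      algebraMap (PolyRing n) (RatFun n) (ω I) / algebraMap (PolyRing n) (RatFun n) f := rfl

/-- The coefficients of `df ∧ ω`. -/
def differentialWedge (f : PolyRing n) (ω : Finset (Fin n) → PolyRing n) (J : Finset (Fin n)) :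
    PolyRing n := ∑ i ∈ J, (-1) ^ (J.filter (· < i)).card * (pderiv i f * ω (J.erase i))

/-- The identity `f d(ω / f) = dω - (df ∧ ω) / f`. -/
theorem smul_exteriorD_divForm {f : PolyRing n} (hf : f ≠ 0) (ω : Finset (Fin n) → PolyRing n)
    (J : Finset (Fin n)) : (f • exteriorD (divForm f ω)) J =
      algebraMap (PolyRing n) (RatFun n)
        (∑ i ∈ J, (-1) ^ (J.filter (· < i)).card * pderiv i (ω (J.erase i))) -
      algebraMap (PolyRing n) (RatFun n) (differentialWedge f ω J) /
        algebraMap (PolyRing n) (RatFun n) f := by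
  have h0 := coe_ne_zero hf
  rw [Pi.smul_apply, Algebra.smul_def, exteriorD, Finset.mul_sum, differentialWedge, map_sum,
    map_sum, Finset.sum_div, ← Finset.sum_sub_distrib]
  refine Finset.sum_congr rfl fun i _ => ?_
  have h1 : ratPartial i (divForm f ω (J.erase i)) = quotientRule i (ω (J.erase i)) f :=
    ratPartialFun_div i _ _ hf
  rw [h1, quotientRule]
  simp only [map_mul, map_pow, map_neg, map_one, map_sub]
  field_simp

theorem divForm_mem_logForms {f : PolyRing n} (hf : f ≠ 0) (ω : Finset (Fin n) → PolyRing n)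
    (j : ℤ) : divForm f ω ∈ logForms f j ↔
      (∀ I : Finset (Fin n), ¬ (I.card : ℤ) = j → ω I = 0) ∧ ∀ J, f ∣ differentialWedge f ω J := by
  have h0 := coe_ne_zero hf
  have h1 : ∀ I, divForm f ω I = 0 ↔ ω I = 0 := by
    intro I
    rw [divForm_apply, div_eq_zero_iff, or_iff_left h0,
      IsFractionRing.to_map_eq_zero_iff]
  have h2 : IsPolynomialForm (f • divForm f ω) := by
    intro I
    refine ⟨ω I, ?_⟩
    rw [Pi.smul_apply, Algebra.smul_def, divForm_apply, mul_div_cancel₀ _ h0]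
  have h3 : IsPolynomialForm (f • exteriorD (divForm f ω)) ↔ ∀ J, f ∣ differentialWedge f ω J := by
    refine forall_congr' fun J => ?_
    rw [smul_exteriorD_divForm hf]
    constructor
    · rintro ⟨q, hq⟩
      rw [eq_sub_iff_add_eq, ← eq_sub_iff_add_eq', div_eq_iff h0, ← map_sub, ← map_mul] at hq
      exact ⟨_, (IsFractionRing.injective (PolyRing n) (RatFun n) hq).trans (mul_comm _ _)⟩
    · rintro ⟨q, hq⟩
      rw [hq, map_mul, mul_div_cancel_left₀ _ h0]
      exact sub_mem ⟨_, rfl⟩ ⟨_, rfl⟩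
  constructor
  · rintro ⟨h4, -, h5⟩
    exact ⟨fun I hI => (h1 I).1 (h4 I hI), h3.1 h5⟩
  · rintro ⟨h4, h5⟩
    exact ⟨fun I hI => (h1 I).2 (h4 I hI), h2, h3.2 h5⟩

theorem divForm_injective {f : PolyRing n} (hf : f ≠ 0) : Function.Injective (divForm f) := by
  intro ω ω' h
  ext1 I
  have h1 := congrFun h I
  rw [divForm_apply, divForm_apply, div_left_inj' (coe_ne_zero hf)] at h1
  exact IsFractionRing.injective (PolyRing n) (RatFun n) h1

theorem exists_divForm_eq {f : PolyRing n} (hf : f ≠ 0) {η : RatForm n}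
    (h : IsPolynomialForm (f • η)) : ∃ ω, divForm f ω = η := by
  choose ω hω using h
  refine ⟨ω, funext fun I => ?_⟩
  rw [divForm_apply, hω, Pi.smul_apply, Algebra.smul_def, mul_div_cancel_left₀ _ (coe_ne_zero hf)]

/-- The degree of a fraction with homogeneous denominator. -/
theorem div_mem_ratHomogeneous {f : PolyRing n} {d : ℕ} (hf : f ≠ 0) (hfd : f.IsHomogeneous d)
    (p : PolyRing n) (e : ℤ) : algebraMap (PolyRing n) (RatFun n) p /
      algebraMap (PolyRing n) (RatFun n) f ∈ ratHomogeneous n e ↔ p ∈ polyHomogeneous n (e + d) := by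
  constructor
  · rintro (h | ⟨a, b, q, r, hq, hr, hr0, rfl, h⟩)
    · rw [div_eq_zero_iff, or_iff_left (coe_ne_zero hf), IsFractionRing.to_map_eq_zero_iff] at h
      rw [h]
      exact zero_mem _
    · rw [div_eq_div_iff (coe_ne_zero hf) (coe_ne_zero hr0), ← map_mul, ← map_mul] at h
      have h1 : p * r = q * f := IsFractionRing.injective (PolyRing n) (RatFun n) h
      -- `p r = q f` is homogeneous of degree `a + d`, hence equal to its component of this degree
      have h2 : p * r ∈ polyHomogeneous n (a + d) := by
        rw [h1]
        exact mul_mem_polyHomogeneous (mem_polyHomogeneous_natCast.2 hq)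
          (mem_polyHomogeneous_natCast.2 hfd)
      have h3 := polyComponent_mul_of_mem (mem_polyHomogeneous_natCast.2 hr) (a + d) p
      rw [polyComponent_of_mem h2, if_pos rfl] at h3
      rw [mul_right_cancel₀ hr0 h3, show (a - b + d : ℤ) = a + d - b by ring]
      exact polyComponent_mem _ _
  · intro h
    by_cases hp : p = 0
    · left
      rw [hp, map_zero, zero_div]
    · have h1 : 0 ≤ e + d := by
        by_contra h1
        exact hp (eq_zero_of_mem_polyHomogeneous_neg (by omega) h)
      obtain ⟨a, ha⟩ := Int.eq_ofNat_of_zero_le h1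
      rw [ha] at h
      exact Or.inr ⟨a, d, p, f, mem_polyHomogeneous_natCast.1 h, hfd, hf, by omega, rfl⟩

namespace CentralArrangement

variable (D : CentralArrangement n)

/-- The coefficients of the linear forms of the arrangement. -/
def coeffs (k : Fin D.size) (i : Fin n) : ℂ := D.form k (Pi.single i 1)

theorem form_apply (k : Fin D.size) (v : Fin n → ℂ) : D.form k v = ∑ i, D.coeffs k i * v i := by
  rw [LinearMap.pi_apply_eq_sum_univ (D.form k) v]
  refine Finset.sum_congr rfl fun i _ => ?_
  rw [smul_eq_mul, mul_comm, coeffs]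
  congr 2
  ext j
  simp [Pi.single_apply, eq_comm]

theorem coeffs_ne_zero (k : Fin D.size) : D.coeffs k ≠ 0 := by
  intro h
  refine D.form_ne_zero k (LinearMap.ext fun v => ?_)
  rw [form_apply, h]
  simp

theorem equation_eq : D.equation = ∏ k, linForm n (D.coeffs k) := by
  rw [equation]
  exact Finset.prod_congr rfl fun k _ => (linForm_apply _).symm

theorem equation_ne_zero : D.equation ≠ 0 := by
  rw [equation_eq]
  exact Finset.prod_ne_zero_iff.2 fun k _ => linForm_ne_zero (D.coeffs_ne_zero k)

theorem isHomogeneous_equation : D.equation.IsHomogeneous D.size := by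
  have h := IsHomogeneous.prod Finset.univ (fun k => linForm n (D.coeffs k)) (fun _ => 1)
    fun k _ => mem_polyHomogeneous_natCast.1 (linForm_mem _)
  rw [equation_eq]
  simpa using h

theorem eq_of_linForm_dvd {k l : Fin D.size}
    (h : linForm n (D.coeffs k) ∣ linForm n (D.coeffs l)) : k = l := by
  obtain ⟨a, ha⟩ := exists_smul_eq_of_linForm_dvd h
  have ha0 : a ≠ 0 := by
    rintro rfl
    exact D.coeffs_ne_zero l (by rw [ha, zero_smul])
  refine D.distinct (Submodule.ext fun v => ?_)
  have h1 : D.form l v = a * D.form k v := by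
    rw [form_apply, form_apply, ha, Finset.mul_sum]
    exact Finset.sum_congr rfl fun i _ => by rw [Pi.smul_apply, smul_eq_mul, mul_assoc]
  rw [LinearMap.mem_ker, LinearMap.mem_ker, h1, mul_eq_zero, or_iff_right ha0]

theorem differentialWedge_equation (ω : Finset (Fin n) → PolyRing n) (J : Finset (Fin n)) :
    differentialWedge D.equation ω J =
      ∑ k, (∏ l ∈ Finset.univ.erase k, linForm n (D.coeffs l)) * wedgeForm (D.coeffs k) ω J := by
  have h1 : ∀ k, wedgeForm (D.coeffs k) ω J =
      ∑ i ∈ J, (-1) ^ (J.filter (· < i)).card * (C (D.coeffs k i) * ω (J.erase i)) := by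
    intro k
    rw [wedgeForm_apply, Finset.sum_apply, ← Finset.sum_subset (Finset.subset_univ J)]
    · refine Finset.sum_congr rfl fun i hi => ?_
      rw [Pi.smul_apply, wedge_apply, if_pos hi, koszulSign, MvPolynomial.smul_eq_C_mul,
        zsmul_eq_mul]
      push_cast
      ring
    · intro i _ hi
      rw [Pi.smul_apply, wedge_apply, if_neg hi, smul_zero]
  simp only [h1, differentialWedge, Finset.mul_sum]
  rw [Finset.sum_comm]
  refine Finset.sum_congr rfl fun i _ => ?_
  rw [equation_eq, pderiv_prod_linForm, Finset.sum_mul, Finset.mul_sum]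
  exact Finset.sum_congr rfl fun k _ => by ring

/-- The module `f M^j`. -/
def numerators (j : ℤ) : Submodule (PolyRing n) (Finset (Fin n) → PolyRing n) :=
  logMod D.coeffs D.coeffs Finset.univ ⊓ supportedOn n fun I => (I.card : ℤ) = j

/-- A form `η = ω / f` is logarithmic if and only if every `ℓ_k` divides `ℓ_k ∧ ω`: as
`f dη = dω - df ∧ η`, the condition is that `f` divides
`df ∧ ω = ∑ₖ (∏_{l ≠ k} ℓ_l) dℓ_k ∧ ω`. -/
theorem divForm_mem_logForms_equation (ω : Finset (Fin n) → PolyRing n) (j : ℤ) :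
    divForm D.equation ω ∈ logForms D.equation j ↔ ω ∈ D.numerators j := by
  rw [divForm_mem_logForms D.equation_ne_zero, and_comm]
  refine and_congr ?_ Iff.rfl
  have h1 : ∀ J, D.equation ∣ differentialWedge D.equation ω J ↔
      ∀ k ∈ Finset.univ, linForm n (D.coeffs k) ∣ wedgeForm (D.coeffs k) ω J := by
    intro J
    rw [differentialWedge_equation]
    conv_lhs => rw [equation_eq]
    exact prod_dvd_sum_iff (fun k _ => prime_linForm (D.coeffs_ne_zero k))
      fun k _ l _ h => D.eq_of_linForm_dvd h
  rw [SetLike.mem_coe, mem_logMod]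
  simp only [h1]
  exact ⟨fun h k hk J => h J k hk, fun h J k hk => h k hk J⟩

/-- Division by `f`, as an isomorphism `f M^j ≃ M^j`. -/
def divEquation (j : ℤ) : D.numerators j ≃ₗ[PolyRing n] logForms D.equation j :=
  LinearEquiv.ofBijective
    ((divForm D.equation).restrict fun ω hω => (D.divForm_mem_logForms_equation ω j).2 hω) <| by
    constructor
    · intro ω ω' h
      exact Subtype.ext (divForm_injective D.equation_ne_zero (congrArg Subtype.val h))
    · rintro ⟨η, hη⟩
      obtain ⟨ω, rfl⟩ := exists_divForm_eq D.equation_ne_zero hη.2.1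
      exact ⟨⟨ω, (D.divForm_mem_logForms_equation ω j).1 hη⟩, rfl⟩

theorem divEquation_mem_logGrading (j e : ℤ) (ω : D.numerators j) :
    D.divEquation j ω ∈ logGrading D.equation j e ↔
      (ω : Finset (Fin n) → PolyRing n) ∈ vecHomogeneous n (formDegree n) (e + D.size) := by
  refine forall_congr' fun I => ?_
  rw [show e + D.size - formDegree n I = e - I.card + D.size by rw [formDegree]; ring]
  exact div_mem_ratHomogeneous D.equation_ne_zero D.isHomogeneous_equation _ _

theorem isGradedSubmodule_numerators (j : ℤ) :
    IsGradedSubmodule (formDegree n) (D.numerators j) :=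
  (isGradedSubmodule_logMod _ _ _).inf_supportedOn _

theorem formRank_coeffs {D : CentralArrangement n} (hD : D.IsEssential) :
    formRank D.coeffs Finset.univ = n := by
  rw [formRank, Finset.coe_univ, Set.image_univ]
  have h : Submodule.span ℂ (Set.range D.coeffs) = ⊤ := by
    by_contra hne
    -- a nonzero functional `g` that vanishes on the span gives a point of all hyperplanes
    obtain ⟨g, hg, hle⟩ := Submodule.exists_le_ker_of_lt_top _ (lt_top_iff_ne_top.2 hne)
    have hgv : ∀ v : Fin n → ℂ, g v = ∑ i, v i * g (Pi.single i 1) := by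
      intro v
      rw [LinearMap.pi_apply_eq_sum_univ g v]
      refine Finset.sum_congr rfl fun i _ => ?_
      rw [smul_eq_mul]
      congr 2
      ext j
      simp [Pi.single_apply, eq_comm]
    have h0 : (fun i => g (Pi.single i 1)) ∈ ⨅ k, LinearMap.ker (D.form k) := by
      rw [Submodule.mem_iInf]
      intro k
      rw [LinearMap.mem_ker, form_apply, ← hgv]
      exact hle (Submodule.subset_span ⟨k, rfl⟩)
    rw [hD, Submodule.mem_bot] at h0
    refine hg (LinearMap.ext fun v => ?_)
    rw [hgv]
    simp [fun i => congrFun h0 i]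
  rw [h, finrank_top, Module.finrank_fin_fun]

theorem regularityLE_numerators {D : CentralArrangement n} (hD : D.IsEssential) (j : ℤ) :
    RegularityLE (formDegree n) (D.numerators j) D.size := by
  have h := (resolutionLE_logMod D.coeffs Finset.univ (fun k _ => D.coeffs_ne_zero k) n D.coeffs
    LinearMap.id Function.injective_id (fun _ _ => rfl) (n + 1)).regularityLE
  rw [formRank_coeffs hD, Finset.card_univ, Fintype.card_fin, add_sub_cancel_right] at h
  refine h.inf_supportedOn fun ω hω k hk I => ?_
  -- the exterior product with a 1-form raises the form degree by one
  have h1 : wedgeForm (D.coeffs k) (restrictTo (fun I => (I.card : ℤ) = j) ω) I =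
      restrictTo (fun I => (I.card : ℤ) = j + 1) (wedgeForm (D.coeffs k) ω) I := by
    rw [restrictTo_apply, wedgeForm_apply, wedgeForm_apply, Finset.sum_apply, Finset.sum_apply]
    split_ifs with hI
    · refine Finset.sum_congr rfl fun i _ => ?_
      rw [Pi.smul_apply, Pi.smul_apply, wedge_apply, wedge_apply]
      split_ifs with hi
      · have := Finset.card_erase_add_one hi
        rw [restrictTo_apply, if_pos (by omega)]
      · rfl
    · refine Finset.sum_eq_zero fun i _ => ?_
      rw [Pi.smul_apply, wedge_apply]
      split_ifs with hi
      · have := Finset.card_erase_add_one hi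
        rw [restrictTo_apply, if_neg (by omega), smul_zero, smul_zero]
      · rw [smul_zero]
  rw [h1, restrictTo_apply]
  split_ifs
  · exact hω k hk I
  · exact dvd_zero _

end CentralArrangement

end LogForms

end LogForms

end

/-- For an essential reduced central hyperplane arrangement in `ℂⁿ` and every `j`, the global
algebraic logarithmic `j`-forms are a finitely generated graded module of Castelnuovo-Mumford
regularity at most `0`. -/
theorem corollary3p1 (n : ℕ) (D : LogForms.CentralArrangement n) (hD : D.IsEssential) (j : ℤ) :
    LogForms.IsGradedModule (n := n) (LogForms.logGrading D.equation j) ∧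
      Module.Finite (MvPolynomial (Fin n) ℂ) (LogForms.logForms D.equation j) ∧
      LogForms.regularity (n := n) (LogForms.logGrading D.equation j) ≤ 0 := by
  refine ⟨LogForms.isGradedModule_of_isGradedSubmodule (D.isGradedSubmodule_numerators j)
    (D.divEquation j) (D.divEquation_mem_logGrading j), ?_, ?_⟩
  · exact Module.Finite.equiv (D.divEquation j)
  · have h := LogForms.regularity_le_of_regularityLE (σ := D.size)
      (LogForms.CentralArrangement.regularityLE_numerators hD j) (D.isGradedSubmodule_numerators j)
      (D.divEquation j) fun e ω => (D.divEquation_mem_logGrading j e ω).2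
    rwa [sub_self] at h
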